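/- **Definitions.** *Complexes.* A simple complex of dimension $n$ is a finite CW-complex in which every closed cell is a closed ball and which is the union of its closed $n$-cells; it is given by its poset of cells ($x\le y$ if $x$ lies in the closed cell $y$). Fix a set $S$ of colours. A colored complex is a simple complex with orientations of all cells of positive dimension and colours in $S$ of these cells, such that two different cells of the same positive dimension in one connected component have different colours; isomorphisms preserve cells, orientations and colours. $\Sigma(D,S)$ is the set of isomorphism classes of connected colored complexes of dimension $D$, and $\sigma\mapsto\sigma^*$ is the involution that inverts the orientations. A cyclic complex is a colored complex with a cyclic order on the vertices of each connected component. A cut of it is a connected subspace $\gamma$ of codimension one that avoids the vertices, meets every closed cell either not at all or in a closed ball of codimension one, these balls being the closed cells of a simple complex structure on $\gamma$, and that divides a connected component into two connected components, thereby dividing its vertices into two non-empty groups of consecutive vertices. A brane complex is a cyclic complex in which every division of the vertices of a component into two non-empty groups of consecutive vertices is realized by a cut. Let $D\ge 0$; brane complexes below have dimension $D+1$. The vertex complex $\sigma_q$ of a vertex $q$ is the cut that separates $q$ from the other vertices; its cell inside a cell $\omega$ has the colour of $\omega$ and is oriented as boundary of the part of $\omega$ not containing $q$. We also write $\sigma_q\in\Sigma(D,S)$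 for its class. A cut morphism $\Omega\to\Omega'$ consists of a connected brane complex $\Omega$ with a cut $\gamma$, and the brane complex $\Omega'$ obtained by cutting $\Omega$ along $\gamma$ and contracting the two copies of $\gamma$ to vertices $q_+$, $q_-$, with the induced orientations, colours and cyclic orders; then $\sigma_{q_-}=\sigma_{q_+}^*$, and $\Omega'=\Omega_+\sqcup\Omega_-$ with $\Omega_\pm$ connected and $q_\pm\in\Omega_\pm$. *Brane Topological Field Theories.* Let $K$ be a field of characteristic $0$, let $B_\sigma$ ($\sigma\in\Sigma(D,S)$) be finite-dimensional $K$-vector spaces, and put $V_\Omega=\bigotimes_q B_{\sigma_q}$, over the vertices $q$ of $\Omega$. A family of linear forms $\Phi_\Omega:V_\Omega\to K$, for all brane complexes $\Omega$, is a Brane Topological Field Theory with tensors $\kappa_\sigma\in B_\sigma\otimes B_{\sigma^*}$ and pairings $\eta_\sigma:B_\sigma\times B_{\sigma^*}\to K$ if: (1) $\Phi$ is invariant under isomorphisms of brane complexes; (2) all $\eta_\sigma$ are non-degenerate, and $\Phi_\Omega(x_1\otimes x_2)=\eta_{\sigma_{q_1}}(x_1,x_2)$ if $\Omega$ has exactly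 two vertices $q_1,q_2$; (3) $\Phi_{\Omega'}(x\otimes\kappa_{\sigma_{q_+}})=\Phi_\Omega(x)$ for every cut morphism $\Omega\to\Omega'$; (4) $\Phi_{\Omega_1\sqcup\Omega_2}(x_1\otimes x_2)=\Phi_{\Omega_1}(x_1)\Phi_{\Omega_2}(x_2)$. *Colored Frobenius Algebras.* Such a structure on $B_*=\bigoplus_\sigma B_\sigma$ consists of non-degenerate pairings $\eta_\sigma:B_\sigma\times B_{\sigma^*}\to K$ (the other components of the bilinear form on $B_*$ being zero) and, for every connected brane complex $\Omega$ with three vertices, a trilinear form $(\cdot,\cdot,\cdot)_\Omega$ on the spaces of its vertices, invariant under isomorphisms of $\Omega$, with the following associativity: for every connected brane complex $\Omega$ with four vertices $q_1,q_2,q_3,q_4$ in cyclic order, $x_k\in B_{\sigma_{q_k}}$, and cut morphisms at cuts that separate $\{q_1,q_2\}$ (with parts $\Omega_+,\Omega_-$) and $\{q_4,q_1\}$ (with parts $\Omega'_+,\Omega'_-$) from the other vertices, $$\sum_{i,j}(x_1,x_2,b_i)_{\Omega_+}F^{ij}(b'_j,x_3,x_4)_{\Omega_-}=\sum_{i,j}(x_4,x_1,c_i)_{\Omega'_+}G^{ij}(c'_j,x_2,x_3)_{\Omega'_-},$$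 where $b,b'$ and $c,c'$ are bases of the spaces of the new vertices and $F,G$ are the inverse matrices of the matrices of the pairing in these bases (indexed so that $\sum F^{ij}b_i\otimes b'_j$ is the tensor inverse to the pairing). *Coverings.* Let $d\ge 0$. A simple $d$-covering $f:\widetilde\Omega\to\Omega$ of a simple complex is a branched covering of degree $d$ (that is, $f$ has a continuous transfer $t:\Omega\to\mathrm{Sym}^d(\widetilde\Omega)$ with $x\in t(f(x))$ and $\mathrm{Sym}^d(f)(t(y))=d\,y$) from a simple complex, mapping each closed cell homeomorphically onto a closed cell, with exactly $d$ cells over every cell of maximal dimension. Isomorphisms of coverings of $\Omega$ are cell-preserving isomorphisms of the covering spaces over the identity of $\Omega$; $\mathrm{Aut}(f)$ is the automorphism group (acting on the cells). Equivalences of coverings of colored complexes are isomorphisms of the covering spaces over isomorphisms of the colored base complexes. $\Upsilon^d_\sigma$ is the set of equivalence classes of simple $d$-coverings of complexes of class $\sigma$, $C^d_\sigma$ is the $K$-vector space with basis $\Upsilon^d_\sigma$, and $\beta\mapsto\beta^*$, $\Upsilon_\sigma^d\to\Upsilon_{\sigma^*}^d$, inverts the orientations of the base. A simple $d$-covering of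 a brane complex $\Omega$ induces a covering of each $\sigma_q$, whose class in $\Upsilon^d_{\sigma_q}$ is its local invariant at $q$. The Hurwitz number $H^d(\Omega,\{\beta_q\})$ is the sum of $1/|\mathrm{Aut} f|$ over the isomorphism classes of simple $d$-coverings $f$ of $\Omega$ with local invariants $\beta_q$. Call $f$ *unglued* if the punctured star of every vertex of $\widetilde\Omega$ is connected, i.e. if the vertices over $q$ correspond to the connected components of the induced covering of $\sigma_q$; let $H^d_{\circ}(\Omega,\{\beta_q\})$ be the same sum over the unglued coverings only. Both families of numbers define linear forms on the spaces $V_\Omega=\bigotimes_q C^d_{\sigma_q}$, by their values on the basis tensors. **Theorem 4.1.** Let $K$ be a field of characteristic $0$, $S$ a set, and $D,d\ge0$. 1. Every brane complex has finitely many isomorphism classes of simple $d$-coverings. 2. The linear forms given by $H^d$ are a Brane Topological Field Theory on the spaces $C^d_\sigma$, for suitable tensors $\kappa_\sigma$ and pairings $\eta_\sigma$; these pairings, together with the values of the linear forms on the connected brane complexes with three vertices, form a Colored Frobenius Algebra on $C^d_*=\bigoplus_\sigma C^d_\sigma$. 3. The same holds for $H^d_\circ$, with $$\kappa_\sigma=\sum_{\beta\in\Upsilon^d_\sigma}|\mathrm{Aut}\,\beta|\;\beta\otimes\beta^*,\qquad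 \eta_\sigma(\beta,\gamma)=\frac{\delta_{\gamma,\beta^*}}{|\mathrm{Aut}\,\beta|}.$$ 4. For every cut morphism from $\Omega$, with cut of class $\sigma=\sigma_{q_+}$ and parts $\Omega_+,\Omega_-$, and for all local invariants, $$H^d_\circ(\Omega,\{\beta_q\})=\sum_{\beta\in\Upsilon^d_\sigma}|\mathrm{Aut}\,\beta|\;H^d_\circ(\Omega_+,\{\beta_q\}_{q\in\Omega_+},\beta)\;H^d_\circ(\Omega_-,\beta^*,\{\beta_q\}_{q\in\Omega_-}).$$ -/

import Mathlib

open scoped TensorProduct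

/-- The geometric realization of the order complex of a finite poset, in barycentric coordinates:
formal convex combinations of elements whose support is a chain. -/
def orderRealization (P : Type*) [PartialOrder P] : Set (P → ℝ) :=
  {w | (∀ p, 0 ≤ w p) ∧ ∑ᶠ p, w p = 1 ∧ ∀ p q, w p ≠ 0 → w q ≠ 0 → p ≤ q ∨ q ≤ p}

/-- The realization of the finite poset `P` is homeomorphic to the sphere of dimension `n - 1`
(the unit sphere of `ℝⁿ`; it is empty for `n = 0`). -/
def IsSpherePoset (P : Type*) [PartialOrder P] (n : ℕ) : Prop :=
  Nonempty (orderRealization P ≃ₜ Metric.sphere (0 : EuclideanSpace ℝ (Fin n)) 1)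

/-- A poset of cells is connected: it is non-empty and any two cells are joined by a sequence of
cells in which consecutive ones are incident. -/
def CellsConnected (P : Type*) [PartialOrder P] : Prop :=
  Nonempty P ∧ ∀ x y : P, Relation.EqvGen (· ≤ ·) x y

theorem orderRealization_mem {P Q : Type*} [PartialOrder P] [PartialOrder Q] (e : P ≃o Q)
    {w : P → ℝ} (hw : w ∈ orderRealization P) :
    (fun q => w (e.symm q)) ∈ orderRealization Q := by
  refine ⟨fun q => hw.1 _, ?_, fun p q hp hq => ?_⟩
  · rw [← hw.2.1]
    exact finsum_comp_equiv e.symm.toEquiv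
  · simpa using hw.2.2 _ _ hp hq

theorem orderRealization_homeo {P Q : Type*} [PartialOrder P] [PartialOrder Q] (e : P ≃o Q) :
    Nonempty (orderRealization P ≃ₜ orderRealization Q) := by
  have h1 : Continuous fun (w : orderRealization P) (q : Q) => w.1 (e.symm q) :=
    continuous_pi fun q => (continuous_apply (e.symm q)).comp continuous_subtype_val
  have h2 : Continuous fun (w : orderRealization Q) (p : P) => w.1 (e p) :=
    continuous_pi fun p => (continuous_apply (e p)).comp continuous_subtype_val
  exact ⟨{ toFun := fun w => ⟨fun q => w.1 (e.symm q), orderRealization_mem e w.2⟩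
           invFun := fun w => ⟨fun p => w.1 (e p), orderRealization_mem e.symm w.2⟩
           left_inv := fun w => by ext; simp
           right_inv := fun w => by ext; simp
           continuous_toFun := h1.subtype_mk _
           continuous_invFun := h2.subtype_mk _ }⟩

theorem IsSpherePoset.of_iso {P Q : Type*} [PartialOrder P] [PartialOrder Q] (e : P ≃o Q) {n : ℕ}
    (h : IsSpherePoset P n) : IsSpherePoset Q n := by
  obtain ⟨f⟩ := h
  obtain ⟨g⟩ := orderRealization_homeo e
  exact ⟨g.symm.trans f⟩

/-- A simple CW-complex of dimension `n`, given by its poset of cells: `x ≤ y` means that the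
cell `x` lies in the closed cell `y`.  The boundary of a closed cell `x` is the realization of
the poset of the cells strictly below `x`, so `sphere` says that the closed cell is a ball of
dimension `dim x`; `pure` says that the complex is the union of its closed `n`-cells. -/
structure SimpleComplex (n : ℕ) where
  Cell : Type
  [order : PartialOrder Cell]
  [finite : Finite Cell]
  dim : Cell → ℕ
  dim_covBy : ∀ {x y : Cell}, x ⋖ y → dim y = dim x + 1
  sphere : ∀ x : Cell, IsSpherePoset {y : Cell // y < x} (dim x)
  pure : ∀ x : Cell, ∃ y, x ≤ y ∧ dim y = n

attribute [instance] SimpleComplex.order SimpleComplex.finite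

namespace SimpleComplex

variable {n : ℕ} (X : SimpleComplex n)

/-- The vertices of a complex: its cells of dimension zero. -/
abbrev Vertex : Type := {x : X.Cell // X.dim x = 0}

/-- Two cells lie in the same connected component. -/
def Joined (x y : X.Cell) : Prop := Relation.EqvGen (· ≤ ·) x y

theorem exists_covBy_le {x y : X.Cell} (h : x < y) : ∃ z, x ⋖ z ∧ z ≤ y := by
  classical
  have := Fintype.ofFinite X.Cell
  let _ : LocallyFiniteOrder X.Cell := Fintype.toLocallyFiniteOrder
  exact exists_covBy_le_of_lt h

theorem dim_lt {x y : X.Cell} (h : x < y) : X.dim x < X.dim y := by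
  induction y using (wellFounded_lt (α := X.Cell)).induction generalizing x with
  | _ y ih =>
    classical
    have := Fintype.ofFinite X.Cell
    let _ : LocallyFiniteOrder X.Cell := Fintype.toLocallyFiniteOrder
    obtain ⟨z, hz, hzy⟩ := exists_le_covBy_of_lt h
    rcases hz.eq_or_lt with rfl | hlt
    · have := X.dim_covBy hzy; omega
    · have := ih z hzy.lt hlt
      have := X.dim_covBy hzy
      omega

theorem dim_mono {x y : X.Cell} (h : x ≤ y) : X.dim x ≤ X.dim y := by
  rcases h.eq_or_lt with rfl | h
  · rfl
  · exact (X.dim_lt h).le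

/-- A closed edge has a vertex different from a given one. -/
theorem exists_other_vertex (q : X.Vertex) {x : X.Cell} (h : q.1 < x) :
    ∃ v : X.Vertex, v ≠ q ∧ v.1 < x := by
  obtain ⟨e, hqe, hex⟩ := X.exists_covBy_le h
  have he : X.dim e = 1 := by rw [X.dim_covBy hqe, q.2]
  suffices ∃ v : X.Vertex, v ≠ q ∧ v.1 < e by
    obtain ⟨v, hv, hve⟩ := this
    exact ⟨v, hv, hve.trans_le hex⟩
  by_contra hcon
  push Not at hcon
  have hun : ∀ y : {y : X.Cell // y < e}, y = ⟨q.1, hqe.lt⟩ := by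
    rintro ⟨y, hy⟩
    have h0 : X.dim y = 0 := by have := X.dim_lt hy; omega
    by_contra hne
    exact hcon ⟨y, h0⟩ (fun h => hne (Subtype.ext (congrArg (fun v : X.Vertex => v.1) h))) hy
  obtain ⟨f⟩ := X.sphere e
  rw [he] at f
  have hsub : Subsingleton (orderRealization {y : X.Cell // y < e}) := by
    refine ⟨fun w w' => Subtype.ext (funext fun y => ?_)⟩
    have : Unique {y : X.Cell // y < e} := ⟨⟨⟨q.1, hqe.lt⟩⟩, hun⟩
    have h1 := w.2.2.1
    have h2 := w'.2.2.1
    rw [finsum_unique] at h1 h2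
    rw [Unique.eq_default y, h1, h2]
  let p : EuclideanSpace ℝ (Fin 1) := EuclideanSpace.single 0 1
  have hp : p ∈ Metric.sphere (0 : EuclideanSpace ℝ (Fin 1)) 1 := by simp [p]
  have hp' : -p ∈ Metric.sphere (0 : EuclideanSpace ℝ (Fin 1)) 1 := by simp [p]
  have := congrArg Subtype.val (f.symm.injective (hsub.elim (f.symm ⟨p, hp⟩) (f.symm ⟨-p, hp'⟩)))
  have := congrArg (fun v : EuclideanSpace ℝ (Fin 1) => v 0) this
  simp [p] at this
  norm_num at this

end SimpleComplex

/-- An oriented complex coloured by `S`.  The orientations of the cells of positive dimension are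
recorded by the incidence numbers `inc x y = ±1` of a cell `x` with its faces `y` of codimension
one (points are positively oriented; the values for other pairs carry no information).
Two different cells of the same positive dimension in the same connected component have different
colours. -/
structure ColoredComplex (n : ℕ) (S : Type*) extends SimpleComplex n where
  inc : Cell → Cell → ℤˣ
  inc_diamond : ∀ {x y y' z : Cell}, z < y → y < x → z < y' → y' < x → dim x = dim z + 2 →
    y ≠ y' → inc x y * inc y z = -(inc x y' * inc y' z)
  inc_edge : ∀ {x v v' : Cell}, dim x = 1 → v < x → v' < x → v ≠ v' → inc x v = -inc x v'
  color : (x : Cell) → 0 < dim x → S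
  color_inj : ∀ {x y : Cell} (hx : 0 < dim x) (hy : 0 < dim y), Relation.EqvGen (· ≤ ·) x y →
    dim x = dim y → color x hx = color y hy → x = y

namespace ColoredComplex

variable {n : ℕ} {S : Type*}

/-- An isomorphism of coloured complexes preserves cells, orientations and colours. -/
structure Iso (X Y : ColoredComplex n S) where
  toOrderIso : X.Cell ≃o Y.Cell
  dim_eq : ∀ x, Y.dim (toOrderIso x) = X.dim x
  inc_eq : ∀ {x y}, y ⋖ x → Y.inc (toOrderIso x) (toOrderIso y) = X.inc x y
  color_eq : ∀ x (h : 0 < X.dim x) (h' : 0 < Y.dim (toOrderIso x)),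
    Y.color (toOrderIso x) h' = X.color x h

def Iso.refl (X : ColoredComplex n S) : Iso X X where
  toOrderIso := OrderIso.refl _
  dim_eq _ := rfl
  inc_eq _ := rfl
  color_eq _ _ _ := rfl

def Iso.symm {X Y : ColoredComplex n S} (φ : Iso X Y) : Iso Y X where
  toOrderIso := φ.toOrderIso.symm
  dim_eq y := by
    have := φ.dim_eq (φ.toOrderIso.symm y)
    simpa using this.symm
  inc_eq {x y} h := by
    have := φ.inc_eq (x := φ.toOrderIso.symm x) (y := φ.toOrderIso.symm y)
      ((apply_covBy_apply_iff φ.toOrderIso.symm).mpr h)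
    simpa using this.symm
  color_eq y h h' := by
    obtain ⟨x, rfl⟩ := φ.toOrderIso.surjective y
    have := φ.color_eq x (by simpa [φ.dim_eq x] using h) h
    simpa using this.symm

def Iso.trans {X Y Z : ColoredComplex n S} (φ : Iso X Y) (ψ : Iso Y Z) : Iso X Z where
  toOrderIso := φ.toOrderIso.trans ψ.toOrderIso
  dim_eq x := (ψ.dim_eq _).trans (φ.dim_eq x)
  inc_eq h := (ψ.inc_eq ((apply_covBy_apply_iff φ.toOrderIso).mpr h)).trans (φ.inc_eq h)
  color_eq x h h' := by
    have h1 : 0 < Y.dim (φ.toOrderIso x) := by rw [φ.dim_eq x]; exact h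
    exact (ψ.color_eq _ h1 h').trans (φ.color_eq x h h1)

def Connected (X : ColoredComplex n S) : Prop := CellsConnected X.Cell

/-- The complex with the opposite orientations of all cells of positive dimension. -/
def star (X : ColoredComplex n S) : ColoredComplex n S where
  toSimpleComplex := X.toSimpleComplex
  inc x y := if X.dim y = 0 then -X.inc x y else X.inc x y
  inc_diamond {x y y' z} hzy hyx hzy' hyx' hd hne := by
    have h := X.inc_diamond hzy hyx hzy' hyx' hd hne
    have h1 : X.dim y ≠ 0 := by have := X.dim_lt hzy; omega
    have h2 : X.dim y' ≠ 0 := by have := X.dim_lt hzy'; omega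
    by_cases h0 : X.dim z = 0 <;> simp [h0, h1, h2, h]
  inc_edge {x v v'} hx hv hv' hne := by
    have h1 : X.dim v = 0 := by have := X.dim_lt hv; omega
    have h2 : X.dim v' = 0 := by have := X.dim_lt hv'; omega
    simp [h1, h2, X.inc_edge hx hv hv' hne]
  color := X.color
  color_inj := X.color_inj

def Iso.star {X Y : ColoredComplex n S} (φ : Iso X Y) : Iso X.star Y.star where
  toOrderIso := φ.toOrderIso
  dim_eq := φ.dim_eq
  inc_eq {x y} h := by
    have h1 : Y.inc (φ.toOrderIso x) (φ.toOrderIso y) = X.inc x y := φ.inc_eq h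
    have h2 : Y.dim (φ.toOrderIso y) = X.dim y := φ.dim_eq y
    change (if Y.dim (φ.toOrderIso y) = 0 then -Y.inc (φ.toOrderIso x) (φ.toOrderIso y) else
      Y.inc (φ.toOrderIso x) (φ.toOrderIso y)) = if X.dim y = 0 then -X.inc x y else X.inc x y
    exact h1 ▸ h2 ▸ rfl
  color_eq := φ.color_eq

end ColoredComplex

/-- Connected coloured complexes. -/
abbrev ConnColored (n : ℕ) (S : Type*) := {X : ColoredComplex n S // X.Connected}

instance ConnColored.setoid (n : ℕ) (S : Type*) : Setoid (ConnColored n S) where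
  r X Y := Nonempty (ColoredComplex.Iso X.1 Y.1)
  iseqv := ⟨fun X => ⟨.refl X.1⟩, fun ⟨φ⟩ => ⟨φ.symm⟩, fun ⟨φ⟩ ⟨ψ⟩ => ⟨φ.trans ψ⟩⟩

/-- The set `Σ(n, S)` of isomorphism classes of connected coloured complexes of dimension `n`. -/
def ColoredClass (n : ℕ) (S : Type*) := Quotient (ConnColored.setoid n S)

/-- The involution `σ ↦ σ*` which inverts the orientations. -/
def ColoredClass.star {n : ℕ} {S : Type*} : ColoredClass n S → ColoredClass n S :=
  Quotient.map (fun X => ⟨X.1.star, X.2⟩) (fun _ _ ⟨φ⟩ => ⟨φ.star⟩)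

/-- A coloured complex with a cyclic order on the vertices of each connected component, given by
the permutation `next` which takes a vertex to its successor: its cycles are the sets of vertices
of the connected components. -/
structure CyclicComplex (n : ℕ) (S : Type*) extends ColoredComplex n S where
  next : Equiv.Perm {x : Cell // dim x = 0}
  next_sameCycle : ∀ v w, next.SameCycle v w ↔ Relation.EqvGen (· ≤ ·) v.1 w.1

namespace CyclicComplex

variable {n : ℕ} {S : Type*} (Ω : CyclicComplex n S)

/-- `A` and its complement divide the vertices of a connected component into two non-empty groups
compatible with the cyclic order: `A` consists of `k` consecutive vertices. -/
def IsDivision (A : Set Ω.Vertex) : Prop :=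
  (∃ (q : Ω.Vertex) (k : ℕ), 0 < k ∧ A = {v | ∃ i < k, (Ω.next ^ i) q = v}) ∧
    ∃ a ∈ A, ∃ b ∉ A, Ω.Joined a.1 b.1

/-- The closed cell `x` has vertices both in `A` and outside of `A`. -/
def Crosses (A : Set Ω.Vertex) (x : Ω.Cell) : Prop :=
  (∃ a ∈ A, a.1 ≤ x) ∧ ∃ b ∉ A, b.1 ≤ x

/-- There is a cut which separates the vertices in `A` from the other vertices of their component.
Such a cut meets exactly the closed cells that have vertices on both sides, and meets every one of
them in a closed ball of codimension one; its cells are these intersections, so that its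
poset of cells is the poset of the crossing cells, in which dimensions drop by one.
Conversely, if the crossing cells form a regular CW-complex in this way, then the locus that
separates the two groups of vertices in the barycentric subdivision is such a cut. -/
structure IsCut (A : Set Ω.Vertex) : Prop where
  division : Ω.IsDivision A
  ball : ∀ x, Ω.Crosses A x → IsSpherePoset {y : Ω.Cell // Ω.Crosses A y ∧ y < x} (Ω.dim x - 1)
  connected : CellsConnected {x : Ω.Cell // Ω.Crosses A x}
  inside : CellsConnected {x : Ω.Cell // ∀ v : Ω.Vertex, v.1 ≤ x → v ∈ A}
  outside : CellsConnected {x : Ω.Cell // (∃ a ∈ A, Ω.Joined a.1 x) ∧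
    ∀ v : Ω.Vertex, v.1 ≤ x → v ∉ A}

end CyclicComplex

/-- A brane complex of dimension `D + 1`: a cyclic complex in which every division of the vertices
of a component that is compatible with the cyclic order is realized by a cut. -/
structure BraneComplex (D : ℕ) (S : Type*) extends CyclicComplex (D + 1) S where
  exists_cut : ∀ A, toCyclicComplex.IsDivision A → toCyclicComplex.IsCut A

namespace BraneComplex

variable {D : ℕ} {S : Type*} (Ω : BraneComplex D S)

theorem exists_gt (q : Ω.Vertex) : ∃ x, q.1 < x := by
  obtain ⟨y, hy, hd⟩ := Ω.pure q.1
  refine ⟨y, lt_of_le_of_ne hy fun h => ?_⟩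
  have := q.2
  rw [h] at this
  omega

theorem crosses_singleton (q : Ω.Vertex) (x : Ω.Cell) : Ω.Crosses {q} x ↔ q.1 < x := by
  constructor
  · rintro ⟨⟨a, ha, hax⟩, b, hb, hbx⟩
    obtain rfl : a = q := ha
    refine lt_of_le_of_ne hax fun h => hb ?_
    subst h
    have hne : ¬ b.1 < a.1 := fun h => by have := Ω.dim_lt h; have := a.2; omega
    exact Subtype.ext (hbx.eq_of_not_lt hne)
  · intro h
    obtain ⟨v, hv, hvx⟩ := Ω.exists_other_vertex q h
    exact ⟨⟨q, rfl, h.le⟩, v, hv, hvx.le⟩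

theorem isCut_singleton (q : Ω.Vertex) : Ω.IsCut {q} := by
  refine Ω.exists_cut _ ⟨⟨q, 1, one_pos, ?_⟩, ?_⟩
  · ext v
    simp [eq_comm]
  · obtain ⟨x, hx⟩ := Ω.exists_gt q
    obtain ⟨v, hv, hvx⟩ := Ω.exists_other_vertex q hx
    exact ⟨q, rfl, v, hv, .trans _ _ _ (.rel _ _ hx.le) (.symm _ _ (.rel _ _ hvx.le))⟩

/-- The vertex complex of `q`, that is, the cut which separates `q` from the other vertices.  Its
cells are the intersections of the cut with the cells `x > q`; such an intersection is oriented as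
a boundary of the part of `x` that does not contain `q`, and has the colour of `x`. -/
def vertexComplex (q : Ω.Vertex) : ColoredComplex D S where
  Cell := {x : Ω.Cell // q.1 < x}
  dim x := Ω.dim x.1 - 1
  dim_covBy {x y} h := by
    have h' : x.1 ⋖ y.1 := ⟨h.1, fun z hxz hzy => h.2 (c := ⟨z, x.2.trans hxz⟩) hxz hzy⟩
    have h1 := Ω.dim_covBy h'
    have h2 := Ω.dim_lt x.2
    omega
  sphere x := by
    refine ((Ω.isCut_singleton q).ball x.1 ((Ω.crosses_singleton q _).mpr x.2)).of_iso
      { toFun := fun y => ⟨⟨y.1, (Ω.crosses_singleton q _).mp y.2.1⟩, y.2.2⟩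
        invFun := fun y => ⟨y.1.1, (Ω.crosses_singleton q _).mpr y.1.2, y.2⟩
        left_inv := fun _ => rfl
        right_inv := fun _ => rfl
        map_rel_iff' := Iff.rfl }
  pure x := by
    obtain ⟨y, hy, hd⟩ := Ω.pure x.1
    exact ⟨⟨y, x.2.trans_le hy⟩, hy, by simp [hd]⟩
  inc x y := if Ω.dim y.1 = 1 then -(Ω.inc x.1 y.1 * Ω.inc y.1 q.1) else -Ω.inc x.1 y.1
  inc_diamond {x y y' z} hzy hyx hzy' hyx' hd hne := by
    have h0 := Ω.dim_lt z.2
    have h1 := Ω.dim_lt (show z.1 < y.1 from hzy)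
    have h2 := Ω.dim_lt (show z.1 < y'.1 from hzy')
    have h3 := Ω.inc_diamond (x := x.1) (y := y.1) (y' := y'.1) (z := z.1) hzy hyx hzy' hyx'
      (by omega) (fun h => hne (Subtype.ext h))
    have h4 : Ω.dim y.1 ≠ 1 := by omega
    have h5 : Ω.dim y'.1 ≠ 1 := by omega
    by_cases h6 : Ω.dim z.1 = 1
    · simp only [h4, h5, h6, if_true, if_false, neg_mul_neg]
      rw [← mul_assoc, ← mul_assoc, h3, neg_mul]
    · simp only [h4, h5, h6, if_false, neg_mul_neg, h3]
  inc_edge {x v v'} hx hv hv' hne := by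
    have h1 := Ω.dim_lt (show v.1 < x.1 from hv)
    have h2 := Ω.dim_lt (show v'.1 < x.1 from hv')
    have h3 := Ω.dim_lt v.2
    have h4 := Ω.dim_lt v'.2
    have h5 := q.2
    have h6 : Ω.dim v.1 = 1 := by omega
    have h7 : Ω.dim v'.1 = 1 := by omega
    simp only [h6, h7, if_true]
    rw [Ω.inc_diamond v.2 hv v'.2 hv' (by omega) (fun h => hne (Subtype.ext h))]
  color x h := Ω.color x.1 (by omega)
  color_inj {x y} hx hy h hd hc := by
    have hj : Relation.EqvGen (· ≤ ·) x.1 y.1 := by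
      clear hd hc hx hy
      induction h with
      | rel a b h => exact .rel _ _ h
      | refl a => exact .refl _
      | symm a b _ ih => exact .symm _ _ ih
      | trans a b c _ _ ih1 ih2 => exact .trans _ _ _ ih1 ih2
    exact Subtype.ext (Ω.color_inj (by omega) (by omega) hj (by omega) hc)

theorem vertexComplex_connected (q : Ω.Vertex) : (Ω.vertexComplex q).Connected := by
  obtain ⟨⟨x⟩, h⟩ := (Ω.isCut_singleton q).connected
  refine ⟨⟨⟨x.1, (Ω.crosses_singleton q _).mp x.2⟩⟩, fun a b => ?_⟩
  have key : ∀ a b : {x : Ω.Cell // Ω.Crosses {q} x}, Relation.EqvGen (· ≤ ·) a b →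
      Relation.EqvGen (· ≤ ·) (⟨a.1, (Ω.crosses_singleton q _).mp a.2⟩ : {x : Ω.Cell // q.1 < x})
        ⟨b.1, (Ω.crosses_singleton q _).mp b.2⟩ := by
    intro a b h
    induction h with
    | rel a b h => exact .rel _ _ h
    | refl a => exact .refl _
    | symm a b _ ih => exact .symm _ _ ih
    | trans a b c _ _ ih1 ih2 => exact .trans _ _ _ ih1 ih2
  exact key ⟨a.1, (Ω.crosses_singleton q _).mpr a.2⟩ ⟨b.1, (Ω.crosses_singleton q _).mpr b.2⟩
    (h _ _)

/-- The class `σ_q` of the vertex complex of `q`. -/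
def cls (q : Ω.Vertex) : ColoredClass D S :=
  Quotient.mk _ ⟨Ω.vertexComplex q, Ω.vertexComplex_connected q⟩

end BraneComplex

namespace BraneComplex

variable {D : ℕ} {S : Type*}

/-- A bijection between the cells around two vertices which preserves all structure induces an
isomorphism of the vertex complexes. -/
theorem cls_eq_of_orderIso {Ω Ω' : BraneComplex D S} {q : Ω.Vertex} {q' : Ω'.Vertex}
    (φ : {x : Ω.Cell // q.1 < x} ≃o {y : Ω'.Cell // q'.1 < y})
    (hdim : ∀ x, Ω'.dim (φ x).1 = Ω.dim x.1)
    (hinc : ∀ x y, y.1 ⋖ x.1 → Ω'.inc (φ x).1 (φ y).1 = Ω.inc x.1 y.1)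
    (hinc0 : ∀ x, Ω.dim x.1 = 1 → Ω'.inc (φ x).1 q'.1 = Ω.inc x.1 q.1)
    (hcolor : ∀ x h h', Ω'.color (φ x).1 h' = Ω.color x.1 h) :
    Ω.cls q = Ω'.cls q' := by
  have h1 : ∀ x : {x : Ω.Cell // q.1 < x}, Ω'.dim (φ x).1 - 1 = Ω.dim x.1 - 1 := fun x => by
    rw [hdim]
  have h2 : ∀ x y : {x : Ω.Cell // q.1 < x}, y ⋖ x →
      (if Ω'.dim (φ y).1 = 1 then -(Ω'.inc (φ x).1 (φ y).1 * Ω'.inc (φ y).1 q'.1)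
        else -Ω'.inc (φ x).1 (φ y).1) =
      if Ω.dim y.1 = 1 then -(Ω.inc x.1 y.1 * Ω.inc y.1 q.1) else -Ω.inc x.1 y.1 := by
    intro x y h
    have h' : y.1 ⋖ x.1 := ⟨h.1, fun z hxz hzy => h.2 (c := ⟨z, y.2.trans hxz⟩) hxz hzy⟩
    rw [hdim, hinc x y h']
    split_ifs with h1
    · rw [hinc0 y h1]
    · rfl
  exact Quotient.sound ⟨⟨φ, h1, fun {x y} h => h2 x y h, fun x h h' => hcolor _ _ _⟩⟩

theorem star_cls_eq_of_orderIso {Ω Ω' : BraneComplex D S} {q : Ω.Vertex} {q' : Ω'.Vertex}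
    (φ : {x : Ω.Cell // q.1 < x} ≃o {y : Ω'.Cell // q'.1 < y})
    (hdim : ∀ x, Ω'.dim (φ x).1 = Ω.dim x.1)
    (hinc : ∀ x y, y.1 ⋖ x.1 → Ω'.inc (φ x).1 (φ y).1 = Ω.inc x.1 y.1)
    (hinc0 : ∀ x, Ω.dim x.1 = 1 → Ω'.inc (φ x).1 q'.1 = -Ω.inc x.1 q.1)
    (hcolor : ∀ x h h', Ω'.color (φ x).1 h' = Ω.color x.1 h) :
    (Ω.cls q).star = Ω'.cls q' := by
  have h1 : ∀ x : {x : Ω.Cell // q.1 < x}, Ω'.dim (φ x).1 - 1 = Ω.dim x.1 - 1 := fun x => by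
    rw [hdim]
  have h2 : ∀ x y : {x : Ω.Cell // q.1 < x}, y ⋖ x →
      (if Ω'.dim (φ y).1 = 1 then -(Ω'.inc (φ x).1 (φ y).1 * Ω'.inc (φ y).1 q'.1)
        else -Ω'.inc (φ x).1 (φ y).1) =
      if Ω.dim y.1 - 1 = 0 then
        -(if Ω.dim y.1 = 1 then -(Ω.inc x.1 y.1 * Ω.inc y.1 q.1) else -Ω.inc x.1 y.1)
      else (if Ω.dim y.1 = 1 then -(Ω.inc x.1 y.1 * Ω.inc y.1 q.1) else -Ω.inc x.1 y.1) := by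
    intro x y h
    have h' : y.1 ⋖ x.1 := ⟨h.1, fun z hxz hzy => h.2 (c := ⟨z, y.2.trans hxz⟩) hxz hzy⟩
    have h0 := Ω.dim_lt y.2
    rw [hdim, hinc x y h']
    by_cases h1 : Ω.dim y.1 = 1
    · simp [h1, hinc0 y h1]
    · have h2 : Ω.dim y.1 - 1 ≠ 0 := by omega
      simp [h1, h2]
  exact Quotient.sound ⟨⟨φ, h1, fun {x y} h => h2 x y h, fun x h h' => hcolor _ _ _⟩⟩

/-- If a brane complex has only two vertices, then their vertex complexes differ by the inversion
of the orientations. -/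
theorem star_cls_eq_of_two {Ω : BraneComplex D S} {q₁ q₂ : Ω.Vertex} (hne : q₁ ≠ q₂)
    (h : ∀ v, v = q₁ ∨ v = q₂) : (Ω.cls q₁).star = Ω.cls q₂ := by
  have key : ∀ x, q₁.1 < x ↔ q₂.1 < x := by
    intro x
    constructor
    · intro hx
      obtain ⟨v, hv, hvx⟩ := Ω.exists_other_vertex q₁ hx
      rcases h v with rfl | rfl
      · exact absurd rfl hv
      · exact hvx
    · intro hx
      obtain ⟨v, hv, hvx⟩ := Ω.exists_other_vertex q₂ hx
      rcases h v with rfl | rfl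
      · exact hvx
      · exact absurd rfl hv
  refine star_cls_eq_of_orderIso
    { toFun := fun x => ⟨x.1, (key _).mp x.2⟩
      invFun := fun x => ⟨x.1, (key _).mpr x.2⟩
      left_inv := fun _ => rfl
      right_inv := fun _ => rfl
      map_rel_iff' := Iff.rfl } (fun _ => rfl) (fun _ _ _ => rfl) (fun x hx => ?_)
      (fun _ _ _ => rfl)
  exact Ω.inc_edge hx ((key _).mp x.2) x.2 (fun h => hne (Subtype.ext h.symm))

/-- The image of a vertex under an isomorphism. -/
def mapVertex {Ω Ω' : BraneComplex D S}
    (φ : ColoredComplex.Iso Ω.toColoredComplex Ω'.toColoredComplex) (v : Ω.Vertex) : Ω'.Vertex :=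
  ⟨φ.toOrderIso v.1, (φ.dim_eq v.1).trans v.2⟩

/-- An isomorphism of brane complexes is an isomorphism of coloured complexes which preserves
the cyclic orders. -/
structure Iso (Ω Ω' : BraneComplex D S) extends
    ColoredComplex.Iso Ω.toColoredComplex Ω'.toColoredComplex where
  next_eq : ∀ v : Ω.Vertex, Ω'.next (mapVertex toIso v) = mapVertex toIso (Ω.next v)

theorem Iso.cls_eq {Ω Ω' : BraneComplex D S} (φ : Iso Ω Ω') (q : Ω.Vertex) :
    Ω.cls q = Ω'.cls (mapVertex φ.toIso q) := by
  refine cls_eq_of_orderIso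
    { toFun := fun x => ⟨φ.toOrderIso x.1, φ.toOrderIso.lt_iff_lt.mpr x.2⟩
      invFun := fun y => ⟨φ.toOrderIso.symm y.1, by
        have := φ.toOrderIso.symm.lt_iff_lt.mpr y.2
        simpa [mapVertex] using this⟩
      left_inv := fun _ => by simp
      right_inv := fun _ => by simp
      map_rel_iff' := φ.toOrderIso.le_iff_le } (fun x => φ.dim_eq _) (fun x y h => φ.inc_eq h)
      (fun x hx => ?_) (fun x h h' => φ.color_eq _ _ _)
  refine φ.inc_eq ⟨x.2, fun z h1 h2 => ?_⟩
  have := Ω.dim_lt h1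
  have := Ω.dim_lt h2
  omega

/-- The brane complex `Ω` is the disjoint union of `Ω₁` and `Ω₂`. -/
structure DisjointUnion (Ω Ω₁ Ω₂ : BraneComplex D S) where
  toOrderIso : Ω₁.Cell ⊕ Ω₂.Cell ≃o Ω.Cell
  dim_inl : ∀ x, Ω.dim (toOrderIso (.inl x)) = Ω₁.dim x
  dim_inr : ∀ x, Ω.dim (toOrderIso (.inr x)) = Ω₂.dim x
  inc_inl : ∀ {x y}, y ⋖ x → Ω.inc (toOrderIso (.inl x)) (toOrderIso (.inl y)) = Ω₁.inc x y
  inc_inr : ∀ {x y}, y ⋖ x → Ω.inc (toOrderIso (.inr x)) (toOrderIso (.inr y)) = Ω₂.inc x y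
  color_inl : ∀ x h h', Ω.color (toOrderIso (.inl x)) h' = Ω₁.color x h
  color_inr : ∀ x h h', Ω.color (toOrderIso (.inr x)) h' = Ω₂.color x h
  next_inl : ∀ v : Ω₁.Vertex, Ω.next ⟨toOrderIso (.inl v.1), (dim_inl _).trans v.2⟩ =
    ⟨toOrderIso (.inl (Ω₁.next v).1), (dim_inl _).trans (Ω₁.next v).2⟩
  next_inr : ∀ v : Ω₂.Vertex, Ω.next ⟨toOrderIso (.inr v.1), (dim_inr _).trans v.2⟩ =
    ⟨toOrderIso (.inr (Ω₂.next v).1), (dim_inr _).trans (Ω₂.next v).2⟩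

namespace DisjointUnion

variable {Ω Ω₁ Ω₂ : BraneComplex D S} (u : DisjointUnion Ω Ω₁ Ω₂)

def inl (v : Ω₁.Vertex) : Ω.Vertex := ⟨u.toOrderIso (.inl v.1), (u.dim_inl _).trans v.2⟩

def inr (v : Ω₂.Vertex) : Ω.Vertex := ⟨u.toOrderIso (.inr v.1), (u.dim_inr _).trans v.2⟩

theorem cls_inl (v : Ω₁.Vertex) : Ω₁.cls v = Ω.cls (u.inl v) := by
  let f : {x : Ω₁.Cell // v.1 < x} ↪o {y : Ω.Cell // (u.inl v).1 < y} :=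
    { toFun := fun x => ⟨u.toOrderIso (.inl x.1),
        u.toOrderIso.lt_iff_lt.mpr (Sum.inl_lt_inl_iff.mpr x.2)⟩
      inj' := fun x y h => by
        have := u.toOrderIso.injective (congrArg Subtype.val h)
        exact Subtype.ext (Sum.inl_injective this)
      map_rel_iff' := fun {x y} =>
        (u.toOrderIso.le_iff_le).trans Sum.inl_le_inl_iff }
  have hf : Function.Surjective f := by
    rintro ⟨y, hy⟩
    obtain ⟨x, rfl⟩ := u.toOrderIso.surjective y
    have hy' := u.toOrderIso.lt_iff_lt.mp hy
    rcases x with x | x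
    · exact ⟨⟨x, Sum.inl_lt_inl_iff.mp hy'⟩, rfl⟩
    · exact absurd hy' Sum.not_inl_lt_inr
  refine cls_eq_of_orderIso (RelIso.ofSurjective f hf) (fun x => u.dim_inl _)
    (fun x y h => u.inc_inl h) (fun x hx => ?_) (fun x h h' => u.color_inl _ _ _)
  refine u.inc_inl ⟨x.2, fun z h1 h2 => ?_⟩
  have := Ω₁.dim_lt h1
  have := Ω₁.dim_lt h2
  omega

theorem cls_inr (v : Ω₂.Vertex) : Ω₂.cls v = Ω.cls (u.inr v) := by
  let f : {x : Ω₂.Cell // v.1 < x} ↪o {y : Ω.Cell // (u.inr v).1 < y} :=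
    { toFun := fun x => ⟨u.toOrderIso (.inr x.1),
        u.toOrderIso.lt_iff_lt.mpr (Sum.inr_lt_inr_iff.mpr x.2)⟩
      inj' := fun x y h => by
        have := u.toOrderIso.injective (congrArg Subtype.val h)
        exact Subtype.ext (Sum.inr_injective this)
      map_rel_iff' := fun {x y} =>
        (u.toOrderIso.le_iff_le).trans Sum.inr_le_inr_iff }
  have hf : Function.Surjective f := by
    rintro ⟨y, hy⟩
    obtain ⟨x, rfl⟩ := u.toOrderIso.surjective y
    have hy' := u.toOrderIso.lt_iff_lt.mp hy
    rcases x with x | x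
    · exact absurd hy' Sum.not_inr_lt_inl
    · exact ⟨⟨x, Sum.inr_lt_inr_iff.mp hy'⟩, rfl⟩
  refine cls_eq_of_orderIso (RelIso.ofSurjective f hf) (fun x => u.dim_inr _)
    (fun x y h => u.inc_inr h) (fun x hx => ?_) (fun x h h' => u.color_inr _ _ _)
  refine u.inc_inr ⟨x.2, fun z h1 h2 => ?_⟩
  have := Ω₂.dim_lt h1
  have := Ω₂.dim_lt h2
  omega

end DisjointUnion

/-- The cells of the complex that one obtains from a connected complex by cutting it along the cut
which separates `A` from the other vertices and contracting the two copies of the cut to points.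
Every closed cell `x` with a vertex in `A` leaves a part on the side of `A`, denoted `left x`
(this is `x` itself if all vertices of `x` are in `A`), and every closed cell with a vertex
outside of `A` leaves a part on the other side, denoted `right x`.  The two new points are
`leftPt` on the side of `A` and `rightPt` on the other side. -/
inductive CutCell (Ω : BraneComplex D S) (A : Set Ω.Vertex) : Type
  | left (x : Ω.Cell) (h : ∃ a ∈ A, a.1 ≤ x)
  | right (x : Ω.Cell) (h : ∃ b ∉ A, b.1 ≤ x)
  | leftPt
  | rightPt

namespace CutCell

variable {Ω : BraneComplex D S} {A : Set Ω.Vertex}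

/-- The incidence of cells: the contracted points lie on the parts of the cells which cross
the cut. -/
def le : CutCell Ω A → CutCell Ω A → Prop
  | left x _, left y _ => x ≤ y
  | right x _, right y _ => x ≤ y
  | leftPt, leftPt => True
  | rightPt, rightPt => True
  | leftPt, left y _ => ∃ b ∉ A, b.1 ≤ y
  | rightPt, right y _ => ∃ a ∈ A, a.1 ≤ y
  | _, _ => False

def dim : CutCell Ω A → ℕ
  | left x _ => Ω.dim x
  | right x _ => Ω.dim x
  | leftPt => 0
  | rightPt => 0

open Classical in
/-- The vertices of the original complex. -/
noncomputable def old (A : Set Ω.Vertex) (v : Ω.Vertex) : CutCell Ω A :=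
  if h : v ∈ A then left v.1 ⟨v, h, le_rfl⟩ else right v.1 ⟨v, h, le_rfl⟩

theorem dim_old (v : Ω.Vertex) : (old A v).dim = 0 := by
  unfold old
  split_ifs <;> exact v.2

end CutCell

/-- A cut morphism `Ω → Ω'`: the set `A` is separated by a cut of the connected complex `Ω`, and
`Ω'` is the brane complex that results from cutting `Ω` along it and contracting the two copies of
the cut.  Orientations, colours and cyclic order are induced by those of `Ω`.  An edge from a
vertex `a` in `A` to a vertex `b` outside of `A` leaves one edge from `a` to the new vertex on the
left, and one from the new vertex on the right to `b`.  In the cyclic order, the new vertex on each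
side takes the place of the vertices on the other side. -/
structure CutMorphism (Ω Ω' : BraneComplex D S) (A : Set Ω.Vertex) where
  connected : Ω.Connected
  isCut : Ω.IsCut A
  toEquiv : CutCell Ω A ≃ Ω'.Cell
  le_iff : ∀ x y, toEquiv x ≤ toEquiv y ↔ x.le y
  dim_eq : ∀ x, Ω'.dim (toEquiv x) = x.dim
  inc_left : ∀ {x y} (hx hy), y ⋖ x →
    Ω'.inc (toEquiv (.left x hx)) (toEquiv (.left y hy)) = Ω.inc x y
  inc_right : ∀ {x y} (hx hy), y ⋖ x →
    Ω'.inc (toEquiv (.right x hx)) (toEquiv (.right y hy)) = Ω.inc x y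
  inc_leftPt : ∀ {x : Ω.Cell} (hx) (b : Ω.Vertex), Ω.dim x = 1 → b ∉ A → b.1 < x →
    Ω'.inc (toEquiv (.left x hx)) (toEquiv .leftPt) = Ω.inc x b.1
  inc_rightPt : ∀ {x : Ω.Cell} (hx) (a : Ω.Vertex), Ω.dim x = 1 → a ∈ A → a.1 < x →
    Ω'.inc (toEquiv (.right x hx)) (toEquiv .rightPt) = Ω.inc x a.1
  color_left : ∀ x hx h h', Ω'.color (toEquiv (.left x hx)) h' = Ω.color x h
  color_right : ∀ x hx h h', Ω'.color (toEquiv (.right x hx)) h' = Ω.color x h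
  next_old : ∀ v : Ω.Vertex, (v ∈ A ↔ Ω.next v ∈ A) →
    Ω'.next ⟨toEquiv (CutCell.old A v), (dim_eq _).trans (CutCell.dim_old v)⟩ =
      ⟨toEquiv (CutCell.old A (Ω.next v)), (dim_eq _).trans (CutCell.dim_old _)⟩
  next_last_left : ∀ v : Ω.Vertex, v ∈ A → Ω.next v ∉ A →
    Ω'.next ⟨toEquiv (CutCell.old A v), (dim_eq _).trans (CutCell.dim_old v)⟩ =
      ⟨toEquiv .leftPt, dim_eq _⟩
  next_leftPt : ∀ v : Ω.Vertex, v ∉ A → Ω.next v ∈ A →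
    Ω'.next ⟨toEquiv .leftPt, dim_eq _⟩ =
      ⟨toEquiv (CutCell.old A (Ω.next v)), (dim_eq _).trans (CutCell.dim_old _)⟩
  next_last_right : ∀ v : Ω.Vertex, v ∉ A → Ω.next v ∈ A →
    Ω'.next ⟨toEquiv (CutCell.old A v), (dim_eq _).trans (CutCell.dim_old v)⟩ =
      ⟨toEquiv .rightPt, dim_eq _⟩
  next_rightPt : ∀ v : Ω.Vertex, v ∈ A → Ω.next v ∉ A →
    Ω'.next ⟨toEquiv .rightPt, dim_eq _⟩ =
      ⟨toEquiv (CutCell.old A (Ω.next v)), (dim_eq _).trans (CutCell.dim_old _)⟩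

namespace CutMorphism

variable {Ω Ω' : BraneComplex D S} {A : Set Ω.Vertex} (c : CutMorphism Ω Ω' A)

/-- The vertices of the original complex, as vertices of the complex after the cut. -/
noncomputable def old (v : Ω.Vertex) : Ω'.Vertex :=
  ⟨c.toEquiv (CutCell.old A v), (c.dim_eq _).trans (CutCell.dim_old v)⟩

/-- The new vertex `q₊` on the side of `A`. -/
def leftPt : Ω'.Vertex := ⟨c.toEquiv .leftPt, c.dim_eq _⟩

/-- The new vertex `q₋` on the other side. -/
def rightPt : Ω'.Vertex := ⟨c.toEquiv .rightPt, c.dim_eq _⟩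

theorem leftPt_ne_rightPt : c.leftPt ≠ c.rightPt := fun h => by
  have := c.toEquiv.injective (congrArg Subtype.val h)
  cases this

theorem lt_iff {x y : CutCell Ω A} : c.toEquiv x < c.toEquiv y ↔ x.le y ∧ x ≠ y := by
  rw [lt_iff_le_and_ne, c.le_iff, c.toEquiv.injective.ne_iff]

theorem cls_old (v : Ω.Vertex) : Ω.cls v = Ω'.cls (c.old v) := by
  by_cases hv : v ∈ A
  · have hold : (c.old v).1 = c.toEquiv (.left v.1 ⟨v, hv, le_rfl⟩) := by
      simp [old, CutCell.old, hv]
    let f : {x : Ω.Cell // v.1 < x} ↪o {y : Ω'.Cell // (c.old v).1 < y} :=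
      { toFun := fun x => ⟨c.toEquiv (.left x.1 ⟨v, hv, x.2.le⟩), by
          rw [hold, c.lt_iff]
          exact ⟨x.2.le, fun h => x.2.ne (CutCell.left.inj h)⟩⟩
        inj' := fun x y h => by
          have := c.toEquiv.injective (congrArg Subtype.val h)
          exact Subtype.ext (CutCell.left.inj this)
        map_rel_iff' := fun {x y} => c.le_iff _ _ }
    have hf : Function.Surjective f := by
      rintro ⟨y, hy⟩
      obtain ⟨x, rfl⟩ := c.toEquiv.surjective y
      have hy' := hy
      rw [hold, c.lt_iff] at hy'
      rcases x with ⟨x, hx⟩ | ⟨x, hx⟩ | _ | _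
      · refine ⟨⟨x, lt_of_le_of_ne hy'.1 fun h => hy'.2 ?_⟩, rfl⟩
        subst h
        rfl
      all_goals exact absurd hy'.1 id
    refine cls_eq_of_orderIso (RelIso.ofSurjective f hf) (fun x => c.dim_eq _)
      (fun x y h => c.inc_left _ _ h) (fun x hx => ?_) (fun x h h' => c.color_left _ _ _ _)
    refine (congrArg (Ω'.inc _) hold).trans (c.inc_left _ _ ⟨x.2, fun z h1 h2 => ?_⟩)
    have := Ω.dim_lt h1
    have := Ω.dim_lt h2
    omega
  · have hold : (c.old v).1 = c.toEquiv (.right v.1 ⟨v, hv, le_rfl⟩) := by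
      simp [old, CutCell.old, hv]
    let f : {x : Ω.Cell // v.1 < x} ↪o {y : Ω'.Cell // (c.old v).1 < y} :=
      { toFun := fun x => ⟨c.toEquiv (.right x.1 ⟨v, hv, x.2.le⟩), by
          rw [hold, c.lt_iff]
          exact ⟨x.2.le, fun h => x.2.ne (CutCell.right.inj h)⟩⟩
        inj' := fun x y h => by
          have := c.toEquiv.injective (congrArg Subtype.val h)
          exact Subtype.ext (CutCell.right.inj this)
        map_rel_iff' := fun {x y} => c.le_iff _ _ }
    have hf : Function.Surjective f := by
      rintro ⟨y, hy⟩
      obtain ⟨x, rfl⟩ := c.toEquiv.surjective y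
      have hy' := hy
      rw [hold, c.lt_iff] at hy'
      rcases x with ⟨x, hx⟩ | ⟨x, hx⟩ | _ | _
      · exact absurd hy'.1 id
      · refine ⟨⟨x, lt_of_le_of_ne hy'.1 fun h => hy'.2 ?_⟩, rfl⟩
        subst h
        rfl
      all_goals exact absurd hy'.1 id
    refine cls_eq_of_orderIso (RelIso.ofSurjective f hf) (fun x => c.dim_eq _)
      (fun x y h => c.inc_right _ _ h) (fun x hx => ?_) (fun x h h' => c.color_right _ _ _ _)
    refine (congrArg (Ω'.inc _) hold).trans (c.inc_right _ _ ⟨x.2, fun z h1 h2 => ?_⟩)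
    have := Ω.dim_lt h1
    have := Ω.dim_lt h2
    omega

/-- The cells around the new vertex on the left are the cells of the cut. -/
def leftIso : {x : Ω.Cell // Ω.Crosses A x} ↪o {y : Ω'.Cell // c.leftPt.1 < y} where
  toFun x := ⟨c.toEquiv (.left x.1 x.2.1), c.lt_iff.mpr ⟨x.2.2, fun h => by cases h⟩⟩
  inj' x y h := Subtype.ext (CutCell.left.inj (c.toEquiv.injective (congrArg Subtype.val h)))
  map_rel_iff' := c.le_iff _ _

theorem leftIso_surjective : Function.Surjective c.leftIso := by
  rintro ⟨y, hy⟩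
  obtain ⟨x, rfl⟩ := c.toEquiv.surjective y
  have hy' := c.lt_iff.mp hy
  rcases x with ⟨x, hx⟩ | ⟨x, hx⟩ | _ | _
  · exact ⟨⟨x, hx, hy'.1⟩, rfl⟩
  · exact absurd hy'.1 id
  · exact absurd rfl hy'.2
  · exact absurd hy'.1 id

/-- The cells around the new vertex on the right are the cells of the cut. -/
def rightIso : {x : Ω.Cell // Ω.Crosses A x} ↪o {y : Ω'.Cell // c.rightPt.1 < y} where
  toFun x := ⟨c.toEquiv (.right x.1 x.2.2), c.lt_iff.mpr ⟨x.2.1, fun h => by cases h⟩⟩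
  inj' x y h := Subtype.ext (CutCell.right.inj (c.toEquiv.injective (congrArg Subtype.val h)))
  map_rel_iff' := c.le_iff _ _

theorem rightIso_surjective : Function.Surjective c.rightIso := by
  rintro ⟨y, hy⟩
  obtain ⟨x, rfl⟩ := c.toEquiv.surjective y
  have hy' := c.lt_iff.mp hy
  rcases x with ⟨x, hx⟩ | ⟨x, hx⟩ | _ | _
  · exact absurd hy'.1 id
  · exact ⟨⟨x, hy'.1, hx⟩, rfl⟩
  · exact absurd hy'.1 id
  · exact absurd rfl hy'.2

/-- The vertex complexes of the two new vertices differ by the inversion of the orientations. -/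
theorem star_cls_leftPt : (Ω'.cls c.leftPt).star = Ω'.cls c.rightPt := by
  let L : _ ≃o _ := RelIso.ofSurjective c.leftIso c.leftIso_surjective
  let R : _ ≃o _ := RelIso.ofSurjective c.rightIso c.rightIso_surjective
  have hφ : ∀ x, (L.symm.trans R) (L x) = R x := fun x => congrArg R (L.symm_apply_apply x)
  refine star_cls_eq_of_orderIso (L.symm.trans R) ?_ ?_ ?_ ?_
  · intro y
    obtain ⟨x, rfl⟩ := L.surjective y
    rw [hφ]
    exact (c.dim_eq _).trans (c.dim_eq (.left x.1 x.2.1)).symm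
  · intro y y' h
    obtain ⟨x, rfl⟩ := L.surjective y
    obtain ⟨x', rfl⟩ := L.surjective y'
    rw [hφ, hφ]
    have hx : x'.1 ⋖ x.1 := by
      have h' : x' < x := by
        have : L x' < L x := h.1
        exact L.lt_iff_lt.mp this
      refine ⟨h', fun z h1 h2 => ?_⟩
      obtain ⟨⟨a, ha, hax⟩, b, hb, hbx⟩ := x'.2
      let z' : {x : Ω.Cell // Ω.Crosses A x} :=
        ⟨z, ⟨a, ha, hax.trans h1.le⟩, b, hb, hbx.trans h1.le⟩
      have h3 : L x' < L z' := L.lt_iff_lt.mpr h1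
      have h4 : L z' < L x := L.lt_iff_lt.mpr h2
      exact h.2 (c := (L z').1) h3 h4
    exact (c.inc_right _ _ hx).trans (c.inc_left _ _ hx).symm
  · intro y hy
    obtain ⟨x, rfl⟩ := L.surjective y
    rw [hφ]
    have hd : Ω.dim x.1 = 1 := (c.dim_eq _).symm.trans hy
    obtain ⟨⟨a, ha, hax⟩, b, hb, hbx⟩ := id x.2
    have hax' : a.1 < x.1 := lt_of_le_of_ne hax fun h => by
      have := a.2; rw [h] at this; omega
    have hbx' : b.1 < x.1 := lt_of_le_of_ne hbx fun h => by
      have := b.2; rw [h] at this; omega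
    have hne : a.1 ≠ b.1 := fun h => hb (Subtype.ext h ▸ ha)
    exact (c.inc_rightPt _ a hd ha hax').trans ((Ω.inc_edge hd hax' hbx' hne).trans
      (congrArg Neg.neg (c.inc_leftPt _ b hd hb hbx').symm))
  · intro y h h'
    obtain ⟨x, rfl⟩ := L.surjective y
    revert h'
    rw [hφ]
    intro h'
    have hd : 0 < Ω.dim x.1 := lt_of_lt_of_eq h (c.dim_eq (.left x.1 x.2.1))
    exact (c.color_right _ _ hd _).trans (c.color_left _ _ hd _).symm

end CutMorphism

end BraneComplex

/-- A simple `d`-covering of a simple complex `X`.  The covering space is a simple complex with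
poset of cells `Cell` (see `Cover.total`), and `map` takes a cell to the cell that it covers.
* `lift`: every closed cell is mapped homeomorphically onto a closed cell.
* `card_fiber`: over every cell of maximal dimension there are exactly `d` cells.
* `transfer`: the map is a branched covering of degree `d`, that is, there is a continuous transfer
  `X → Sym^d`.  Continuity determines the multiplicity `m e > 0` of the points of a cell `e` in the
  transfer: it is the number of sheets near `e` over every adjacent cell of maximal dimension. -/
structure Cover {n : ℕ} (X : SimpleComplex n) (d : ℕ) where
  Cell : Type
  [order : PartialOrder Cell]
  [finite : Finite Cell]
  map : Cell → X.Cell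
  mono : Monotone map
  lift : ∀ e x, x ≤ map e → ∃! e', e' ≤ e ∧ map e' = x
  card_fiber : ∀ x, X.dim x = n → Nat.card {e // map e = x} = d
  transfer : ∃ m : Cell → ℕ, (∀ e, 0 < m e) ∧
    ∀ e x, map e ≤ x → X.dim x = n → Nat.card {e' // e ≤ e' ∧ map e' = x} = m e

attribute [instance] Cover.order Cover.finite

namespace Cover

variable {n : ℕ} {X : SimpleComplex n} {d : ℕ}

theorem map_lt (f : Cover X d) {e e' : f.Cell} (h : e < e') : f.map e < f.map e' := by
  refine lt_of_le_of_ne (f.mono h.le) fun heq => h.ne ?_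
  obtain ⟨_, _, hu⟩ := f.lift e' (f.map e') le_rfl
  rw [hu e ⟨h.le, heq⟩, hu e' ⟨le_rfl, rfl⟩]

theorem le_of_map_le (f : Cover X d) {a b e : f.Cell} (ha : a ≤ e) (hb : b ≤ e)
    (h : f.map a ≤ f.map b) : a ≤ b := by
  obtain ⟨c, ⟨hcb, hc⟩, _⟩ := f.lift b (f.map a) h
  obtain ⟨_, _, hu⟩ := f.lift e (f.map a) (f.mono ha)
  rw [hu a ⟨ha, rfl⟩, ← hu c ⟨hcb.trans hb, hc⟩]
  exact hcb

/-- The covering space, as a simple complex. -/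
def total (f : Cover X d) : SimpleComplex n where
  Cell := f.Cell
  dim e := X.dim (f.map e)
  dim_covBy {e e'} h := by
    refine X.dim_covBy ⟨f.map_lt h.lt, fun x h1 h2 => ?_⟩
    obtain ⟨a, ⟨ha, rfl⟩, _⟩ := f.lift e' x h2.le
    have hea := f.le_of_map_le h.le ha h1.le
    exact h.2 (lt_of_le_of_ne hea fun h => h1.ne (congrArg f.map h))
      (lt_of_le_of_ne ha fun h => h2.ne (congrArg f.map h))
  sphere e := by
    let g : {a : f.Cell // a < e} ↪o {x : X.Cell // x < f.map e} :=
      { toFun := fun a => ⟨f.map a.1, f.map_lt a.2⟩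
        inj' := fun a b h => by
          have h' : f.map a.1 = f.map b.1 := congrArg Subtype.val h
          exact Subtype.ext (le_antisymm (f.le_of_map_le a.2.le b.2.le h'.le)
            (f.le_of_map_le b.2.le a.2.le h'.ge))
        map_rel_iff' := fun {a b} => ⟨fun h => f.le_of_map_le a.2.le b.2.le h, fun h => f.mono h⟩ }
    have hg : Function.Surjective g := by
      rintro ⟨x, hx⟩
      obtain ⟨a, ⟨ha, rfl⟩, _⟩ := f.lift e x hx.le
      exact ⟨⟨a, lt_of_le_of_ne ha fun h => hx.ne (congrArg f.map h)⟩, rfl⟩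
    have G : {a : f.Cell // a < e} ≃o {x : X.Cell // x < f.map e} := RelIso.ofSurjective g hg
    exact (X.sphere (f.map e)).of_iso G.symm
  pure e := by
    obtain ⟨x, hx, hd⟩ := X.pure (f.map e)
    obtain ⟨m, hm, hmc⟩ := f.transfer
    have h1 := hm e
    rw [← hmc e x hx hd] at h1
    obtain ⟨⟨a, ha, rfl⟩⟩ := (Nat.card_pos_iff.mp h1).1
    exact ⟨a, ha, hd⟩

/-- The isomorphisms between two coverings of the same complex. -/
def Iso (f g : Cover X d) : Type := {φ : f.Cell ≃o g.Cell // ∀ e, g.map (φ e) = f.map e}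

/-- The order `|Aut f|` of the automorphism group of a covering. -/
noncomputable def autCard (f : Cover X d) : ℕ := Nat.card (Iso f f)

instance setoid (X : SimpleComplex n) (d : ℕ) : Setoid (Cover X d) where
  r f g := Nonempty (Iso f g)
  iseqv := ⟨fun f => ⟨⟨.refl _, fun _ => rfl⟩⟩,
    fun ⟨φ⟩ => ⟨⟨φ.1.symm, fun e => by simpa using (φ.2 (φ.1.symm e)).symm⟩⟩,
    fun ⟨φ⟩ ⟨ψ⟩ => ⟨⟨φ.1.trans ψ.1, fun e => (ψ.2 _).trans (φ.2 e)⟩⟩⟩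

/-- The covering space is not glued at its vertices: the punctured star of each of its vertices is
connected.  Equivalently, the vertices over a vertex `q` of `X` correspond to the connected
components of the induced covering of the vertex complex of `q`. -/
def Unglued (f : Cover X d) : Prop :=
  ∀ e, X.dim (f.map e) = 0 → CellsConnected {e' : f.Cell // e < e'}

end Cover

/-- Isomorphism classes of simple `d`-coverings of a complex. -/
def CoverClass {n : ℕ} (X : SimpleComplex n) (d : ℕ) := Quotient (Cover.setoid X d)

/-- A simple `d`-covering of a connected coloured complex. -/
structure CoveredComplex (n : ℕ) (S : Type*) (d : ℕ) where
  base : ConnColored n S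
  cover : Cover base.1.toSimpleComplex d

namespace CoveredComplex

variable {n : ℕ} {S : Type*} {d : ℕ}

/-- An equivalence of coverings: an isomorphism of the covering spaces over an isomorphism of the
coloured base complexes. -/
structure Equivalence (f g : CoveredComplex n S d) where
  baseIso : ColoredComplex.Iso f.base.1 g.base.1
  totalIso : f.cover.Cell ≃o g.cover.Cell
  comm : ∀ e, g.cover.map (totalIso e) = baseIso.toOrderIso (f.cover.map e)

def Equivalence.symm {f g : CoveredComplex n S d} (φ : Equivalence f g) : Equivalence g f where
  baseIso := φ.baseIso.symm
  totalIso := φ.totalIso.symm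
  comm e := by
    have := φ.comm (φ.totalIso.symm e)
    rw [OrderIso.apply_symm_apply] at this
    rw [this]
    exact (φ.baseIso.toOrderIso.symm_apply_apply _).symm

def Equivalence.trans {f g h : CoveredComplex n S d} (φ : Equivalence f g) (ψ : Equivalence g h) :
    Equivalence f h where
  baseIso := φ.baseIso.trans ψ.baseIso
  totalIso := φ.totalIso.trans ψ.totalIso
  comm e := (ψ.comm _).trans (congrArg ψ.baseIso.toOrderIso (φ.comm e))

instance setoid (n : ℕ) (S : Type*) (d : ℕ) : Setoid (CoveredComplex n S d) where
  r f g := Nonempty (Equivalence f g)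
  iseqv := ⟨fun _ => ⟨⟨.refl _, .refl _, fun _ => rfl⟩⟩, fun ⟨φ⟩ => ⟨φ.symm⟩,
    fun ⟨φ⟩ ⟨ψ⟩ => ⟨φ.trans ψ⟩⟩

/-- The same covering, with the orientations of the base inverted. -/
def star (f : CoveredComplex n S d) : CoveredComplex n S d where
  base := ⟨f.base.1.star, f.base.2⟩
  cover := f.cover

theorem autCard_eq {f g : CoveredComplex n S d} (φ : Equivalence f g) :
    f.cover.autCard = g.cover.autCard := by
  have key : ∀ {f g : CoveredComplex n S d} (φ : Equivalence f g) (α : f.cover.Iso f.cover)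
      (e : g.cover.Cell), g.cover.map (φ.totalIso (α.1 (φ.totalIso.symm e))) = g.cover.map e := by
    intro f g φ α e
    rw [φ.comm, α.2, ← φ.comm, OrderIso.apply_symm_apply]
  refine Nat.card_congr
    { toFun := fun α => ⟨(φ.totalIso.symm.trans α.1).trans φ.totalIso, key φ α⟩
      invFun := fun α => ⟨(φ.totalIso.trans α.1).trans φ.totalIso.symm, key φ.symm α⟩
      left_inv := fun α => Subtype.ext (by ext; simp)
      right_inv := fun α => Subtype.ext (by ext; simp) }

end CoveredComplex

/-- The equivalence classes of simple `d`-coverings of connected coloured complexes of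
dimension `n`. -/
def CoverType (n : ℕ) (S : Type*) (d : ℕ) := Quotient (CoveredComplex.setoid n S d)

namespace CoverType

variable {n : ℕ} {S : Type*} {d : ℕ}

/-- The class of the complex that is covered. -/
def base : CoverType n S d → ColoredClass n S :=
  Quotient.map CoveredComplex.base fun _ _ ⟨φ⟩ => ⟨φ.baseIso⟩

/-- The involution induced by the inversion of the orientations. -/
def star : CoverType n S d → CoverType n S d :=
  Quotient.map CoveredComplex.star fun _ _ ⟨φ⟩ => ⟨⟨φ.baseIso.star, φ.totalIso, φ.comm⟩⟩

/-- `|Aut β|`. -/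
noncomputable def autCard : CoverType n S d → ℕ :=
  Quotient.lift (fun f => f.cover.autCard) fun _ _ ⟨φ⟩ => CoveredComplex.autCard_eq φ

theorem base_star (β : CoverType n S d) : β.star.base = β.base.star := by
  induction β using Quotient.inductionOn
  rfl

end CoverType

namespace BraneComplex

variable {D : ℕ} {S : Type*} (Ω : BraneComplex D S) {d : ℕ}

/-- The coverings of a brane complex. -/
abbrev Covering (d : ℕ) := Cover Ω.toSimpleComplex d

/-- The covering of the vertex complex of `q` which is induced by a covering of `Ω`. -/
def restrict (f : Ω.Covering d) (q : Ω.Vertex) :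
    Cover (Ω.vertexComplex q).toSimpleComplex d where
  Cell := {e : f.Cell // q.1 < f.map e}
  map e := ⟨f.map e.1, e.2⟩
  mono _ _ h := f.mono h
  lift e x hx := by
    obtain ⟨a, ⟨ha, hax⟩, hu⟩ := f.lift e.1 x.1 hx
    refine ⟨⟨a, hax ▸ x.2⟩, ⟨ha, Subtype.ext hax⟩, fun b hb => Subtype.ext ?_⟩
    exact hu b.1 ⟨hb.1, congrArg Subtype.val hb.2⟩
  card_fiber x hx := by
    have h1 := Ω.dim_lt x.2
    have h2 : Ω.dim x.1 - 1 = D := hx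
    refine Eq.trans ?_ (f.card_fiber x.1 (by omega))
    exact Nat.card_congr
      { toFun := fun e => ⟨e.1.1, congrArg Subtype.val e.2⟩
        invFun := fun e => ⟨⟨e.1, lt_of_lt_of_eq x.2 e.2.symm⟩, Subtype.ext e.2⟩
        left_inv := fun _ => rfl
        right_inv := fun _ => rfl }
  transfer := by
    obtain ⟨m, hm, hmc⟩ := f.transfer
    refine ⟨fun e => m e.1, fun e => hm e.1, fun e x hex hx => ?_⟩
    have h1 := Ω.dim_lt x.2
    have h2 : Ω.dim x.1 - 1 = D := hx
    refine Eq.trans ?_ (hmc e.1 x.1 hex (by omega))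
    exact Nat.card_congr
      { toFun := fun e => ⟨e.1.1, e.2.1, congrArg Subtype.val e.2.2⟩
        invFun := fun e => ⟨⟨e.1, lt_of_lt_of_eq x.2 e.2.2.symm⟩, e.2.1, Subtype.ext e.2.2⟩
        left_inv := fun _ => rfl
        right_inv := fun _ => rfl }

/-- The local invariant of a covering of `Ω` at the vertex `q`. -/
def localInvariant (f : Ω.Covering d) (q : Ω.Vertex) : CoverType D S d :=
  Quotient.mk _ ⟨⟨Ω.vertexComplex q, Ω.vertexComplex_connected q⟩, Ω.restrict f q⟩

theorem localInvariant_eq {f g : Ω.Covering d} (φ : f.Iso g) :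
    Ω.localInvariant f = Ω.localInvariant g := by
  funext q
  refine Quotient.sound ⟨⟨.refl _,
    { toFun := fun e => ⟨φ.1 e.1, (φ.2 e.1).symm ▸ e.2⟩
      invFun := fun e => ⟨φ.1.symm e.1, by
        have h := φ.2 (φ.1.symm e.1)
        rw [OrderIso.apply_symm_apply] at h
        exact h ▸ e.2⟩
      left_inv := fun _ => Subtype.ext (φ.1.symm_apply_apply _)
      right_inv := fun _ => Subtype.ext (φ.1.apply_symm_apply _)
      map_rel_iff' := φ.1.le_iff_le }, fun e => Subtype.ext (φ.2 e.1)⟩⟩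

/-- The local invariants of an isomorphism class of coverings. -/
def localInvariants : CoverClass Ω.toSimpleComplex d → Ω.Vertex → CoverType D S d :=
  Quotient.lift Ω.localInvariant fun _ _ ⟨φ⟩ => Ω.localInvariant_eq φ

theorem autCard_eq {f g : Ω.Covering d} (φ : f.Iso g) : f.autCard = g.autCard := by
  have key : ∀ {f g : Ω.Covering d} (φ : f.Iso g) (α : f.Iso f)
      (e : g.Cell), g.map (φ.1 (α.1 (φ.1.symm e))) = g.map e := by
    intro f g φ α e
    rw [φ.2, α.2, ← φ.2, OrderIso.apply_symm_apply]
  refine Nat.card_congr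
    { toFun := fun α => ⟨(φ.1.symm.trans α.1).trans φ.1, key φ α⟩
      invFun := fun α => ⟨(φ.1.trans α.1).trans φ.1.symm, fun e => by
        have h := φ.2 (φ.1.symm (α.1 (φ.1 e)))
        rw [OrderIso.apply_symm_apply, α.2, φ.2] at h
        exact h.symm⟩
      left_inv := fun α => Subtype.ext (by ext; simp)
      right_inv := fun α => Subtype.ext (by ext; simp) }

/-- `|Aut f|` for an isomorphism class of coverings. -/
noncomputable def classAutCard : CoverClass Ω.toSimpleComplex d → ℕ :=
  Quotient.lift Cover.autCard fun _ _ ⟨φ⟩ => Ω.autCard_eq φ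

/-- The Hurwitz number `H^d(Ω, {β_q})`: the sum of `1 / |Aut f|` over the isomorphism classes of
simple `d`-coverings `f` of `Ω` with local invariants `β_q` at the vertices `q`. -/
noncomputable def hurwitz (K : Type*) [Field K] (β : Ω.Vertex → CoverType D S d) : K :=
  ∑ᶠ f : {f : CoverClass Ω.toSimpleComplex d // Ω.localInvariants f = β},
    1 / (Ω.classAutCard f.1 : K)

/-- The Hurwitz number in which only the unglued coverings are counted. -/
noncomputable def ungluedHurwitz (K : Type*) [Field K] (β : Ω.Vertex → CoverType D S d) : K :=
  ∑ᶠ f : {f : CoverClass Ω.toSimpleComplex d //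
      (∃ g : Ω.Covering d, g.Unglued ∧ f = Quotient.mk _ g) ∧ Ω.localInvariants f = β},
    1 / (Ω.classAutCard f.1 : K)

end BraneComplex

section TopologicalFieldTheory

variable {K : Type*} [Field K] {D : ℕ} {S : Type*}

/-- The identification of the spaces of equal classes. -/
def transport (K : Type*) [Field K] {D : ℕ} {S : Type*} (B : ColoredClass D S → Type*)
    [∀ σ, AddCommGroup (B σ)] [∀ σ, Module K (B σ)] {σ τ : ColoredClass D S} (h : σ = τ) :
    B σ ≃ₗ[K] B τ :=
  h ▸ LinearEquiv.refl K (B σ)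

variable (B : ColoredClass D S → Type*) [∀ σ, AddCommGroup (B σ)] [∀ σ, Module K (B σ)]

variable (K) in
/-- The space `V_Ω`, the tensor product of the spaces `B_σ` of the vertex complexes of `Ω`. -/
abbrev StateSpace (Ω : BraneComplex D S) := ⨂[K] q : Ω.Vertex, B (Ω.cls q)

variable {B}

open Classical in
/-- The bilinear form in the entries at `i` and `j` of a linear form on a tensor product, for
fixed other entries `x`. -/
noncomputable def pairAt {ι : Type*} {M : ι → Type*} [∀ i, AddCommGroup (M i)]
    [∀ i, Module K (M i)] (Φ : (⨂[K] i, M i) →ₗ[K] K) (x : ∀ i, M i) {i j : ι} (h : i ≠ j) :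
    M i →ₗ[K] M j →ₗ[K] K :=
  LinearMap.mk₂ K
    (fun a b => Φ (PiTensorProduct.tprod K (Function.update (Function.update x i a) j b)))
    (fun a a' b => by
      simp only [Function.update_comm h, MultilinearMap.map_update_add, map_add])
    (fun c a b => by
      simp only [Function.update_comm h, MultilinearMap.map_update_smul, map_smul])
    (fun a b b' => by simp only [MultilinearMap.map_update_add, map_add])
    (fun c a b => by simp only [MultilinearMap.map_update_smul, map_smul])

/-- A family of linear forms `Φ_Ω` on the spaces `V_Ω` is a Brane Topological Field Theory with
respect to the finite dimensional spaces `B_σ` and the tensors `κ_σ ∈ B_σ ⊗ B_σ*`; the forms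
`η_σ : B_σ × B_σ* → K` are those given by the complexes with two vertices. -/
structure IsBraneTFT (κ : ∀ σ, B σ ⊗[K] B σ.star) (η : ∀ σ, B σ →ₗ[K] B σ.star →ₗ[K] K)
    (Φ : ∀ Ω : BraneComplex D S, StateSpace K B Ω →ₗ[K] K) : Prop where
  finiteDimensional : ∀ σ, Module.Finite K (B σ)
  /-- Topological invariance. -/
  invariance : ∀ {Ω Ω' : BraneComplex D S} (φ : Ω.Iso Ω') (x : ∀ q, B (Ω.cls q))
    (x' : ∀ q, B (Ω'.cls q)),
    (∀ q, x' (BraneComplex.mapVertex φ.toIso q) = transport K B (φ.cls_eq q) (x q)) →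
    Φ Ω' (PiTensorProduct.tprod K x') = Φ Ω (PiTensorProduct.tprod K x)
  /-- Non-degeneracy. -/
  pairing : ∀ {Ω : BraneComplex D S} {q₁ q₂ : Ω.Vertex} (hne : q₁ ≠ q₂)
    (h : ∀ v, v = q₁ ∨ v = q₂) (x : ∀ q, B (Ω.cls q)),
    η (Ω.cls q₁) (x q₁)
        (transport K B (BraneComplex.star_cls_eq_of_two hne h).symm (x q₂)) =
      Φ Ω (PiTensorProduct.tprod K x)
  nondegenerate : ∀ σ, (η σ).Nondegenerate
  /-- Cut invariance: inserting the tensor `κ_σ` at the two new vertices does not change the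
  value. -/
  cut : ∀ {Ω Ω' : BraneComplex D S} {A : Set Ω.Vertex} (c : Ω.CutMorphism Ω' A)
    (x : ∀ q, B (Ω.cls q)) (x' : ∀ q, B (Ω'.cls q)),
    (∀ q, x' (c.old q) = transport K B (c.cls_old q) (x q)) →
    TensorProduct.lift ((pairAt (Φ Ω') x' c.leftPt_ne_rightPt).compl₂
        (transport K B c.star_cls_leftPt).toLinearMap) (κ (Ω'.cls c.leftPt)) =
      Φ Ω (PiTensorProduct.tprod K x)
  /-- Multiplicativity. -/
  multiplicativity : ∀ {Ω Ω₁ Ω₂ : BraneComplex D S} (u : Ω.DisjointUnion Ω₁ Ω₂)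
    (x : ∀ q, B (Ω.cls q)),
    Φ Ω (PiTensorProduct.tprod K x) =
      Φ Ω₁ (PiTensorProduct.tprod K fun q => transport K B (u.cls_inl q).symm (x (u.inl q))) *
      Φ Ω₂ (PiTensorProduct.tprod K fun q => transport K B (u.cls_inr q).symm (x (u.inr q)))

/-- The complex after a cut is the disjoint union of the connected complexes `Ω₁`, which contains
the new vertex on the left, and `Ω₂`. -/
structure BraneComplex.CutMorphism.Splitting {Ω Ω' : BraneComplex D S} {A : Set Ω.Vertex}
    (c : Ω.CutMorphism Ω' A) (Ω₁ Ω₂ : BraneComplex D S) extends Ω'.DisjointUnion Ω₁ Ω₂ where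
  connected₁ : Ω₁.Connected
  connected₂ : Ω₂.Connected
  left_mem : ∃ p, toDisjointUnion.inl p = c.leftPt

open Classical in
/-- The sum `∑ (x₁, x₂, b_i) F^{ij} (b'_j, x₃, x₄)` for a cut of a complex into two parts, where
the entries of `y` at the old vertices are the `x_k`, where `b` and `b'` are bases of the
spaces of the two new vertices, and where `F^{ij}` is the inverse matrix of `η(b_i, b'_j)`, with
indices such that `∑ F^{ij} b_i ⊗ b'_j` is the tensor inverse to `η`. -/
noncomputable def glueSum (η : ∀ σ, B σ →ₗ[K] B σ.star →ₗ[K] K)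
    (μ : ∀ Ω : BraneComplex D S, StateSpace K B Ω →ₗ[K] K) {Ω Ω' : BraneComplex D S}
    {A : Set Ω.Vertex} {c : Ω.CutMorphism Ω' A} {Ω₁ Ω₂ : BraneComplex D S}
    (u : c.Splitting Ω₁ Ω₂) (y : ∀ v, B (Ω'.cls v)) {m : ℕ}
    (b : Module.Basis (Fin m) K (B (Ω'.cls c.leftPt)))
    (b' : Module.Basis (Fin m) K (B (Ω'.cls c.rightPt))) : K :=
  let F : Matrix (Fin m) (Fin m) K := Matrix.of fun i j =>
    η (Ω'.cls c.leftPt) (b i) (transport K B c.star_cls_leftPt.symm (b' j))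
  let z (i j : Fin m) := Function.update (Function.update y c.leftPt (b i)) c.rightPt (b' j)
  ∑ i, ∑ j,
    μ Ω₁ (PiTensorProduct.tprod K fun v => transport K B (u.cls_inl v).symm (z i j (u.inl v))) *
    F⁻¹ j i *
    μ Ω₂ (PiTensorProduct.tprod K fun v => transport K B (u.cls_inr v).symm (z i j (u.inr v)))

/-- The structure of a Colored Frobenius Algebra on `B_* = ⨁ B_σ`: non-degenerate forms
`η_σ : B_σ × B_σ* → K` (the other components of the bilinear form on `B_*` vanish), and for every
connected brane complex `Ω` with three vertices a trilinear form `μ_Ω` on the spaces of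
its vertices, which depends only on the isomorphism class of `Ω`; the values of `μ` on other
complexes carry no information.  The forms satisfy the associativity relation for the two ways of
cutting a connected complex with four vertices into complexes with three vertices. -/
structure IsColoredFrobenius (η : ∀ σ, B σ →ₗ[K] B σ.star →ₗ[K] K)
    (μ : ∀ Ω : BraneComplex D S, StateSpace K B Ω →ₗ[K] K) : Prop where
  finiteDimensional : ∀ σ, Module.Finite K (B σ)
  nondegenerate : ∀ σ, (η σ).Nondegenerate
  invariance : ∀ {Ω Ω' : BraneComplex D S} (φ : Ω.Iso Ω') (x : ∀ q, B (Ω.cls q))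
    (x' : ∀ q, B (Ω'.cls q)), Ω.Connected → Nat.card Ω.Vertex = 3 →
    (∀ q, x' (BraneComplex.mapVertex φ.toIso q) = transport K B (φ.cls_eq q) (x q)) →
    μ Ω' (PiTensorProduct.tprod K x') = μ Ω (PiTensorProduct.tprod K x)
  associativity : ∀ {Ω : BraneComplex D S} (q : Ω.Vertex), Ω.Connected → Nat.card Ω.Vertex = 4 →
    ∀ {Ω' Ω'' Ω₁ Ω₂ Ω₃ Ω₄ : BraneComplex D S} {c : Ω.CutMorphism Ω' {q, Ω.next q}}
      {c' : Ω.CutMorphism Ω'' {Ω.next.symm q, q}} (u : c.Splitting Ω₁ Ω₂) (u' : c'.Splitting Ω₃ Ω₄)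
      (x : ∀ q, B (Ω.cls q)) (y : ∀ q, B (Ω'.cls q)) (y' : ∀ q, B (Ω''.cls q)),
      (∀ v, y (c.old v) = transport K B (c.cls_old v) (x v)) →
      (∀ v, y' (c'.old v) = transport K B (c'.cls_old v) (x v)) →
      ∀ {m m' : ℕ} (b₁ : Module.Basis (Fin m) K (B (Ω'.cls c.leftPt)))
        (b₂ : Module.Basis (Fin m) K (B (Ω'.cls c.rightPt)))
        (b₃ : Module.Basis (Fin m') K (B (Ω''.cls c'.leftPt)))
        (b₄ : Module.Basis (Fin m') K (B (Ω''.cls c'.rightPt))),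
        glueSum η μ u y b₁ b₂ = glueSum η μ u' y' b₃ b₄

end TopologicalFieldTheory

section Hurwitz

variable (K : Type*) [Field K] (D : ℕ) (S : Type*) (d : ℕ)

/-- The space `C_σ^d` spanned by the equivalence classes of simple `d`-coverings of complexes
in the class `σ`. -/
abbrev CoverSpace (σ : ColoredClass D S) : Type _ := {β : CoverType D S d // β.base = σ} →₀ K

variable {K D S d}

/-- The linear forms on the spaces `V_Ω` whose values on the basis tensors are given by numbers
`h Ω {β_q}`. -/
noncomputable def formOf (h : ∀ Ω : BraneComplex D S, (Ω.Vertex → CoverType D S d) → K)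
    (Ω : BraneComplex D S) : StateSpace K (CoverSpace K D S d) Ω →ₗ[K] K :=
  (Basis.piTensorProduct fun q : Ω.Vertex =>
    (Finsupp.basisSingleOne : Module.Basis {β : CoverType D S d // β.base = Ω.cls q} K _)).constr K
    fun β => h Ω fun q => (β q).1

/-- The gluing formula along cuts: for a cut of `Ω` into `Ω₁` and `Ω₂`, the number of `Ω` is the sum
over the classes `b` of coverings of the cut of the products of the numbers of `Ω₁` and `Ω₂`,
with `b` and `b*` inserted at the new vertices, weighted by `|Aut b|`. -/
def GluingFormula (h : ∀ Ω : BraneComplex D S, (Ω.Vertex → CoverType D S d) → K) : Prop :=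
  ∀ {Ω Ω' : BraneComplex D S} {A : Set Ω.Vertex} (c : Ω.CutMorphism Ω' A)
    {Ω₁ Ω₂ : BraneComplex D S} (u : c.Splitting Ω₁ Ω₂) (β : Ω.Vertex → CoverType D S d)
    (β' : CoverType D S d → Ω'.Vertex → CoverType D S d),
    (∀ b q, β' b (c.old q) = β q) → (∀ b, β' b c.leftPt = b) → (∀ b, β' b c.rightPt = b.star) →
    h Ω β = ∑ᶠ b : CoverType D S d,
      (b.autCard : K) * h Ω₁ (fun q => β' b (u.inl q)) * h Ω₂ (fun q => β' b (u.inr q))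

end Hurwitz

/-!
Hurwitz numbers of brane complexes form a field theory because coverings can be restricted, glued
and counted with numbered sheets, where no automorphisms get in the way.

A simple `d`-covering is determined, away from the vertices of the base, by how the `d` sheets over
every maximal cell are identified along the smaller cells. Numbering the sheets over every maximal
cell by `Fin d` turns a covering into a finite combinatorial object, a `MarkedCover`: for every cell
an equivalence relation on the sheets around it. The group `Gauge` of renumberings acts on
these objects; its orbits are the isomorphism classes of coverings and its stabilizers are
the automorphism groups. Hence a sum of `1 / |Aut f|` over isomorphism classes is a number of
marked coverings divided by the order of the gauge group. Over a vertex `q`, a covering of the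
punctured star is extended by choosing which of its sheets to glue: there is one choice in
the unglued theory, and in the theory of all coverings the number of choices depends
only on the local invariant at `q`. So both families of numbers are instances of
`BraneComplex.weightedCount`, which counts marked coverings of the complex of cells of positive
dimension and multiplies by weights of the local invariants (`BraneComplex.hurwitz_eq`,
`BraneComplex.ungluedHurwitz_eq`).

Marked coverings form a sheaf for upward closed sets of cells, which makes the counts
multiplicative for disjoint unions. For a cut, a covering of `Ω` is a pair of coverings of the two
sides that agree on the cells that cross the cut. Connected coloured complexes are rigid, as
different cells of one dimension have different colours; therefore two marked coverings of the cut
have the same class `β` exactly when they differ by a renumbering `γ` of the sheets over it. Given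
a marked covering of the complex after the cut with invariants `β` and `β*` at the new vertices,
there are `|Aut β|` such `γ`, and twisting one side by `γ` makes the sides agree. Counting the
triples in two ways gives the cut formula `BraneComplex.CutMorphism.weightedCount_eq`. The same
argument for a complex with two vertices, whose marked coverings are those of a single vertex
complex, computes the pairing.

In terms of linear forms the cut formula says that inserting the tensor
`∑ |Aut β| / w(β)² β ⊗ β*` at the new vertices does not change the value, and this tensor is inverse
to the pairing `η(β, β*) = w(β)² / |Aut β|`. Both sides of the associativity relation are then equal
to the value for the complex with four vertices (`IsBraneTFT.isColoredFrobenius`).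
-/

/-! ### Coverings with marked sheets -/

/-- The sheets over the maximal cells, numbered by `Fin d` over each of them. -/
abbrev Sheet {P : Type} (t : P → Prop) (d : ℕ) : Type := {z // t z} × Fin d

/-- The renumberings of the sheets over every maximal cell. -/
abbrev Gauge {P : Type} (t : P → Prop) (d : ℕ) : Type := {z // t z} → Equiv.Perm (Fin d)

/-- The effect of a renumbering on a sheet. -/
def Gauge.move {P : Type} {t : P → Prop} {d : ℕ} (g : Gauge t d) (a : Sheet t d) : Sheet t d :=
  (a.1, g a.1 a.2)

namespace Gauge

variable {P : Type} {t : P → Prop} {d : ℕ} (g h : Gauge t d) (a : Sheet t d)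

@[simp] theorem move_one : (1 : Gauge t d).move a = a := rfl

@[simp] theorem move_mul : (g * h).move a = g.move (h.move a) := rfl

@[simp] theorem move_inv_move : g⁻¹.move (g.move a) = a := by
  rw [← move_mul, inv_mul_cancel, move_one]

@[simp] theorem move_move_inv : g.move (g⁻¹.move a) = a := by
  rw [← move_mul, mul_inv_cancel, move_one]

end Gauge

/-- A covering of a poset of cells with marked sheets: over every maximal cell (singled out by the
predicate `t`) there are `d` numbered sheets, and `rel x a b` says that the sheets `a` and `b` have
the same face over `x`.  A covering is thus described by a relation on a fixed set, and an
isomorphism that preserves the marking is an equality. -/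
@[ext]
structure MarkedCover {P : Type} [PartialOrder P] (t : P → Prop) (d : ℕ) where
  rel : P → Sheet t d → Sheet t d → Prop
  le_of_rel : ∀ {x a b}, rel x a b → x ≤ a.1.1
  refl : ∀ {x a}, x ≤ a.1.1 → rel x a a
  symm : ∀ {x a b}, rel x a b → rel x b a
  trans : ∀ {x a b c}, rel x a b → rel x b c → rel x a c
  mono : ∀ {x y a b}, x ≤ y → rel y a b → rel x a b
  eq_of_top : ∀ {a b}, rel a.1.1 a b → a = b
  card : ∀ {x a} (z z' : {z // t z}), x ≤ a.1.1 → x ≤ z.1 → x ≤ z'.1 →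
    Nat.card {i // rel x a (z, i)} = Nat.card {i // rel x a (z', i)}

namespace MarkedCover

variable {P : Type} [PartialOrder P] {t : P → Prop} {d : ℕ}

theorem le_of_rel' (E : MarkedCover t d) {x a b} (h : E.rel x a b) : x ≤ b.1.1 :=
  E.le_of_rel (E.symm h)

instance [Finite P] : Finite (MarkedCover t d) :=
  Finite.of_injective (fun E : MarkedCover t d => E.rel) fun _ _ h => MarkedCover.ext h

/-- Renumbering the sheets. -/
instance : SMul (Gauge t d) (MarkedCover t d) where
  smul g E :=
    { rel := fun x a b => E.rel x (g⁻¹.move a) (g⁻¹.move b)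
      le_of_rel := fun h => (E.le_of_rel h :)
      refl := fun {x a} h => E.refl (a := g⁻¹.move a) h
      symm := fun h => E.symm h
      trans := fun h h' => E.trans h h'
      mono := fun h h' => E.mono h h'
      eq_of_top := fun {a b} h => by
        have h' : g⁻¹.move a = g⁻¹.move b := E.eq_of_top h
        rw [← g.move_move_inv a, h', g.move_move_inv]
      card := fun {x a} z z' h hz hz' => by
        have key : ∀ z : {z // t z}, Nat.card {i // E.rel x (g⁻¹.move a) (g⁻¹.move (z, i))} =
            Nat.card {i // E.rel x (g⁻¹.move a) (z, i)} := fun z =>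
          Nat.card_congr ((g⁻¹ z).subtypeEquiv fun i => Iff.rfl)
        rw [key, key, E.card (a := g⁻¹.move a) z z' h hz hz'] }

theorem smul_rel (g : Gauge t d) (E : MarkedCover t d) (x a b) :
    (g • E).rel x a b ↔ E.rel x (g⁻¹.move a) (g⁻¹.move b) := Iff.rfl

instance : MulAction (Gauge t d) (MarkedCover t d) where
  one_smul E := by ext x a b; simp [smul_rel]
  mul_smul g h E := by ext x a b; simp [smul_rel]

/-- The cells of the covering space: pairs of a cell `x` and a class of sheets for `E.rel x`.
Smaller cells are faces of more sheets. -/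
def Cell (E : MarkedCover t d) : Type :=
  {p : P × (Set (Sheet t d))ᵒᵈ //
    ∃ a : Sheet t d, p.1 ≤ a.1.1 ∧ p.2 = OrderDual.toDual {b | E.rel p.1 a b}}

instance (E : MarkedCover t d) : PartialOrder E.Cell := inferInstanceAs (PartialOrder (Subtype _))

instance (E : MarkedCover t d) [Finite P] : Finite E.Cell := by
  have : Finite (Set (Sheet t d))ᵒᵈ := inferInstanceAs (Finite (Set (Sheet t d)))
  exact inferInstanceAs (Finite (Subtype _))

/-- The face over `x` of the sheet `a`. -/
def face (E : MarkedCover t d) (x : P) (a : Sheet t d) (h : x ≤ a.1.1) : E.Cell :=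
  ⟨(x, OrderDual.toDual {b | E.rel x a b}), a, h, rfl⟩

/-- The cell that is covered. -/
def proj (E : MarkedCover t d) (e : E.Cell) : P := e.1.1

variable (E : MarkedCover t d)

theorem exists_face (e : E.Cell) : ∃ (a : Sheet t d) (h : E.proj e ≤ a.1.1),
    e = E.face (E.proj e) a h := by
  obtain ⟨⟨x, C⟩, a, h, hC⟩ := e
  exact ⟨a, h, Subtype.ext (Prod.ext rfl hC)⟩

theorem proj_mono : Monotone E.proj := fun e e' h => by
  have h' : e.1 ≤ e'.1 := h
  exact h'.1

theorem face_le_face {x y a b} (hx : x ≤ a.1.1) (hy : y ≤ b.1.1) :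
    E.face x a hx ≤ E.face y b hy ↔ x ≤ y ∧ E.rel x a b := by
  constructor
  · intro h
    exact ⟨h.1, h.2 (E.refl hy)⟩
  · rintro ⟨h, hab⟩
    exact ⟨h, fun c hc => E.trans hab (E.mono h hc)⟩

theorem face_eq_face {x y a b} (hx : x ≤ a.1.1) (hy : y ≤ b.1.1) :
    E.face x a hx = E.face y b hy ↔ x = y ∧ E.rel x a b := by
  rw [le_antisymm_iff, face_le_face, face_le_face]
  constructor
  · rintro ⟨⟨h1, h2⟩, h3, -⟩
    exact ⟨le_antisymm h1 h3, h2⟩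
  · rintro ⟨rfl, h⟩
    exact ⟨⟨le_rfl, h⟩, le_rfl, E.symm h⟩

/-- The sheet `a` as a cell of the covering space. -/
def sheetCell (a : Sheet t d) : E.Cell := E.face a.1.1 a le_rfl

theorem face_le_sheetCell {x a b} (hx : x ≤ a.1.1) :
    E.face x a hx ≤ E.sheetCell b ↔ E.rel x a b := by
  rw [sheetCell, face_le_face]
  exact ⟨fun h => h.2, fun h => ⟨E.le_of_rel' h, h⟩⟩

end MarkedCover

/-- The cells of maximal dimension. -/
def SimpleComplex.IsTop {n : ℕ} (X : SimpleComplex n) (x : X.Cell) : Prop := X.dim x = n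

theorem SimpleComplex.dim_le {n : ℕ} (X : SimpleComplex n) (x : X.Cell) : X.dim x ≤ n := by
  obtain ⟨y, hy, hd⟩ := X.pure x
  exact (X.dim_mono hy).trans hd.le

theorem SimpleComplex.IsTop.eq {n : ℕ} {X : SimpleComplex n} {x y : X.Cell} (hx : X.IsTop x)
    (h : x ≤ y) : x = y := by
  by_contra hne
  have h1 := X.dim_lt (lt_of_le_of_ne h hne)
  have h2 := X.dim_le y
  have h3 : X.dim x = n := hx
  omega

namespace MarkedCover

variable {n d : ℕ} {X : SimpleComplex n} (E : MarkedCover X.IsTop d)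

theorem exists_sheetCell {e : E.Cell} (h : X.IsTop (E.proj e)) : ∃ a, e = E.sheetCell a := by
  obtain ⟨a, ha, he⟩ := E.exists_face e
  refine ⟨a, he.trans ?_⟩
  rw [sheetCell, face_eq_face]
  exact ⟨h.eq ha, E.refl ha⟩

theorem sheetCell_injective : Function.Injective E.sheetCell := fun a b h => by
  rw [sheetCell, sheetCell, face_eq_face] at h
  exact E.eq_of_top h.2

/-- The covering described by the relations on the marked sheets. -/
abbrev toCover : Cover X d where
  Cell := E.Cell
  map := E.proj
  mono := E.proj_mono
  lift e x hx := by
    obtain ⟨a, ha, he⟩ := E.exists_face e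
    have hxa := hx.trans ha
    refine ⟨E.face x a hxa, ⟨?_, rfl⟩, ?_⟩
    · rw [he, face_le_face]
      exact ⟨hx, E.refl hxa⟩
    · rintro e' ⟨h', rfl⟩
      obtain ⟨b, hb, hb'⟩ := E.exists_face e'
      refine hb'.trans ((E.face_eq_face hb hxa).mpr ⟨rfl, ?_⟩)
      exact ((E.face_le_face hb ha).mp (hb'.symm.trans_le (h'.trans_eq he))).2
  card_fiber x hx := by
    refine (Nat.card_congr (Equiv.ofBijective
      (fun i : Fin d => (⟨E.sheetCell (⟨x, hx⟩, i), rfl⟩ : {e // E.proj e = x})) ⟨?_, ?_⟩)).symm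
      |>.trans (by simp)
    · intro i j h
      exact congrArg Prod.snd (E.sheetCell_injective (congrArg Subtype.val h))
    · rintro ⟨e, rfl⟩
      obtain ⟨a, rfl⟩ := E.exists_sheetCell hx
      exact ⟨a.2, rfl⟩
  transfer := by
    -- The multiplicity of a cell is the number of the sheets through it over any maximal cell.
    choose a ha he using E.exists_face
    refine ⟨fun e => Nat.card {i // E.rel (E.proj e) (a e) ((a e).1, i)}, fun e => ?_,
      fun e x hex hx => ?_⟩
    · exact Nat.card_pos_iff.mpr ⟨⟨⟨(a e).2, E.refl (ha e)⟩⟩, inferInstance⟩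
    · refine Eq.trans ?_ (E.card ⟨x, hx⟩ _ (ha e) hex (ha e))
      refine (Nat.card_congr (Equiv.ofBijective
        (fun i : {i // E.rel (E.proj e) (a e) (⟨x, hx⟩, i)} =>
          (⟨E.sheetCell (⟨x, hx⟩, i.1), ?_, rfl⟩ : {e' // e ≤ e' ∧ E.proj e' = x})) ⟨?_, ?_⟩)).symm
      · have h := i.2
        rw [← E.face_le_sheetCell (ha e)] at h
        exact (he e).trans_le h
      · intro i j h
        exact Subtype.ext (congrArg Prod.snd (E.sheetCell_injective (congrArg Subtype.val h)))
      · rintro ⟨e', hle, rfl⟩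
        obtain ⟨b, rfl⟩ := E.exists_sheetCell hx
        refine ⟨⟨b.2, ?_⟩, rfl⟩
        have h := (he e).symm.trans_le hle
        rwa [E.face_le_sheetCell] at h

end MarkedCover

namespace Cover

variable {n d : ℕ} {X : SimpleComplex n}

/-- A numbering of the sheets of a covering over the cells of maximal dimension. -/
structure Marking (f : Cover X d) where
  sheet : Sheet X.IsTop d → f.Cell
  map_sheet : ∀ a, f.map (sheet a) = a.1.1
  injective : Function.Injective sheet
  surjective : ∀ e, X.IsTop (f.map e) → ∃ a, sheet a = e

theorem exists_marking (f : Cover X d) : Nonempty f.Marking := by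
  have h : ∀ z : {z // X.IsTop z}, Nonempty (Fin d ≃ {e // f.map e = z.1}) := fun z =>
    ⟨(finCongr (f.card_fiber z.1 z.2).symm).trans (Finite.equivFin _).symm⟩
  have φ : ∀ z : {z // X.IsTop z}, Fin d ≃ {e // f.map e = z.1} := fun z => (h z).some
  refine ⟨⟨fun a => (φ a.1 a.2).1, fun a => (φ a.1 a.2).2, ?_, ?_⟩⟩
  · rintro ⟨z, i⟩ ⟨z', i'⟩ h
    obtain rfl : z = z' := Subtype.ext <| by
      rw [← (φ z i).2, ← (φ z' i').2]
      exact congrArg f.map h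
    exact Prod.ext rfl ((φ z).injective (Subtype.ext h))
  · intro e he
    exact ⟨(⟨f.map e, he⟩, (φ ⟨f.map e, he⟩).symm ⟨e, rfl⟩), by simp⟩

theorem face_unique (f : Cover X d) {e e₁ e₂ : f.Cell} (h₁ : e₁ ≤ e) (h₂ : e₂ ≤ e)
    (h : f.map e₁ = f.map e₂) : e₁ = e₂ :=
  le_antisymm (f.le_of_map_le h₁ h₂ h.le) (f.le_of_map_le h₂ h₁ h.ge)

theorem exists_face (f : Cover X d) {e : f.Cell} {x : X.Cell} (h : x ≤ f.map e) :
    ∃ e', e' ≤ e ∧ f.map e' = x := (f.lift e x h).exists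

/-- Every cell lies in a cell of maximal dimension over any given one. -/
theorem exists_top_over (f : Cover X d) (e : f.Cell) {z : X.Cell} (h : f.map e ≤ z)
    (hz : X.IsTop z) : ∃ e', e ≤ e' ∧ f.map e' = z := by
  obtain ⟨m, hm, hmc⟩ := f.transfer
  have h1 := hm e
  rw [← hmc e z h hz] at h1
  obtain ⟨⟨a, ha⟩⟩ := (Nat.card_pos_iff.mp h1).1
  exact ⟨a, ha⟩

namespace Marking

variable {f : Cover X d} (M : f.Marking)

theorem exists_sheet_ge (e : f.Cell) : ∃ a, e ≤ M.sheet a := by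
  obtain ⟨z, hz, hd⟩ := X.pure (f.map e)
  obtain ⟨e', he, rfl⟩ := f.exists_top_over e hz hd
  obtain ⟨a, rfl⟩ := M.surjective e' hd
  exact ⟨a, he⟩

/-- The relations between the sheets of a marked covering. -/
def toMarkedCover : MarkedCover X.IsTop d where
  rel x a b := ∃ e, f.map e = x ∧ e ≤ M.sheet a ∧ e ≤ M.sheet b
  le_of_rel := by
    rintro x a b ⟨e, rfl, h, -⟩
    exact (f.mono h).trans (M.map_sheet a).le
  refl {x a} h := by
    obtain ⟨e, he, rfl⟩ := f.exists_face (h.trans (M.map_sheet a).ge)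
    exact ⟨e, rfl, he, he⟩
  symm := by
    rintro x a b ⟨e, h, h1, h2⟩
    exact ⟨e, h, h2, h1⟩
  trans := by
    rintro x a b c ⟨e, rfl, h1, h2⟩ ⟨e', h, h3, h4⟩
    obtain rfl := f.face_unique h2 h3 h.symm
    exact ⟨e, rfl, h1, h4⟩
  mono := by
    rintro x y a b h ⟨e, rfl, h1, h2⟩
    obtain ⟨e', he, rfl⟩ := f.exists_face h
    exact ⟨e', rfl, he.trans h1, he.trans h2⟩
  eq_of_top := by
    rintro a b ⟨e, h, h1, h2⟩
    obtain rfl := f.face_unique h1 le_rfl (h.trans (M.map_sheet a).symm)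
    have h3 := M.map_sheet a
    have h4 := a.1.2.eq (h3.symm.le.trans ((f.mono h2).trans (M.map_sheet b).le))
    exact M.injective (f.face_unique h2 le_rfl (h3.trans (h4.trans (M.map_sheet b).symm)))
  card {x a} z z' h hz hz' := by
    obtain ⟨e, he, rfl⟩ := f.exists_face (h.trans (M.map_sheet a).ge)
    obtain ⟨m, hm, hmc⟩ := f.transfer
    suffices key : ∀ z : {z // X.IsTop z}, f.map e ≤ z.1 →
        Nat.card {i // ∃ e', f.map e' = f.map e ∧ e' ≤ M.sheet a ∧ e' ≤ M.sheet (z, i)} = m e by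
      rw [key z hz, key z' hz']
    intro z hz
    rw [← hmc e z.1 hz z.2]
    refine Nat.card_congr (Equiv.ofBijective
      (fun i => (⟨M.sheet (z, i.1), ?_, M.map_sheet _⟩ : {e' // e ≤ e' ∧ f.map e' = z.1})) ⟨?_, ?_⟩)
    · obtain ⟨e', h1, h2, h3⟩ := i.2
      exact (f.face_unique he h2 h1.symm).trans_le h3
    · intro i j h
      exact Subtype.ext (congrArg Prod.snd (M.injective (congrArg Subtype.val h)))
    · rintro ⟨e', h1, h2⟩
      obtain ⟨b, rfl⟩ := M.surjective e' (h2 ▸ z.2)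
      obtain rfl : b.1 = z := Subtype.ext ((M.map_sheet b).symm.trans h2)
      exact ⟨⟨b.2, e, rfl, he, h1⟩, rfl⟩

/-- A covering with marked sheets is determined by the relations between the sheets. -/
theorem exists_iso {E : MarkedCover X.IsTop d} (hE : M.toMarkedCover = E) :
    ∃ φ : f.Iso E.toCover, ∀ a, φ.1 (M.sheet a) = E.sheetCell a := by
  subst hE
  choose a ha using M.exists_sheet_ge
  have hle : ∀ e, f.map e ≤ (a e).1.1 := fun e => (f.mono (ha e)).trans (M.map_sheet _).le
  let F : f.Cell ↪o M.toMarkedCover.toCover.Cell := OrderEmbedding.ofMapLEIff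
    (fun e => M.toMarkedCover.face (f.map e) (a e) (hle e)) (fun e e' => by
      refine (M.toMarkedCover.face_le_face _ _).trans ?_
      constructor
      · rintro ⟨h, e'', h1, h2, h3⟩
        obtain rfl := f.face_unique h2 (ha e) h1
        exact f.le_of_map_le h3 (ha e') h
      · intro h
        exact ⟨f.mono h, e, rfl, ha e, h.trans (ha e')⟩)
  have hF : Function.Surjective F := by
    intro c
    obtain ⟨b, hb, hc⟩ := M.toMarkedCover.exists_face c
    obtain ⟨e, he, h⟩ := f.exists_face (hb.trans (M.map_sheet b).ge)
    refine ⟨e, Eq.trans ?_ hc.symm⟩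
    exact (M.toMarkedCover.face_eq_face (hle e) hb).mpr ⟨h, e, rfl, ha e, he⟩
  refine ⟨⟨RelIso.ofSurjective F hF, fun e => rfl⟩, fun b => ?_⟩
  exact (M.toMarkedCover.face_eq_face (hle _) le_rfl).mpr ⟨M.map_sheet b, _, rfl, ha _, le_rfl⟩

end Marking

end Cover

namespace MarkedCover

variable {n d : ℕ} {X : SimpleComplex n}

/-- The tautological marking of the covering described by relations between sheets. -/
def marking (E : MarkedCover X.IsTop d) : E.toCover.Marking where
  sheet := E.sheetCell
  map_sheet _ := rfl
  injective := E.sheetCell_injective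
  surjective e h := by
    obtain ⟨a, rfl⟩ := E.exists_sheetCell h
    exact ⟨a, rfl⟩

theorem toMarkedCover_marking (E : MarkedCover X.IsTop d) : E.marking.toMarkedCover = E := by
  ext x a b
  constructor
  · rintro ⟨e, rfl, h1, h2⟩
    obtain ⟨c, hc, he⟩ := E.exists_face e
    have h1' := he.symm.trans_le h1
    have h2' := he.symm.trans_le h2
    erw [face_le_sheetCell] at h1' h2'
    exact E.trans (E.symm h1') h2'
  · intro h
    exact ⟨E.face x a (E.le_of_rel h), rfl, (E.face_le_sheetCell _).mpr (E.refl (E.le_of_rel h)),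
      (E.face_le_sheetCell _).mpr h⟩

end MarkedCover

namespace Cover

variable {n d : ℕ} {X : SimpleComplex n}

def Iso.symm {f g : Cover X d} (φ : f.Iso g) : g.Iso f :=
  ⟨φ.1.symm, fun e => by simpa using (φ.2 (φ.1.symm e)).symm⟩

def Iso.trans {f g h : Cover X d} (φ : f.Iso g) (ψ : g.Iso h) : f.Iso h :=
  ⟨φ.1.trans ψ.1, fun e => (ψ.2 _).trans (φ.2 e)⟩

/-- Isomorphisms of coverings are determined by their effect on the sheets. -/
theorem Marking.iso_ext {f g : Cover X d} (M : f.Marking) {φ ψ : f.Iso g}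
    (h : ∀ a, φ.1 (M.sheet a) = ψ.1 (M.sheet a)) : φ = ψ := by
  refine Subtype.ext (OrderIso.ext (funext fun e => ?_))
  obtain ⟨a, ha⟩ := M.exists_sheet_ge e
  have h1 := φ.1.monotone ha
  have h2 := ψ.1.monotone ha
  rw [h] at h1
  exact g.face_unique h1 h2 ((φ.2 e).trans (ψ.2 e).symm)

/-- Renumbering the sheets. -/
def Marking.twist {f : Cover X d} (M : f.Marking) (g : Gauge X.IsTop d) : f.Marking where
  sheet a := M.sheet (g⁻¹.move a)
  map_sheet a := M.map_sheet _
  injective a b h := by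
    have := M.injective h
    rw [← g.move_move_inv a, this, g.move_move_inv]
  surjective e he := by
    obtain ⟨a, rfl⟩ := M.surjective e he
    exact ⟨g.move a, by simp⟩

theorem Marking.toMarkedCover_twist {f : Cover X d} (M : f.Marking) (g : Gauge X.IsTop d) :
    (M.twist g).toMarkedCover = g • M.toMarkedCover := rfl

theorem Marking.exists_gauge {f g : Cover X d} (M : f.Marking) (N : g.Marking) (φ : f.Iso g) :
    ∃ γ : Gauge X.IsTop d, ∀ a, φ.1 (M.sheet a) = N.sheet (γ.move a) := by
  have h : ∀ a, ∃ i, φ.1 (M.sheet a) = N.sheet (a.1, i) := fun a => by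
    have h1 : g.map (φ.1 (M.sheet a)) = a.1.1 := (φ.2 _).trans (M.map_sheet a)
    obtain ⟨b, hb⟩ := N.surjective (φ.1 (M.sheet a)) (by rw [h1]; exact a.1.2)
    obtain ⟨z, i⟩ := b
    obtain rfl : z = a.1 := Subtype.ext <| by
      rw [← h1, ← hb, N.map_sheet]
    exact ⟨i, hb.symm⟩
  choose γ hγ using h
  have hinj : ∀ z, Function.Injective fun i => γ (z, i) := fun z i j hij => by
    have := hγ (z, i)
    rw [show γ (z, i) = γ (z, j) from hij] at this
    have h2 := M.injective (φ.1.injective (this.trans (hγ (z, j)).symm))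
    exact congrArg Prod.snd h2
  exact ⟨fun z => Equiv.ofBijective _ (Finite.injective_iff_bijective.mp (hinj z)), fun a => hγ a⟩

theorem Marking.toMarkedCover_eq {f g : Cover X d} (M : f.Marking) (N : g.Marking) (φ : f.Iso g)
    (h : ∀ a, φ.1 (M.sheet a) = N.sheet a) : M.toMarkedCover = N.toMarkedCover := by
  ext x a b
  constructor
  · rintro ⟨e, rfl, h1, h2⟩
    exact ⟨φ.1 e, φ.2 e, h a ▸ φ.1.monotone h1, h b ▸ φ.1.monotone h2⟩
  · rintro ⟨e, rfl, h1, h2⟩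
    refine ⟨φ.symm.1 e, φ.symm.2 e, ?_, ?_⟩
    · exact (φ.1.symm_apply_le).mpr (h1.trans (h a).ge)
    · exact (φ.1.symm_apply_le).mpr (h2.trans (h b).ge)

/-- The isomorphisms between two coverings with marked sheets are the renumberings which take the
relations of the first to those of the second. -/
theorem Marking.card_iso {f g : Cover X d} (M : f.Marking) (N : g.Marking) :
    Nat.card (f.Iso g) =
      Nat.card {γ : Gauge X.IsTop d // γ • M.toMarkedCover = N.toMarkedCover} := by
  choose γ hγ using M.exists_gauge N
  have hmem : ∀ φ, γ φ • M.toMarkedCover = N.toMarkedCover := fun φ => by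
    rw [← toMarkedCover_twist]
    refine toMarkedCover_eq _ _ φ fun a => ?_
    exact (hγ φ _).trans (by rw [Gauge.move_move_inv])
  refine Nat.card_congr (Equiv.ofBijective (fun φ => ⟨γ φ, hmem φ⟩) ⟨fun φ ψ h => ?_, ?_⟩)
  · refine M.iso_ext fun a => ?_
    rw [hγ, hγ, show γ φ = γ ψ from congrArg Subtype.val h]
  · rintro ⟨δ, hδ⟩
    obtain ⟨φ₁, h₁⟩ := (M.twist δ).exists_iso hδ
    obtain ⟨φ₂, h₂⟩ := N.exists_iso rfl
    have key : ∀ a, (φ₁.trans φ₂.symm).1 (M.sheet a) = N.sheet (δ.move a) := fun a => by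
      have h3 := h₁ (δ.move a)
      rw [show (M.twist δ).sheet (δ.move a) = M.sheet a by simp [twist]] at h3
      refine (congrArg φ₂.1.symm (h3.trans (h₂ _).symm)).trans (φ₂.1.symm_apply_apply _)
    refine ⟨φ₁.trans φ₂.symm, Subtype.ext (funext fun z => Equiv.ext fun i => ?_)⟩
    have := N.injective ((hγ _ (z, i)).symm.trans (key (z, i)))
    exact congrArg Prod.snd this

end Cover

namespace MarkedCover

variable {n d : ℕ} {X : SimpleComplex n}

theorem card_iso (E F : MarkedCover X.IsTop d) :
    Nat.card (E.toCover.Iso F.toCover) = Nat.card {γ : Gauge X.IsTop d // γ • E = F} := by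
  rw [E.marking.card_iso F.marking, toMarkedCover_marking, toMarkedCover_marking]

theorem nonempty_iso_iff (E F : MarkedCover X.IsTop d) :
    Nonempty (E.toCover.Iso F.toCover) ↔ ∃ γ : Gauge X.IsTop d, γ • E = F := by
  have : Finite (E.toCover.Iso F.toCover) :=
    Finite.of_injective (fun φ => (φ.1 : _ → _)) fun φ ψ h => Subtype.ext (OrderIso.ext h)
  rw [← Finite.card_pos_iff, card_iso, Finite.card_pos_iff, nonempty_subtype]

end MarkedCover

/-- Every covering is given by relations between numbered sheets. -/
theorem Cover.exists_toCover_iso {n d : ℕ} {X : SimpleComplex n} (f : Cover X d) :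
    ∃ E : MarkedCover X.IsTop d, Nonempty (f.Iso E.toCover) := by
  obtain ⟨M⟩ := f.exists_marking
  obtain ⟨φ, -⟩ := M.exists_iso rfl
  exact ⟨_, ⟨φ⟩⟩

/-! ### Restriction and gluing of marked coverings -/

/-- An isomorphism of a poset of cells onto an upper set of another one, which preserves the
maximal cells.  Marked coverings can be restricted along such maps. -/
structure UpperMap {P Q : Type} [PartialOrder P] [PartialOrder Q] (s : P → Prop) (t : Q → Prop)
    where
  toOrderEmbedding : P ↪o Q
  upper : ∀ {p q}, toOrderEmbedding p ≤ q → ∃ p', toOrderEmbedding p' = q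
  top_iff : ∀ p, t (toOrderEmbedding p) ↔ s p

namespace UpperMap

variable {P Q R : Type} [PartialOrder P] [PartialOrder Q] [PartialOrder R]
  {s : P → Prop} {t : Q → Prop} {r : R → Prop} {d : ℕ}

instance : CoeFun (UpperMap s t) fun _ => P → Q := ⟨fun j => j.toOrderEmbedding⟩

theorem le_iff (j : UpperMap s t) {x y : P} : j x ≤ j y ↔ x ≤ y := j.toOrderEmbedding.le_iff_le

theorem injective (j : UpperMap s t) : Function.Injective j := j.toOrderEmbedding.injective

/-- The map of sheets. -/
def sheet (j : UpperMap s t) (a : Sheet s d) : Sheet t d :=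
  (⟨j a.1.1, (j.top_iff _).mpr a.1.2⟩, a.2)

theorem sheet_injective (j : UpperMap s t) : Function.Injective (j.sheet (d := d)) := fun _ _ h =>
  Prod.ext (Subtype.ext (j.injective (congrArg (fun c : Sheet t d => c.1.1) h)))
    (congrArg (fun c : Sheet t d => c.2) h)

theorem exists_sheet (j : UpperMap s t) {x : P} {a : Sheet t d} (h : j x ≤ a.1.1) :
    ∃ b, j.sheet b = a := by
  obtain ⟨⟨y, hy⟩, i⟩ := a
  obtain ⟨p, rfl⟩ := j.upper h
  exact ⟨(⟨p, (j.top_iff p).mp hy⟩, i), rfl⟩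

def comp (k : UpperMap t r) (j : UpperMap s t) : UpperMap s r where
  toOrderEmbedding := j.toOrderEmbedding.trans k.toOrderEmbedding
  upper {p q} h := by
    obtain ⟨q', rfl⟩ := k.upper h
    obtain ⟨p', rfl⟩ := j.upper (k.le_iff.mp h)
    exact ⟨p', rfl⟩
  top_iff p := (k.top_iff _).trans (j.top_iff p)

/-- An isomorphism of posets. -/
def ofIso (e : P ≃o Q) (h : ∀ p, t (e p) ↔ s p) : UpperMap s t where
  toOrderEmbedding := e.toOrderEmbedding
  upper {_ q} _ := e.surjective q
  top_iff := h

/-- The restriction of renumberings. -/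
def gauge (j : UpperMap s t) (g : Gauge t d) : Gauge s d :=
  fun z => g ⟨j z.1, (j.top_iff _).mpr z.2⟩

theorem gauge_surjective (j : UpperMap s t) : Function.Surjective (j.gauge (d := d)) := by
  classical
  intro g
  refine ⟨fun z => if h : ∃ p : {p // s p}, j p.1 = z.1 then g h.choose else 1, funext fun p => ?_⟩
  have h : ∃ p' : {p // s p}, j p'.1 = j p.1 := ⟨p, rfl⟩
  change (if h : ∃ p' : {p // s p}, j p'.1 = j p.1 then g h.choose else 1) = g p
  rw [dif_pos h]
  exact congrArg g (Subtype.ext (j.injective h.choose_spec))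

theorem gauge_injective (j : UpperMap s t) (hj : Function.Surjective j) :
    Function.Injective (j.gauge (d := d)) := fun g h hgh => funext fun z => by
  obtain ⟨z, hz⟩ := z
  obtain ⟨p, rfl⟩ := hj z
  exact congrFun hgh ⟨p, (j.top_iff p).mp hz⟩

/-- The restriction of a marked covering. -/
def pullback (j : UpperMap s t) (E : MarkedCover t d) : MarkedCover s d where
  rel x a b := E.rel (j x) (j.sheet a) (j.sheet b)
  le_of_rel h := j.le_iff.mp (E.le_of_rel h :)
  refl {_ a} h := E.refl (a := j.sheet a) (j.le_iff.mpr h)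
  symm h := E.symm h
  trans h h' := E.trans h h'
  mono h h' := E.mono (j.le_iff.mpr h) h'
  eq_of_top {a _} h := j.sheet_injective (E.eq_of_top (a := j.sheet a) h)
  card {_ a} z z' h hz hz' := E.card (a := j.sheet a) ⟨j z.1, (j.top_iff _).mpr z.2⟩
    ⟨j z'.1, (j.top_iff _).mpr z'.2⟩ (j.le_iff.mpr h) (j.le_iff.mpr hz) (j.le_iff.mpr hz')

theorem pullback_rel (j : UpperMap s t) (E : MarkedCover t d) (x a b) :
    (j.pullback E).rel x a b ↔ E.rel (j x) (j.sheet a) (j.sheet b) := Iff.rfl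

theorem pullback_comp (k : UpperMap t r) (j : UpperMap s t) (E : MarkedCover r d) :
    (k.comp j).pullback E = j.pullback (k.pullback E) := rfl

theorem pullback_smul (j : UpperMap s t) (g : Gauge t d) (E : MarkedCover t d) :
    j.pullback (g • E) = j.gauge g • j.pullback E := rfl

theorem pullback_congr {j k : UpperMap s t} (h : ∀ x, j x = k x) (E : MarkedCover t d) :
    j.pullback E = k.pullback E := by
  have h' : ∀ a : Sheet s d, j.sheet a = k.sheet a := fun a => Prod.ext (Subtype.ext (h _)) rfl
  ext x a b
  rw [pullback_rel, pullback_rel, h, h', h']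

theorem pullback_injective (j : UpperMap s t) (hj : Function.Surjective j) :
    Function.Injective (j.pullback (d := d)) := fun E F h => by
  ext x a b
  obtain ⟨p, rfl⟩ := hj x
  by_cases ha : j p ≤ a.1.1
  · by_cases hb : j p ≤ b.1.1
    · obtain ⟨a, rfl⟩ := j.exists_sheet ha
      obtain ⟨b, rfl⟩ := j.exists_sheet hb
      rw [← pullback_rel, ← pullback_rel, h]
    · exact ⟨fun h => absurd (E.le_of_rel' h) hb, fun h => absurd (F.le_of_rel' h) hb⟩
  · exact ⟨fun h => absurd (E.le_of_rel h) ha, fun h => absurd (F.le_of_rel h) ha⟩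

end UpperMap

namespace MarkedCover

variable {P Q R C : Type} [PartialOrder P] [PartialOrder Q] [PartialOrder R] [PartialOrder C]
  {s : P → Prop} {t : Q → Prop} {r : R → Prop} {c : C → Prop} {d : ℕ}

/-- Being a marked covering is a local property of the relations between the sheets. -/
def ofLocal (rel : R → Sheet r d → Sheet r d → Prop)
    (le_of_rel : ∀ {x a b}, rel x a b → x ≤ a.1.1 ∧ x ≤ b.1.1)
    (H : ∀ x, ∃ (P : Type) (_ : PartialOrder P) (s : P → Prop) (j : UpperMap s r) (p : P)
      (E : MarkedCover s d), j p = x ∧ ∀ y a b, rel (j y) (j.sheet a) (j.sheet b) ↔ E.rel y a b) :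
    MarkedCover r d where
  rel := rel
  le_of_rel h := (le_of_rel h).1
  refl {x a} h := by
    obtain ⟨P, _, s, j, p, E, rfl, hE⟩ := H x
    obtain ⟨a, rfl⟩ := j.exists_sheet h
    exact (hE _ _ _).mpr (E.refl (j.le_iff.mp h))
  symm {x _ _} h := by
    obtain ⟨P, _, s, j, p, E, rfl, hE⟩ := H x
    obtain ⟨a, rfl⟩ := j.exists_sheet (le_of_rel h).1
    obtain ⟨b, rfl⟩ := j.exists_sheet (le_of_rel h).2
    exact (hE _ _ _).mpr (E.symm ((hE _ _ _).mp h))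
  trans {x _ _ _} h h' := by
    obtain ⟨P, _, s, j, p, E, rfl, hE⟩ := H x
    obtain ⟨a, rfl⟩ := j.exists_sheet (le_of_rel h).1
    obtain ⟨b, rfl⟩ := j.exists_sheet (le_of_rel h).2
    obtain ⟨c, rfl⟩ := j.exists_sheet (le_of_rel h').2
    exact (hE _ _ _).mpr (E.trans ((hE _ _ _).mp h) ((hE _ _ _).mp h'))
  mono {x _ _ _} hxy h := by
    obtain ⟨P, _, s, j, p, E, rfl, hE⟩ := H x
    obtain ⟨q, rfl⟩ := j.upper hxy
    obtain ⟨a, rfl⟩ := j.exists_sheet (le_of_rel h).1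
    obtain ⟨b, rfl⟩ := j.exists_sheet (le_of_rel h).2
    exact (hE _ _ _).mpr (E.mono (j.le_iff.mp hxy) ((hE _ _ _).mp h))
  eq_of_top {a _} h := by
    obtain ⟨P, _, s, j, p, E, hp, hE⟩ := H a.1.1
    obtain ⟨a, rfl⟩ := j.exists_sheet hp.le
    obtain rfl : p = a.1.1 := j.injective hp
    obtain ⟨b, rfl⟩ := j.exists_sheet (le_of_rel h).2
    exact congrArg j.sheet (E.eq_of_top ((hE _ _ _).mp h))
  card {x a} z z' h hz hz' := by
    obtain ⟨P, _, s, j, p, E, rfl, hE⟩ := H x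
    obtain ⟨a, rfl⟩ := j.exists_sheet h
    obtain ⟨z, hzt⟩ := z
    obtain ⟨z', hzt'⟩ := z'
    obtain ⟨z, rfl⟩ := j.upper hz
    obtain ⟨z', rfl⟩ := j.upper hz'
    have key : ∀ (z : {z // s z}), Nat.card {i // rel (j p) (j.sheet a) (j.sheet (z, i))} =
        Nat.card {i // E.rel p a (z, i)} := fun z =>
      Nat.card_congr (Equiv.subtypeEquivRight fun i => hE _ _ _)
    exact (key ⟨z, (j.top_iff z).mp hzt⟩).trans ((E.card _ _ (j.le_iff.mp h) (j.le_iff.mp hz)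
      (j.le_iff.mp hz')).trans (key ⟨z', (j.top_iff z').mp hzt'⟩).symm)

/-- Marked coverings are determined by their restrictions to the members of a cover by
upper sets. -/
theorem eq_of_pullback_eq (j : UpperMap s r) (k : UpperMap t r)
    (h : ∀ x, (∃ p, j p = x) ∨ ∃ q, k q = x) {E F : MarkedCover r d}
    (hj : j.pullback E = j.pullback F) (hk : k.pullback E = k.pullback F) : E = F := by
  ext x a b
  by_cases ha : x ≤ a.1.1 ∧ x ≤ b.1.1
  · obtain ⟨ha, hb⟩ := ha
    rcases h x with ⟨p, rfl⟩ | ⟨p, rfl⟩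
    · obtain ⟨a, rfl⟩ := j.exists_sheet ha
      obtain ⟨b, rfl⟩ := j.exists_sheet hb
      rw [← UpperMap.pullback_rel, ← UpperMap.pullback_rel, hj]
    · obtain ⟨a, rfl⟩ := k.exists_sheet ha
      obtain ⟨b, rfl⟩ := k.exists_sheet hb
      rw [← UpperMap.pullback_rel, ← UpperMap.pullback_rel, hk]
  · exact ⟨fun h => absurd ⟨E.le_of_rel h, E.le_of_rel' h⟩ ha,
      fun h => absurd ⟨F.le_of_rel h, F.le_of_rel' h⟩ ha⟩

/-- Marked coverings of two upper sets which agree on the intersection can be glued. -/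
theorem exists_glue (j : UpperMap s r) (k : UpperMap t r)
    (h : ∀ x, (∃ p, j p = x) ∨ ∃ q, k q = x) (E : MarkedCover s d) (F : MarkedCover t d)
    (u : UpperMap c s) (v : UpperMap c t) (huv : ∀ x, j (u x) = k (v x))
    (hc : ∀ p q, j p = k q → ∃ x, u x = p ∧ v x = q) (hEF : u.pullback E = v.pullback F) :
    ∃ G : MarkedCover r d, j.pullback G = E ∧ k.pullback G = F := by
  have hsh : ∀ x : Sheet c d, j.sheet (u.sheet x) = k.sheet (v.sheet x) := fun a =>
    Prod.ext (Subtype.ext (huv _)) rfl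
  have hcs : ∀ (a : Sheet s d) (b : Sheet t d), j.sheet a = k.sheet b →
      ∃ x, u.sheet x = a ∧ v.sheet x = b := by
    rintro ⟨⟨p, hp⟩, i⟩ ⟨⟨q, hq⟩, i'⟩ hab
    obtain ⟨x, rfl, rfl⟩ := hc p q (congrArg (fun c : Sheet r d => c.1.1) hab)
    obtain rfl : i = i' := congrArg (fun c : Sheet r d => c.2) hab
    exact ⟨(⟨x, (u.top_iff x).mp hp⟩, i), rfl, rfl⟩
  let rel : R → Sheet r d → Sheet r d → Prop := fun x a b =>
    (∃ p a' b', j p = x ∧ j.sheet a' = a ∧ j.sheet b' = b ∧ E.rel p a' b') ∨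
    (∃ q a' b', k q = x ∧ k.sheet a' = a ∧ k.sheet b' = b ∧ F.rel q a' b')
  have hE : ∀ p a b, rel (j p) (j.sheet a) (j.sheet b) ↔ E.rel p a b := by
    intro p a b
    constructor
    · rintro (⟨p', a', b', h1, h2, h3, h4⟩ | ⟨q, a', b', h1, h2, h3, h4⟩)
      · rwa [j.injective h1, j.sheet_injective h2, j.sheet_injective h3] at h4
      · obtain ⟨x, rfl, rfl⟩ := hc _ _ h1.symm
        obtain ⟨a, rfl, rfl⟩ := hcs _ _ h2.symm
        obtain ⟨b, rfl, rfl⟩ := hcs _ _ h3.symm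
        rwa [← UpperMap.pullback_rel, ← hEF] at h4
    · exact fun h => Or.inl ⟨p, a, b, rfl, rfl, rfl, h⟩
  have hF : ∀ q a b, rel (k q) (k.sheet a) (k.sheet b) ↔ F.rel q a b := by
    intro q a b
    constructor
    · rintro (⟨p, a', b', h1, h2, h3, h4⟩ | ⟨q', a', b', h1, h2, h3, h4⟩)
      · obtain ⟨x, rfl, rfl⟩ := hc _ _ h1
        obtain ⟨a, rfl, rfl⟩ := hcs _ _ h2
        obtain ⟨b, rfl, rfl⟩ := hcs _ _ h3
        rwa [← UpperMap.pullback_rel, hEF] at h4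
      · rwa [k.injective h1, k.sheet_injective h2, k.sheet_injective h3] at h4
    · exact fun h => Or.inr ⟨q, a, b, rfl, rfl, rfl, h⟩
  refine ⟨ofLocal rel ?_ ?_, ?_, ?_⟩
  · rintro x a b (⟨p, a, b, rfl, rfl, rfl, h⟩ | ⟨p, a, b, rfl, rfl, rfl, h⟩)
    · exact ⟨j.le_iff.mpr (E.le_of_rel h), j.le_iff.mpr (E.le_of_rel' h)⟩
    · exact ⟨k.le_iff.mpr (F.le_of_rel h), k.le_iff.mpr (F.le_of_rel' h)⟩
  · intro x
    rcases h x with ⟨p, rfl⟩ | ⟨p, rfl⟩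
    · exact ⟨P, _, s, j, p, E, rfl, hE⟩
    · exact ⟨Q, _, t, k, p, F, rfl, hF⟩
  · ext x a b
    exact hE x a b
  · ext x a b
    exact hF x a b

/-- The number of renumberings. -/
theorem card_gauge {P : Type} [Finite P] {s : P → Prop} {d : ℕ} :
    Nat.card (Gauge s d) = d.factorial ^ Nat.card {z // s z} := by
  have := Fintype.ofFinite {z // s z}
  rw [Nat.card_pi, Finset.prod_const, Finset.card_univ, Nat.card_eq_fintype_card,
    Fintype.card_perm, Fintype.card_fin, Nat.card_eq_fintype_card]

end MarkedCover

/-! ### Classes of coverings of connected coloured complexes -/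

namespace ColoredComplex

variable {n : ℕ} {S : Type*}

/-- The map of posets underlying an isomorphism. -/
def Iso.upperMap {X Y : ColoredComplex n S} (φ : Iso X Y) : UpperMap X.IsTop Y.IsTop :=
  UpperMap.ofIso φ.toOrderIso fun p => by
    rw [SimpleComplex.IsTop, SimpleComplex.IsTop, φ.dim_eq]

/-- Connected coloured complexes have no automorphisms: cells of positive dimension are
distinguished by their colours, and the two vertices of an edge by the orientation. -/
theorem Connected.apply_eq {X : ColoredComplex n S} (hX : X.Connected) (φ : Iso X X) (x : X.Cell) :
    φ.toOrderIso x = x := by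
  have hpos : ∀ x, 0 < X.dim x → φ.toOrderIso x = x := fun x hx => by
    have hx' : 0 < X.dim (φ.toOrderIso x) := by rwa [φ.dim_eq]
    exact X.color_inj hx' hx (hX.2 _ _) (φ.dim_eq x) (φ.color_eq x hx hx')
  rcases Nat.eq_zero_or_pos (X.dim x) with h0 | hx
  · by_cases hn : n = 0
    · have key : ∀ a b : X.Cell, Relation.EqvGen (· ≤ ·) a b → a = b := by
        intro a b h
        induction h with
        | rel a b h =>
          by_contra hne
          have h1 := X.dim_lt (lt_of_le_of_ne h hne)
          have h2 := X.dim_le b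
          omega
        | refl a => rfl
        | symm a b _ ih => exact ih.symm
        | trans a b c _ _ ih ih' => exact ih.trans ih'
      exact key _ _ (hX.2 _ _)
    · obtain ⟨y, hxy, hy⟩ := X.pure x
      have hlt : x < y := lt_of_le_of_ne hxy fun h => by rw [← h] at hy; omega
      obtain ⟨e, hxe, -⟩ := X.exists_covBy_le hlt
      have hde : X.dim e = 1 := by rw [X.dim_covBy hxe, h0]
      have he := hpos e (by omega)
      by_contra hne
      have h1 : φ.toOrderIso x < e := by
        have := φ.toOrderIso.lt_iff_lt.mpr hxe.lt
        rwa [he] at this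
      have h2 := X.inc_edge hde hxe.lt h1 (Ne.symm hne)
      have h3 := φ.inc_eq hxe
      rw [he] at h3
      rw [h3] at h2
      exact units_ne_neg_self _ h2
  · exact hpos x hx

theorem Connected.iso_eq {X Y : ColoredComplex n S} (hX : X.Connected) (φ ψ : Iso X Y) :
    φ.toOrderIso = ψ.toOrderIso := by
  ext x
  have h := hX.apply_eq (φ.trans ψ.symm) x
  exact (ψ.toOrderIso.symm_apply_eq).mp h

end ColoredComplex

namespace Cover

variable {n d : ℕ}

/-- The transport of a covering along an isomorphism of the base. -/
def reindex {X Y : SimpleComplex n} (e : X.Cell ≃o Y.Cell) (he : ∀ x, Y.dim (e x) = X.dim x)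
    (f : Cover Y d) : Cover X d where
  Cell := f.Cell
  map c := e.symm (f.map c)
  mono _ _ h := e.symm.monotone (f.mono h)
  lift c x hx := by
    obtain ⟨c', ⟨h1, h2⟩, h3⟩ := f.lift c (e x) ((e.le_symm_apply).mp hx)
    refine ⟨c', ⟨h1, by rw [h2, e.symm_apply_apply]⟩, fun y hy => h3 y ⟨hy.1, ?_⟩⟩
    rw [← hy.2, e.apply_symm_apply]
  card_fiber x hx := by
    refine Eq.trans ?_ (f.card_fiber (e x) ((he x).trans hx))
    exact Nat.card_congr (Equiv.subtypeEquivRight fun c => e.symm_apply_eq)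
  transfer := by
    obtain ⟨m, hm, hmc⟩ := f.transfer
    refine ⟨m, hm, fun c x hcx hx => ?_⟩
    rw [← hmc c (e x) ((e.symm_apply_le).mp hcx) ((he x).trans hx)]
    exact Nat.card_congr (Equiv.subtypeEquivRight fun c => and_congr_right fun _ => e.symm_apply_eq)

/-- The marking of a covering transported along an isomorphism of the base. -/
def Marking.reindex {X Y : SimpleComplex n} {e : X.Cell ≃o Y.Cell}
    {he : ∀ x, Y.dim (e x) = X.dim x} {f : Cover Y d} (M : f.Marking)
    (j : UpperMap X.IsTop Y.IsTop) (hj : ∀ x, j x = e x) : (f.reindex e he).Marking where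
  sheet a := M.sheet (j.sheet a)
  map_sheet a := (e.symm_apply_eq).mpr ((M.map_sheet _).trans (hj _))
  injective := M.injective.comp j.sheet_injective
  surjective c hc := by
    have h : Y.IsTop (f.map c) := by
      have := (he (e.symm (f.map c))).trans hc
      rwa [e.apply_symm_apply] at this
    obtain ⟨a, rfl⟩ := M.surjective c h
    obtain ⟨b, rfl⟩ := j.exists_sheet (x := e.symm a.1.1) (a := a) (by rw [hj, e.apply_symm_apply])
    exact ⟨b, rfl⟩

theorem Marking.toMarkedCover_reindex {X Y : SimpleComplex n} {e : X.Cell ≃o Y.Cell}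
    {he : ∀ x, Y.dim (e x) = X.dim x} {f : Cover Y d} (M : f.Marking)
    (j : UpperMap X.IsTop Y.IsTop) (hj : ∀ x, j x = e x) :
    (M.reindex (he := he) j hj).toMarkedCover = j.pullback M.toMarkedCover := by
  ext x a b
  constructor
  · rintro ⟨c, hc, h1, h2⟩
    exact ⟨c, ((e.symm_apply_eq).mp hc).trans (hj _).symm, h1, h2⟩
  · rintro ⟨c, hc, h1, h2⟩
    exact ⟨c, (e.symm_apply_eq).mpr (hc.trans (hj _)), h1, h2⟩

end Cover

namespace MarkedCover

variable {n d : ℕ} {S : Type*}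

/-- The class of the covering of a connected coloured complex. -/
def type (X : ConnColored n S) (E : MarkedCover X.1.IsTop d) : CoverType n S d :=
  Quotient.mk _ ⟨X, E.toCover⟩

theorem type_star (X : ConnColored n S) (E : MarkedCover X.1.IsTop d) :
    (E.type X).star = MarkedCover.type (n := n) (S := S) ⟨X.1.star, X.2⟩ E := rfl

theorem exists_type_eq (X : ConnColored n S) (β : CoverType n S d)
    (h : β.base = Quotient.mk _ X) : ∃ E : MarkedCover X.1.IsTop d, E.type X = β := by
  induction β using Quotient.inductionOn with
  | _ f =>
    obtain ⟨φ⟩ : Nonempty (ColoredComplex.Iso f.base.1 X.1) := Quotient.exact h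
    obtain ⟨E, ⟨ψ⟩⟩ := (f.cover.reindex φ.symm.toOrderIso φ.symm.dim_eq).exists_toCover_iso
    exact ⟨E, Quotient.sound ⟨⟨φ.symm, ψ.1.symm, fun e =>
      (OrderIso.symm_apply_eq φ.symm.toOrderIso).mp (ψ.symm.2 e)⟩⟩⟩

theorem type_eq_iff_iso {X Y : ConnColored n S} (φ : ColoredComplex.Iso X.1 Y.1)
    (E : MarkedCover X.1.IsTop d) (F : MarkedCover Y.1.IsTop d) :
    E.type X = F.type Y ↔ Nonempty (E.toCover.Iso (φ.upperMap.pullback F).toCover) := by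
  obtain ⟨ψ, -⟩ := (F.marking.reindex (e := φ.toOrderIso) (he := φ.dim_eq) φ.upperMap
    fun _ => rfl).exists_iso (E := φ.upperMap.pullback F)
      ((Cover.Marking.toMarkedCover_reindex _ _ _).trans
        (congrArg φ.upperMap.pullback F.toMarkedCover_marking))
  constructor
  · intro h
    obtain ⟨ε⟩ := Quotient.exact h
    have hε : ε.baseIso.toOrderIso = φ.toOrderIso := X.2.iso_eq _ _
    refine ⟨Cover.Iso.trans (g := F.toCover.reindex φ.toOrderIso φ.dim_eq) ⟨ε.totalIso, ?_⟩ ψ⟩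
    intro e
    refine (OrderIso.symm_apply_eq _).mpr ?_
    exact (ε.comm e).trans (congrArg (fun χ : X.1.Cell ≃o Y.1.Cell => χ (E.toCover.map e)) hε)
  · rintro ⟨ε⟩
    have ε' := ε.trans ψ.symm
    refine Quotient.sound ⟨⟨φ, ε'.1, fun e => ?_⟩⟩
    exact (OrderIso.symm_apply_eq _).mp (ε'.2 e)

/-- Two marked coverings of connected coloured complexes have the same class if and only if
they differ by a renumbering of the sheets. -/
theorem type_eq_iff {X Y : ConnColored n S} (φ : ColoredComplex.Iso X.1 Y.1)
    (E : MarkedCover X.1.IsTop d) (F : MarkedCover Y.1.IsTop d) :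
    E.type X = F.type Y ↔ ∃ γ : Gauge X.1.IsTop d, γ • E = φ.upperMap.pullback F := by
  rw [type_eq_iff_iso φ, nonempty_iso_iff]

theorem type_smul (X : ConnColored n S) (E : MarkedCover X.1.IsTop d) (γ : Gauge X.1.IsTop d) :
    (γ • E).type X = E.type X := by
  rw [eq_comm, type_eq_iff (.refl _)]
  exact ⟨γ, rfl⟩

theorem type_pullback {X Y : ConnColored n S} (φ : ColoredComplex.Iso X.1 Y.1)
    (F : MarkedCover Y.1.IsTop d) : (φ.upperMap.pullback F).type X = F.type Y := by
  rw [type_eq_iff φ]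
  exact ⟨1, one_smul _ _⟩

open Classical in
/-- The number of renumberings which take a given marked covering to another one. -/
theorem card_smul_eq {X Y : ConnColored n S} (φ : ColoredComplex.Iso X.1 Y.1)
    (E : MarkedCover X.1.IsTop d) (F : MarkedCover Y.1.IsTop d) :
    Nat.card {γ : Gauge X.1.IsTop d // γ • E = φ.upperMap.pullback F} =
      if E.type X = F.type Y then (E.type X).autCard else 0 := by
  split_ifs with h
  · obtain ⟨ε⟩ := (type_eq_iff_iso φ E F).mp h
    rw [← card_iso]
    exact Nat.card_congr
      { toFun := fun α => α.trans ε.symm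
        invFun := fun α => α.trans ε
        left_inv := fun α => Subtype.ext (by ext; simp [Cover.Iso.trans, Cover.Iso.symm])
        right_inv := fun α => Subtype.ext (by ext; simp [Cover.Iso.trans, Cover.Iso.symm]) }
  · rw [type_eq_iff φ] at h
    rw [Nat.card_eq_zero, isEmpty_subtype]
    exact Or.inl (not_exists.mp h)

open Classical in
/-- The number of isomorphisms between the restrictions of two marked coverings along
identifications of one poset with the two bases. -/
theorem card_smul_pullback_eq {X Y : ConnColored n S} (φ : ColoredComplex.Iso X.1 Y.1)
    {Q : Type} [PartialOrder Q] {q : Q → Prop} (k : UpperMap q X.1.IsTop) (l : UpperMap q Y.1.IsTop)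
    (hk : Function.Surjective k) (hkl : ∀ x, φ.toOrderIso (k x) = l x)
    (E : MarkedCover X.1.IsTop d) (F : MarkedCover Y.1.IsTop d) :
    Nat.card {γ : Gauge q d // γ • k.pullback E = l.pullback F} =
      if E.type X = F.type Y then (E.type X).autCard else 0 := by
  rw [← card_smul_eq φ]
  have hl : l.pullback F = k.pullback (φ.upperMap.pullback F) := by
    rw [← UpperMap.pullback_comp]
    exact UpperMap.pullback_congr (fun x => (hkl x).symm) F
  refine (Nat.card_congr (Equiv.subtypeEquiv (Equiv.ofBijective (k.gauge (d := d))
    ⟨k.gauge_injective hk, k.gauge_surjective⟩) fun γ => ?_)).symm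
  rw [hl]
  exact ((k.pullback_injective hk).eq_iff (a := γ • E)).symm

open Classical in
/-- The number of marked coverings in a given class: orbits and stabilizers. -/
theorem card_type_eq_mul (X : ConnColored n S) (β : CoverType n S d)
    (h : β.base = Quotient.mk _ X) :
    Nat.card {E : MarkedCover X.1.IsTop d // E.type X = β} * β.autCard =
      Nat.card (Gauge X.1.IsTop d) := by
  obtain ⟨E, rfl⟩ := exists_type_eq X β h
  have h1 : Nat.card (Gauge X.1.IsTop d) =
      Nat.card (Σ F : MarkedCover X.1.IsTop d, {γ : Gauge X.1.IsTop d // γ • E = F}) :=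
    Nat.card_congr (Equiv.sigmaFiberEquiv fun γ : Gauge X.1.IsTop d => γ • E).symm
  have := Fintype.ofFinite (MarkedCover X.1.IsTop d)
  rw [h1, Nat.card_sigma]
  have h2 : ∀ F : MarkedCover X.1.IsTop d, Nat.card {γ : Gauge X.1.IsTop d // γ • E = F} =
      if F.type X = E.type X then (E.type X).autCard else 0 := fun F => by
    rw [eq_comm (a := F.type X)]
    exact card_smul_eq (.refl _) E F
  simp_rw [h2]
  rw [← Finset.sum_filter, Finset.sum_const, smul_eq_mul, Nat.card_eq_fintype_card,
    Fintype.card_subtype]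

theorem autCard_pos (β : CoverType n S d) : 0 < β.autCard := by
  obtain ⟨X, hX⟩ := Quotient.exists_rep β.base
  have h := card_type_eq_mul X β hX.symm
  refine Nat.pos_of_ne_zero fun h0 => ?_
  rw [h0, mul_zero] at h
  exact Nat.card_pos.ne h

theorem finite_base (σ : ColoredClass n S) : Finite {β : CoverType n S d // β.base = σ} := by
  obtain ⟨X, rfl⟩ := Quotient.exists_rep σ
  refine Finite.of_surjective
    (fun E : MarkedCover X.1.IsTop d =>
      (⟨E.type X, rfl⟩ : {β : CoverType n S d // β.base = Quotient.mk _ X})) ?_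
  rintro ⟨β, hβ⟩
  obtain ⟨E, rfl⟩ := exists_type_eq X β hβ
  exact ⟨E, rfl⟩

end MarkedCover

/-! ### Gluing of sheets at the vertices -/

/-- The equivalence relations which contain a given relation `ρ`; if the proposition `u` holds,
only the finest one is admitted.  Over a vertex, they are the ways of gluing the sheets of a given
covering of the punctured star, and `u` restricts to the unglued ones. -/
def Merging (u : Prop) {α : Type} (ρ : α → α → Prop) : Type :=
  {r : Setoid α // (∀ a b, ρ a b → r.r a b) ∧ (u → ∀ a b, r.r a b → Relation.EqvGen ρ a b)}

namespace Merging

variable {u : Prop} {α β : Type} {ρ : α → α → Prop} {ρ' : β → β → Prop}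

instance [Finite α] : Finite (Merging u ρ) :=
  Finite.of_injective (fun r : Merging u ρ => r.1.r) fun _ _ h =>
    Subtype.ext (Setoid.ext fun a b => iff_of_eq (congrFun (congrFun h a) b))

instance : Nonempty (Merging u ρ) :=
  ⟨⟨Relation.EqvGen.setoid ρ, fun _ _ h => .rel _ _ h, fun _ _ _ h => h⟩⟩

theorem rel_of_eqvGen (r : Merging u ρ) {a b} (h : Relation.EqvGen ρ a b) : r.1.r a b := by
  induction h with
  | rel a b h => exact r.2.1 a b h
  | refl a => exact r.1.refl a
  | symm a b _ ih => exact r.1.symm ih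
  | trans a b c _ _ ih ih' => exact r.1.trans ih ih'

theorem card_of_true (hu : u) : Nat.card (Merging u ρ) = 1 := by
  rw [Nat.card_eq_one_iff_unique]
  refine ⟨⟨fun r r' => Subtype.ext (Setoid.ext fun a b => ?_)⟩, inferInstance⟩
  exact ⟨fun h => r'.rel_of_eqvGen (r.2.2 hu a b h), fun h => r.rel_of_eqvGen (r'.2.2 hu a b h)⟩

/-- The transport along a bijection. -/
def map (e : α ≃ β) (h : ∀ a b, ρ a b ↔ ρ' (e a) (e b)) (r : Merging u ρ) : Merging u ρ' := by
  refine ⟨r.1.comap e.symm, fun a b hab => r.2.1 _ _ ?_, fun hu a b hab => ?_⟩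
  · rw [h, e.apply_symm_apply, e.apply_symm_apply]
    exact hab
  · have key : ∀ a b, Relation.EqvGen ρ a b → Relation.EqvGen ρ' (e a) (e b) := by
      intro a b hab
      induction hab with
      | rel a b hab => exact .rel _ _ ((h _ _).mp hab)
      | refl a => exact .refl _
      | symm a b _ ih => exact .symm _ _ ih
      | trans a b c _ _ ih ih' => exact .trans _ _ _ ih ih'
    have := key _ _ (r.2.2 hu _ _ hab)
    rwa [e.apply_symm_apply, e.apply_symm_apply] at this

theorem card_congr (e : α ≃ β) (h : ∀ a b, ρ a b ↔ ρ' (e a) (e b)) :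
    Nat.card (Merging u ρ) = Nat.card (Merging u ρ') := by
  have h' : ∀ a b, ρ' a b ↔ ρ (e.symm a) (e.symm b) := fun a b => by
    rw [h, e.apply_symm_apply, e.apply_symm_apply]
  refine Nat.card_congr ⟨map e h, map e.symm h', fun r => ?_, fun r => ?_⟩
  · exact Subtype.ext (Setoid.ext fun a b => by
      change r.1.r (e.symm (e a)) (e.symm (e b)) ↔ _
      rw [e.symm_apply_apply, e.symm_apply_apply])
  · exact Subtype.ext (Setoid.ext fun a b => by
      change r.1.r (e (e.symm a)) (e (e.symm b)) ↔ _
      rw [e.apply_symm_apply, e.apply_symm_apply])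

end Merging

namespace Cover

variable {n d : ℕ} {X : SimpleComplex n}

/-- Two cells of maximal dimension of a covering space have a common face. -/
def Incident (f : Cover X d) (a b : {e : f.Cell // X.IsTop (f.map e)}) : Prop :=
  ∃ e, e ≤ a.1 ∧ e ≤ b.1

end Cover

namespace CoverType

variable {n d : ℕ} {S : Type*}

/-- The number of ways of gluing a vertex to a covering of its vertex complex (respectively `1`, if
`u` holds and only the unglued coverings are admitted). -/
noncomputable def weight (u : Prop) : CoverType n S d → ℕ :=
  Quotient.lift (fun f => Nat.card (Merging u f.cover.Incident)) fun f g ⟨φ⟩ => by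
    refine Merging.card_congr (φ.totalIso.toEquiv.subtypeEquiv fun e => ?_) fun a b => ?_
    · change f.base.1.dim _ = n ↔ g.base.1.dim (g.cover.map (φ.totalIso e)) = n
      rw [φ.comm, φ.baseIso.dim_eq]
    · constructor
      · rintro ⟨e, h, h'⟩
        exact ⟨φ.totalIso e, φ.totalIso.monotone h, φ.totalIso.monotone h'⟩
      · rintro ⟨e, h, h'⟩
        exact ⟨φ.totalIso.symm e, φ.totalIso.symm_apply_le.mpr h, φ.totalIso.symm_apply_le.mpr h'⟩

theorem weight_star (u : Prop) (β : CoverType n S d) : β.star.weight u = β.weight u := by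
  induction β using Quotient.inductionOn
  rfl

theorem weight_pos (u : Prop) (β : CoverType n S d) : 0 < β.weight u := by
  induction β using Quotient.inductionOn with
  | _ f => exact Nat.card_pos (α := Merging u f.cover.Incident)

theorem weight_of_true {u : Prop} (hu : u) (β : CoverType n S d) : β.weight u = 1 := by
  induction β using Quotient.inductionOn
  exact Merging.card_of_true hu

end CoverType

namespace MarkedCover

/-- Two sheets have a common face. -/
def Incident {P : Type} [PartialOrder P] {t : P → Prop} {d : ℕ} (E : MarkedCover t d)
    (a b : Sheet t d) : Prop := ∃ x, E.rel x a b

variable {n d : ℕ} {S : Type*}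

theorem weight_type (u : Prop) (X : ConnColored n S) (E : MarkedCover X.1.IsTop d) :
    (E.type X).weight u = Nat.card (Merging u E.Incident) := by
  refine (Merging.card_congr (Equiv.ofBijective
    (fun a => (⟨E.sheetCell a, a.1.2⟩ : {e : E.toCover.Cell // X.1.IsTop (E.proj e)})) ⟨?_, ?_⟩)
    fun a b => ?_).symm
  · intro a b h
    exact E.sheetCell_injective (congrArg Subtype.val h)
  · rintro ⟨e, he⟩
    obtain ⟨a, rfl⟩ := E.exists_sheetCell he
    exact ⟨a, rfl⟩
  · conv_lhs => rw [← E.toMarkedCover_marking]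
    constructor
    · rintro ⟨x, e, rfl, h, h'⟩
      exact ⟨e, h, h'⟩
    · rintro ⟨e, h, h'⟩
      exact ⟨_, e, rfl, h, h'⟩

/-- If the sheets of a covering of a connected complex are glued along an equivalence relation, then
the classes of the relation contain the same number of sheets over all maximal cells. -/
theorem card_merging {X : SimpleComplex n} (hX : CellsConnected X.Cell) (E : MarkedCover X.IsTop d)
    (r : Setoid (Sheet X.IsTop d)) (hr : ∀ a b, E.Incident a b → r.r a b) (a : Sheet X.IsTop d)
    (z z' : {z // X.IsTop z}) :
    Nat.card {i // r.r a (z, i)} = Nat.card {i // r.r a (z', i)} := by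
  classical
  -- Over the maximal cells around `x`, each class is a union of classes of `E.rel x`, so that
  -- every sheet can be weighted by the inverse of the size of the latter.
  have step : ∀ x (z z' : {z // X.IsTop z}), x ≤ z.1 → x ≤ z'.1 →
      Nat.card {i // r.r a (z, i)} = Nat.card {i // r.r a (z', i)} := by
    intro x z z' hz hz'
    have hcard : ∀ b : Sheet X.IsTop d, x ≤ b.1.1 → ∀ w : {z // X.IsTop z}, x ≤ w.1 →
        ((Finset.univ.filter fun j => r.r a (w, j) ∧ E.rel x b (w, j)).card : ℚ) =
          if r.r a b then (Nat.card {i // E.rel x b (b.1, i)} : ℚ) else 0 := by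
      intro b hb w hw
      split_ifs with hab
      · rw [E.card b.1 w hb hb hw, Nat.card_eq_fintype_card, Fintype.card_subtype]
        congr 2
        ext j
        simp only [Finset.mem_filter, Finset.mem_univ, true_and, and_iff_right_iff_imp]
        exact fun h => r.trans hab (hr _ _ ⟨x, h⟩)
      · rw [Nat.cast_eq_zero, Finset.card_eq_zero, Finset.filter_eq_empty_iff]
        rintro j - ⟨h1, h2⟩
        exact hab (r.trans h1 (r.symm (hr _ _ ⟨x, h2⟩)))
    have hpos : ∀ b : Sheet X.IsTop d, x ≤ b.1.1 →
        (Nat.card {i // E.rel x b (b.1, i)} : ℚ) ≠ 0 := fun b hb =>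
      Nat.cast_ne_zero.mpr (Nat.card_pos_iff.mpr ⟨⟨⟨b.2, E.refl hb⟩⟩, inferInstance⟩).ne'
    let m : Sheet X.IsTop d → ℚ := fun b => Nat.card {i // E.rel x b (b.1, i)}
    have hm : ∀ b c, E.rel x b c → m b = m c := fun b c h => by
      have h1 := E.card b.1 c.1 (E.le_of_rel h) (E.le_of_rel h) (E.le_of_rel' h)
      simp only [m]
      rw [h1]
      refine congrArg Nat.cast (Nat.card_congr (Equiv.subtypeEquivRight fun i => ?_))
      exact ⟨fun h' => E.trans (E.symm h) h', fun h' => E.trans h h'⟩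
    have expand : ∀ w w' : {z // X.IsTop z}, x ≤ w.1 → x ≤ w'.1 →
        (Nat.card {i // r.r a (w, i)} : ℚ) = ∑ i : Fin d, ∑ j : Fin d,
          if r.r a (w', j) ∧ E.rel x (w, i) (w', j) then (m (w, i))⁻¹ else 0 := by
      intro w w' hw hw'
      rw [Nat.card_eq_fintype_card, Fintype.card_subtype, Finset.card_filter, Nat.cast_sum]
      refine Finset.sum_congr rfl fun i _ => ?_
      rw [← Finset.sum_filter, Finset.sum_const, nsmul_eq_mul, hcard (w, i) hw w' hw']
      split_ifs
      · rw [Nat.cast_one]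
        exact (mul_inv_cancel₀ (hpos (w, i) hw)).symm
      · simp
    have h1 := expand z z' hz hz'
    have h2 := expand z' z hz' hz
    rw [Finset.sum_comm] at h2
    rw [← Nat.cast_inj (R := ℚ), h1, h2]
    refine Finset.sum_congr rfl fun i _ => Finset.sum_congr rfl fun j _ => ?_
    by_cases h : E.rel x (z, i) (z', j)
    · have h3 : r.r a (z', j) ↔ r.r a (z, i) :=
        ⟨fun h' => r.trans h' (r.symm (hr _ _ ⟨x, h⟩)), fun h' => r.trans h' (hr _ _ ⟨x, h⟩)⟩
      have h4 : E.rel x (z', j) (z, i) := E.symm h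
      simp only [h, h4, h3, and_true, hm _ _ h]
    · have h4 : ¬ E.rel x (z', j) (z, i) := fun h' => h (E.symm h')
      rw [if_neg fun h' => h h'.2, if_neg fun h' => h4 h'.2]
  have key : ∀ x y : X.Cell, Relation.EqvGen (· ≤ ·) x y → ∀ z z' : {z // X.IsTop z}, x ≤ z.1 →
      y ≤ z'.1 → Nat.card {i // r.r a (z, i)} = Nat.card {i // r.r a (z', i)} := by
    intro x y h
    induction h with
    | rel x y h => exact fun z z' hz hz' => step x z z' hz (le_trans h hz')
    | refl x => exact step x
    | symm x y _ ih => exact fun z z' hz hz' => (ih z' z hz' hz).symm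
    | trans x y w _ _ ih ih' =>
      intro z z' hz hz'
      obtain ⟨y', hy, hd⟩ := X.pure y
      exact (ih z ⟨y', hd⟩ hz hy).trans (ih' ⟨y', hd⟩ z' hy hz')
  exact key z.1 z'.1 (hX.2 _ _) z z' le_rfl le_rfl

end MarkedCover

/-! ### Marked coverings of brane complexes -/

namespace BraneComplex

variable {D : ℕ} {S : Type*} (Ω : BraneComplex D S) {d : ℕ}

/-- The cells of positive dimension. -/
abbrev PosCell : Type := {x : Ω.Cell // 0 < Ω.dim x}

/-- The cells of maximal dimension, among the cells of positive dimension. -/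
def PosTop (x : Ω.PosCell) : Prop := Ω.IsTop x.1

/-- The inclusion of the cells of positive dimension. -/
def posMap : UpperMap Ω.PosTop Ω.IsTop where
  toOrderEmbedding := OrderEmbedding.subtype _
  upper {p q} h := ⟨⟨q, p.2.trans_le (Ω.dim_mono h)⟩, rfl⟩
  top_iff _ := Iff.rfl

theorem posMap_sheet_surjective : Function.Surjective (Ω.posMap.sheet (d := d)) := by
  rintro ⟨⟨z, hz⟩, i⟩
  have h : Ω.dim z = D + 1 := hz
  exact ⟨(⟨⟨z, by omega⟩, hz⟩, i), rfl⟩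

/-- The cells around a vertex. -/
def starMap (q : Ω.Vertex) : UpperMap (Ω.vertexComplex q).IsTop Ω.PosTop where
  toOrderEmbedding := OrderEmbedding.ofMapLEIff
    (fun x => ⟨x.1, (Nat.zero_le _).trans_lt (Ω.dim_lt x.2)⟩) fun _ _ => Iff.rfl
  upper {p q'} h := ⟨⟨q'.1, p.2.trans_le h⟩, rfl⟩
  top_iff p := by
    have h1 := Ω.dim_lt p.2
    change Ω.dim p.1 = D + 1 ↔ Ω.dim p.1 - 1 = D
    omega

/-- The cells around a vertex, as cells of the whole complex. -/
def linkMap (q : Ω.Vertex) : UpperMap (Ω.vertexComplex q).IsTop Ω.IsTop :=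
  Ω.posMap.comp (Ω.starMap q)

theorem exists_linkMap_sheet {q : Ω.Vertex} {a : Sheet Ω.IsTop d} (h : q.1 ≤ a.1.1) :
    ∃ b, (Ω.linkMap q).sheet b = a := by
  obtain ⟨⟨z, hz⟩, i⟩ := a
  have hlt : q.1 < z := lt_of_le_of_ne h fun h => by
    have h1 : Ω.dim z = D + 1 := hz
    have h2 := q.2
    rw [h] at h2
    omega
  exact (Ω.linkMap q).exists_sheet (x := ⟨z, hlt⟩) le_rfl

theorem lt_linkMap_sheet (q : Ω.Vertex) (a : Sheet (Ω.vertexComplex q).IsTop d) :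
    q.1 < ((Ω.linkMap q).sheet a).1.1 := a.1.1.2

theorem lt_linkMap (q : Ω.Vertex) (x : (Ω.vertexComplex q).Cell) : q.1 < Ω.linkMap q x := x.2

/-- The vertex complex, as a connected coloured complex. -/
abbrev link (q : Ω.Vertex) : ConnColored D S := ⟨Ω.vertexComplex q, Ω.vertexComplex_connected q⟩

/-- The class of the covering around a vertex. -/
def markedInvariant (E : MarkedCover Ω.PosTop d) (q : Ω.Vertex) : CoverType D S d :=
  ((Ω.starMap q).pullback E).type (Ω.link q)

/-- The marking of the induced covering of a vertex complex. -/
def restrictMarking {f : Ω.Covering d} (M : f.Marking) (q : Ω.Vertex) :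
    (Ω.restrict f q).Marking where
  sheet a := ⟨M.sheet ((Ω.linkMap q).sheet a), by
    rw [M.map_sheet]
    exact Ω.lt_linkMap_sheet q a⟩
  map_sheet a := Subtype.ext (M.map_sheet _)
  injective a b h := (Ω.linkMap q).sheet_injective (M.injective (congrArg Subtype.val h))
  surjective e he := by
    have h : Ω.IsTop (f.map e.1) := ((Ω.linkMap q).top_iff ⟨f.map e.1, e.2⟩).mpr he
    obtain ⟨a, ha⟩ := M.surjective e.1 h
    obtain ⟨b, rfl⟩ := Ω.exists_linkMap_sheet (q := q) (a := a) (by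
      rw [← M.map_sheet, ha]
      exact e.2.le)
    exact ⟨b, Subtype.ext ha⟩

theorem toMarkedCover_restrictMarking {f : Ω.Covering d} (M : f.Marking) (q : Ω.Vertex) :
    (Ω.restrictMarking M q).toMarkedCover = (Ω.linkMap q).pullback M.toMarkedCover := by
  ext x a b
  constructor
  · rintro ⟨e, rfl, h1, h2⟩
    exact ⟨e.1, rfl, h1, h2⟩
  · rintro ⟨e, h, h1, h2⟩
    exact ⟨⟨e, by rw [h]; exact Ω.lt_linkMap q x⟩, Subtype.ext h, h1, h2⟩

theorem localInvariant_toCover (E : MarkedCover Ω.IsTop d) (q : Ω.Vertex) :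
    Ω.localInvariant E.toCover q = Ω.markedInvariant (Ω.posMap.pullback E) q := by
  obtain ⟨φ, -⟩ := (Ω.restrictMarking E.marking q).exists_iso
    (E := (Ω.starMap q).pullback (Ω.posMap.pullback E))
    ((Ω.toMarkedCover_restrictMarking _ q).trans
      (congrArg (Ω.linkMap q).pullback E.toMarkedCover_marking))
  exact Quotient.sound ⟨⟨.refl _, φ.1, φ.2⟩⟩

/-- A covering is unglued if and only if sheets with the same vertex over `q` are connected in the
covering of the vertex complex of `q`. -/
theorem unglued_toCover_iff (E : MarkedCover Ω.IsTop d) :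
    E.toCover.Unglued ↔ ∀ (q : Ω.Vertex) (a b : Sheet (Ω.vertexComplex q).IsTop d),
      E.rel q.1 ((Ω.linkMap q).sheet a) ((Ω.linkMap q).sheet b) →
        Relation.EqvGen ((Ω.linkMap q).pullback E).Incident a b := by
  have hE := E.toMarkedCover_marking
  let M := E.marking
  let f := E.toCover
  have lift : ∀ (q : Ω.Vertex) (e : f.Cell), q.1 ≤ f.map e →
      ∃ a : Sheet (Ω.vertexComplex q).IsTop d, e ≤ M.sheet ((Ω.linkMap q).sheet a) := by
    intro q e he
    obtain ⟨a, ha⟩ := M.exists_sheet_ge e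
    obtain ⟨b, rfl⟩ := Ω.exists_linkMap_sheet (q := q)
      (he.trans ((f.mono ha).trans (M.map_sheet a).le))
    exact ⟨b, ha⟩
  have inc : ∀ (q : Ω.Vertex) (e : f.Cell) (a b : Sheet (Ω.vertexComplex q).IsTop d),
      q.1 < f.map e → e ≤ M.sheet ((Ω.linkMap q).sheet a) → e ≤ M.sheet ((Ω.linkMap q).sheet b) →
        ((Ω.linkMap q).pullback E).Incident a b := by
    intro q e a b he ha hb
    refine ⟨⟨f.map e, he⟩, ?_⟩
    rw [← hE]
    exact ⟨e, rfl, ha, hb⟩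
  constructor
  · intro h q a b hab
    rw [← hE] at hab
    obtain ⟨e, heq, h1, h2⟩ := hab
    have hlt : ∀ a : Sheet (Ω.vertexComplex q).IsTop d, e ≤ M.sheet ((Ω.linkMap q).sheet a) →
        e < M.sheet ((Ω.linkMap q).sheet a) := fun a ha => lt_of_le_of_ne ha fun h => by
      have h3 := Ω.lt_linkMap_sheet q a
      rw [← M.map_sheet, ← h] at h3
      exact h3.ne heq.symm
    have key : ∀ e₁ e₂ : {e' : f.Cell // e < e'}, Relation.EqvGen (· ≤ ·) e₁ e₂ → ∀ a b,
        e₁.1 ≤ M.sheet ((Ω.linkMap q).sheet a) → e₂.1 ≤ M.sheet ((Ω.linkMap q).sheet b) →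
          Relation.EqvGen ((Ω.linkMap q).pullback E).Incident a b := by
      intro e₁ e₂ h
      have hq : ∀ e' : {e' : f.Cell // e < e'}, q.1 < f.map e'.1 := fun e' =>
        heq.symm.trans_lt (f.map_lt e'.2)
      induction h with
      | rel e₁ e₂ h => exact fun a b ha hb => .rel _ _ (inc q e₁.1 a b (hq _) ha (le_trans h hb))
      | refl e₁ => exact fun a b ha hb => .rel _ _ (inc q e₁.1 a b (hq _) ha hb)
      | symm e₁ e₂ _ ih => exact fun a b ha hb => .symm _ _ (ih b a hb ha)
      | trans e₁ e₂ e₃ _ _ ih ih' =>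
        intro a b ha hb
        obtain ⟨c, hc⟩ := lift q e₂.1 (hq e₂).le
        exact .trans _ _ _ (ih a c ha hc) (ih' c b hc hb)
    have hd : Ω.dim (f.map e) = 0 := (congrArg Ω.dim heq).trans q.2
    exact key ⟨_, hlt a h1⟩ ⟨_, hlt b h2⟩ ((h e hd).2 _ _) a b le_rfl le_rfl
  · intro h e hd
    let q : Ω.Vertex := ⟨f.map e, hd⟩
    have hlt : ∀ {e' : f.Cell} {a : Sheet (Ω.vertexComplex q).IsTop d}, e ≤ e' →
        e' = M.sheet ((Ω.linkMap q).sheet a) → e < e' := fun {e' a} he h =>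
      lt_of_le_of_ne he fun h' => by
        have h3 := Ω.lt_linkMap_sheet q a
        rw [← M.map_sheet, ← h, ← h'] at h3
        exact h3.ne rfl
    constructor
    · obtain ⟨a, ha⟩ := lift q e le_rfl
      exact ⟨⟨_, hlt ha rfl⟩⟩
    · intro e₁ e₂
      obtain ⟨a, ha⟩ := lift q e₁.1 (f.map_lt e₁.2).le
      obtain ⟨b, hb⟩ := lift q e₂.1 (f.map_lt e₂.2).le
      have hab : E.rel q.1 ((Ω.linkMap q).sheet a) ((Ω.linkMap q).sheet b) := by
        rw [← hE]
        exact ⟨e, rfl, e₁.2.le.trans ha, e₂.2.le.trans hb⟩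
      have key : ∀ a b, Relation.EqvGen ((Ω.linkMap q).pullback E).Incident a b →
          (e < M.sheet ((Ω.linkMap q).sheet a) ↔ e < M.sheet ((Ω.linkMap q).sheet b)) ∧
          ∀ ha hb, Relation.EqvGen (· ≤ ·)
            (⟨M.sheet ((Ω.linkMap q).sheet a), ha⟩ : {e' : f.Cell // e < e'})
            ⟨M.sheet ((Ω.linkMap q).sheet b), hb⟩ := by
        intro a b hab
        induction hab with
        | rel a b hab =>
          obtain ⟨x, hx⟩ := hab
          rw [← hE] at hx
          obtain ⟨c, hcx, hca, hcb⟩ := hx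
          have hqc : f.map e < f.map c := (Ω.lt_linkMap q x).trans_eq hcx.symm
          have hec : ∀ {a}, e < a → c ≤ a → e < c := fun {a} h1 h2 =>
            lt_of_le_of_ne (f.le_of_map_le h1.le h2 hqc.le) fun h => hqc.ne (congrArg f.map h)
          refine ⟨⟨fun h => (hec h hca).trans_le hcb, fun h => (hec h hcb).trans_le hca⟩,
            fun ha hb => ?_⟩
          exact .trans _ ⟨c, hec ha hca⟩ _ (.symm _ _ (.rel _ _ hca)) (.rel _ _ hcb)
        | refl a => exact ⟨Iff.rfl, fun _ _ => .refl _⟩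
        | symm a b _ ih => exact ⟨ih.1.symm, fun ha hb => .symm _ _ (ih.2 hb ha)⟩
        | trans a b c _ _ ih ih' =>
          exact ⟨ih.1.trans ih'.1, fun ha hb =>
            .trans _ _ _ (ih.2 ha (ih.1.mp ha)) (ih'.2 (ih.1.mp ha) hb)⟩
      exact .trans _ _ _ (.rel _ _ ha) (.trans _ _ _ ((key a b (h q a b hab)).2
        (e₁.2.trans_le ha) (e₂.2.trans_le hb)) (.symm _ _ (.rel _ _ hb)))

theorem pos_or_vertex (x : Ω.Cell) : (∃ p, Ω.posMap p = x) ∨ ∃ q : Ω.Vertex, q.1 = x := by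
  rcases Nat.eq_zero_or_pos (Ω.dim x) with h | h
  · exact Or.inr ⟨⟨x, h⟩, rfl⟩
  · exact Or.inl ⟨⟨x, h⟩, rfl⟩

/-- The relation between the sheets around a vertex. -/
def vertexSetoid (E : MarkedCover Ω.IsTop d) (q : Ω.Vertex) :
    Setoid (Sheet (Ω.vertexComplex q).IsTop d) where
  r a b := E.rel q.1 ((Ω.linkMap q).sheet a) ((Ω.linkMap q).sheet b)
  iseqv := ⟨fun a => E.refl (Ω.lt_linkMap_sheet q a).le, fun h => E.symm h,
    fun h h' => E.trans h h'⟩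

/-- A marked covering of the cells of positive dimension extends to the vertices by any choice of
equivalence relations that contain the relations around the vertices. -/
theorem exists_extension (E : MarkedCover Ω.PosTop d)
    (r : ∀ q : Ω.Vertex, Setoid (Sheet (Ω.vertexComplex q).IsTop d))
    (hr : ∀ q a b, ((Ω.starMap q).pullback E).Incident a b → (r q).r a b) :
    ∃ F : MarkedCover Ω.IsTop d, Ω.posMap.pullback F = E ∧ ∀ q, Ω.vertexSetoid F q = r q := by
  let rel : Ω.Cell → Sheet Ω.IsTop d → Sheet Ω.IsTop d → Prop := fun x a b =>
    (∃ p a' b', Ω.posMap p = x ∧ Ω.posMap.sheet a' = a ∧ Ω.posMap.sheet b' = b ∧ E.rel p a' b') ∨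
    ∃ q : Ω.Vertex, q.1 = x ∧ ∃ a' b', (Ω.linkMap q).sheet a' = a ∧ (Ω.linkMap q).sheet b' = b ∧
      (r q).r a' b'
  have hpq : ∀ (p : Ω.PosCell) (q : Ω.Vertex), q.1 ≠ Ω.posMap p := fun p q h => by
    have h1 := p.2
    have h2 := q.2
    have h3 : q.1 = p.1 := h
    rw [h3] at h2
    omega
  have hpos : ∀ p a b, rel (Ω.posMap p) (Ω.posMap.sheet a) (Ω.posMap.sheet b) ↔ E.rel p a b := by
    intro p a b
    constructor
    · rintro (⟨p', a', b', h1, h2, h3, h4⟩ | ⟨q, h, -⟩)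
      · rwa [Ω.posMap.injective h1, Ω.posMap.sheet_injective h2, Ω.posMap.sheet_injective h3] at h4
      · exact absurd h (hpq p q)
    · exact fun h => Or.inl ⟨p, a, b, rfl, rfl, rfl, h⟩
  have hvert : ∀ (q : Ω.Vertex) a b,
      rel q.1 ((Ω.linkMap q).sheet a) ((Ω.linkMap q).sheet b) ↔ (r q).r a b := by
    intro q a b
    constructor
    · rintro (⟨p, a', b', h1, -⟩ | ⟨q', h, a', b', h2, h3, h4⟩)
      · exact absurd h1.symm (hpq p q)
      · obtain rfl : q' = q := Subtype.ext h
        rwa [(Ω.linkMap q').sheet_injective h2, (Ω.linkMap q').sheet_injective h3] at h4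
    · exact fun h => Or.inr ⟨q, rfl, a, b, rfl, rfl, h⟩
  have le_of_rel : ∀ {x a b}, rel x a b → x ≤ a.1.1 ∧ x ≤ b.1.1 := by
    rintro x a b (⟨p, a, b, rfl, rfl, rfl, h⟩ | ⟨q, rfl, a, b, rfl, rfl, h⟩)
    · exact ⟨Ω.posMap.le_iff.mpr (E.le_of_rel h), Ω.posMap.le_iff.mpr (E.le_of_rel' h)⟩
    · exact ⟨(Ω.lt_linkMap_sheet q a).le, (Ω.lt_linkMap_sheet q b).le⟩
  have hsurj := Ω.posMap_sheet_surjective (d := d)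
  refine ⟨⟨rel, fun h => (le_of_rel h).1, ?_, ?_, ?_, ?_, ?_, ?_⟩, ?_, ?_⟩
  · intro x a h
    rcases Ω.pos_or_vertex x with ⟨p, rfl⟩ | ⟨q, rfl⟩
    · obtain ⟨a, rfl⟩ := hsurj a
      exact (hpos _ _ _).mpr (E.refl (Ω.posMap.le_iff.mp h))
    · obtain ⟨a, rfl⟩ := Ω.exists_linkMap_sheet h
      exact (hvert _ _ _).mpr ((r q).refl a)
  · rintro x a b (⟨p, a, b, rfl, rfl, rfl, h⟩ | ⟨q, rfl, a, b, rfl, rfl, h⟩)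
    · exact (hpos _ _ _).mpr (E.symm h)
    · exact (hvert _ _ _).mpr ((r q).symm h)
  · rintro x a b c (⟨p, a, b, rfl, rfl, rfl, h⟩ | ⟨q, rfl, a, b, rfl, rfl, h⟩) h'
    · obtain ⟨c, rfl⟩ := hsurj c
      exact (hpos _ _ _).mpr (E.trans h ((hpos _ _ _).mp h'))
    · obtain ⟨c, rfl⟩ := Ω.exists_linkMap_sheet (le_of_rel h').2
      exact (hvert _ _ _).mpr ((r q).trans h ((hvert _ _ _).mp h'))
  · rintro x y a b hxy (⟨p, a, b, rfl, rfl, rfl, h⟩ | ⟨q, rfl, a, b, rfl, rfl, h⟩)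
    · rcases Ω.pos_or_vertex x with ⟨p', rfl⟩ | ⟨q, rfl⟩
      · exact (hpos _ _ _).mpr (E.mono (Ω.posMap.le_iff.mp hxy) h)
      · have hlt : q.1 < p.1 := lt_of_le_of_ne hxy (hpq p q)
        obtain ⟨a, rfl⟩ := (Ω.starMap q).exists_sheet (x := ⟨p.1, hlt⟩) (E.le_of_rel h)
        obtain ⟨b, rfl⟩ := (Ω.starMap q).exists_sheet (x := ⟨p.1, hlt⟩) (E.le_of_rel' h)
        exact (hvert q a b).mpr (hr q a b ⟨⟨p.1, hlt⟩, h⟩)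
    · obtain rfl : x = q.1 := by
        by_contra hne
        have h1 := Ω.dim_lt (lt_of_le_of_ne hxy hne)
        have h2 := q.2
        omega
      exact (hvert _ _ _).mpr h
  · rintro a b (⟨p, a, b, h1, rfl, rfl, h⟩ | ⟨q, h1, a, b, rfl, rfl, h⟩)
    · obtain rfl := Ω.posMap.injective h1
      exact congrArg Ω.posMap.sheet (E.eq_of_top h)
    · exact absurd h1 (Ω.lt_linkMap_sheet q a).ne
  · intro x a z z' h hz hz'
    rcases Ω.pos_or_vertex x with ⟨p, rfl⟩ | ⟨q, rfl⟩
    · obtain ⟨a, rfl⟩ := hsurj a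
      obtain ⟨z, hzt⟩ := z
      obtain ⟨z', hzt'⟩ := z'
      obtain ⟨z, rfl⟩ := Ω.posMap.upper hz
      obtain ⟨z', rfl⟩ := Ω.posMap.upper hz'
      have key : ∀ (z : {z // Ω.PosTop z}),
          Nat.card {i // rel (Ω.posMap p) (Ω.posMap.sheet a) (Ω.posMap.sheet (z, i))} =
          Nat.card {i // E.rel p a (z, i)} := fun z =>
        Nat.card_congr (Equiv.subtypeEquivRight fun i => hpos _ _ _)
      exact (key ⟨z, hzt⟩).trans ((E.card _ _ (Ω.posMap.le_iff.mp h) (Ω.posMap.le_iff.mp hz)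
        (Ω.posMap.le_iff.mp hz')).trans (key ⟨z', hzt'⟩).symm)
    · obtain ⟨a, rfl⟩ := Ω.exists_linkMap_sheet h
      have key : ∀ z : {z // Ω.IsTop z}, q.1 ≤ z.1 → ∃ z' : {z // (Ω.vertexComplex q).IsTop z},
          Nat.card {i // rel q.1 ((Ω.linkMap q).sheet a) (z, i)} =
            Nat.card {i // (r q).r a (z', i)} := fun z hz => by
        obtain ⟨z, hzt⟩ := z
        have hlt : q.1 < z := lt_of_le_of_ne hz fun h => by
          have h1 : Ω.dim z = D + 1 := hzt
          have h2 := q.2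
          rw [h] at h2
          omega
        exact ⟨⟨⟨z, hlt⟩, ((Ω.linkMap q).top_iff ⟨z, hlt⟩).mp hzt⟩,
          Nat.card_congr (Equiv.subtypeEquivRight fun i =>
            hvert q a (⟨⟨z, hlt⟩, ((Ω.linkMap q).top_iff ⟨z, hlt⟩).mp hzt⟩, i))⟩
      obtain ⟨w, hw⟩ := key z hz
      obtain ⟨w', hw'⟩ := key z' hz'
      rw [hw, hw']
      exact MarkedCover.card_merging (Ω.vertexComplex_connected q) _ (r q) (hr q) a w w'
  · ext x a b
    exact hpos x a b
  · intro q
    ext a b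
    exact hvert q a b

/-- The marked coverings with a given restriction to the cells of positive dimension correspond to
the ways of gluing the sheets at the vertices. -/
theorem card_extensions (u : Prop) (E : MarkedCover Ω.PosTop d) :
    Nat.card {F : MarkedCover Ω.IsTop d //
        Ω.posMap.pullback F = E ∧ (u → F.toCover.Unglued)} =
      ∏ᶠ q, (Ω.markedInvariant E q).weight u := by
  have := Fintype.ofFinite Ω.Vertex
  rw [finprod_eq_prod_of_fintype]
  simp_rw [markedInvariant, MarkedCover.weight_type]
  rw [← Nat.card_pi]
  refine Nat.card_congr (Equiv.ofBijective (fun F q => ⟨Ω.vertexSetoid F.1 q, ?_, ?_⟩) ⟨?_, ?_⟩)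
  · rintro a b ⟨x, h⟩
    rw [← F.2.1] at h
    exact F.1.mono x.2.le h
  · intro hu a b hab
    have h := (Ω.unglued_toCover_iff F.1).mp (F.2.2 hu) q a b hab
    rwa [linkMap, UpperMap.pullback_comp, F.2.1] at h
  · rintro ⟨F, hF, _⟩ ⟨F', hF', _⟩ h
    refine Subtype.ext (MarkedCover.ext (funext fun x => funext fun a => funext fun b => ?_))
    change F.rel x a b = F'.rel x a b
    rcases Ω.pos_or_vertex x with ⟨p, rfl⟩ | ⟨q, rfl⟩
    · obtain ⟨a, rfl⟩ := Ω.posMap_sheet_surjective a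
      obtain ⟨b, rfl⟩ := Ω.posMap_sheet_surjective b
      exact congrFun (congrFun (congrFun (congrArg MarkedCover.rel (hF.trans hF'.symm)) p) a) b
    · by_cases hab : q.1 ≤ a.1.1 ∧ q.1 ≤ b.1.1
      · obtain ⟨a, rfl⟩ := Ω.exists_linkMap_sheet hab.1
        obtain ⟨b, rfl⟩ := Ω.exists_linkMap_sheet hab.2
        have h' : Ω.vertexSetoid F q = Ω.vertexSetoid F' q := congrArg Subtype.val (congrFun h q)
        exact congrArg (fun s : Setoid _ => s.r a b) h'
      · exact propext ⟨fun h => absurd ⟨F.le_of_rel h, F.le_of_rel' h⟩ hab,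
          fun h => absurd ⟨F'.le_of_rel h, F'.le_of_rel' h⟩ hab⟩
  · intro r
    obtain ⟨F, hF, hr⟩ := Ω.exists_extension E (fun q => (r q).1) fun q => (r q).2.1
    refine ⟨⟨F, hF, fun hu => (Ω.unglued_toCover_iff F).mpr fun q a b hab => ?_⟩,
      funext fun q => Subtype.ext (hr q)⟩
    rw [linkMap, UpperMap.pullback_comp, hF]
    refine (r q).2.2 hu a b ?_
    rw [← hr q]
    exact hab

theorem _root_.Cover.Unglued.of_iso {n : ℕ} {X : SimpleComplex n} {f g : Cover X d} (φ : f.Iso g)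
    (h : g.Unglued) : f.Unglued := by
  intro e he
  obtain ⟨⟨e₀⟩, hc⟩ := h (φ.1 e) (by rw [φ.2]; exact he)
  let ψ : {e' : f.Cell // e < e'} ≃o {e' : g.Cell // φ.1 e < e'} :=
    { toFun := fun x => ⟨φ.1 x.1, φ.1.lt_iff_lt.mpr x.2⟩
      invFun := fun x => ⟨φ.1.symm x.1, φ.1.lt_symm_apply.mpr x.2⟩
      left_inv := fun x => Subtype.ext (φ.1.symm_apply_apply _)
      right_inv := fun x => Subtype.ext (φ.1.apply_symm_apply _)
      map_rel_iff' := φ.1.le_iff_le }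
  refine ⟨⟨ψ.symm e₀⟩, fun a b => ?_⟩
  have key : ∀ a b, Relation.EqvGen (· ≤ ·) a b →
      Relation.EqvGen (· ≤ ·) (ψ.symm a) (ψ.symm b) := by
    intro a b hab
    induction hab with
    | rel a b hab => exact .rel _ _ (ψ.symm.monotone hab)
    | refl a => exact .refl _
    | symm a b _ ih => exact .symm _ _ ih
    | trans a b c _ _ ih ih' => exact .trans _ _ _ ih ih'
  have h1 := key _ _ (hc (ψ a) (ψ b))
  rwa [ψ.symm_apply_apply, ψ.symm_apply_apply] at h1

instance _root_.CoverClass.finite {n : ℕ} (X : SimpleComplex n) : Finite (CoverClass X d) := by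
  refine Finite.of_surjective
    (fun E : MarkedCover X.IsTop d => (Quotient.mk _ E.toCover : CoverClass X d)) fun f => ?_
  induction f using Quotient.inductionOn with
  | _ f =>
    obtain ⟨E, ⟨φ⟩⟩ := f.exists_toCover_iso
    exact ⟨E, Quotient.sound ⟨φ.symm⟩⟩

theorem card_class_mul (f : CoverClass Ω.toSimpleComplex d) :
    Nat.card {E : MarkedCover Ω.IsTop d // (Quotient.mk _ E.toCover : CoverClass _ d) = f} *
      Ω.classAutCard f = Nat.card (Gauge Ω.IsTop d) := by
  induction f using Quotient.inductionOn with
  | _ f =>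
    obtain ⟨E, ⟨φ⟩⟩ := f.exists_toCover_iso
    have hf : (Quotient.mk _ f : CoverClass _ d) = Quotient.mk _ E.toCover := Quotient.sound ⟨φ⟩
    rw [hf, ← Nat.card_congr (MulAction.orbitProdStabilizerEquivGroup (Gauge Ω.IsTop d) E),
      Nat.card_prod]
    congr 1
    · refine Nat.card_congr (Equiv.subtypeEquivRight fun F => ?_)
      rw [Quotient.eq, MulAction.mem_orbit_iff, ← MarkedCover.nonempty_iso_iff]
      exact ⟨fun ⟨ψ⟩ => ⟨ψ.symm⟩, fun ⟨ψ⟩ => ⟨ψ.symm⟩⟩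
    · exact MarkedCover.card_iso E E

/-- The sum of `1 / |Aut f|` over some classes of coverings is the number of marked coverings in
these classes, divided by the number of markings. -/
theorem finsum_class (K : Type*) [Field K] [CharZero K]
    (p : CoverClass Ω.toSimpleComplex d → Prop) :
    ∑ᶠ f : {f // p f}, 1 / (Ω.classAutCard f.1 : K) =
      (Nat.card {E : MarkedCover Ω.IsTop d // p (Quotient.mk _ E.toCover)} : K) /
        Nat.card (Gauge Ω.IsTop d) := by
  classical
  have := Fintype.ofFinite {f // p f}
  rw [finsum_eq_sum_of_fintype]
  have h1 : Nat.card {E : MarkedCover Ω.IsTop d // p (Quotient.mk _ E.toCover)} =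
      ∑ f : {f // p f}, Nat.card {E : MarkedCover Ω.IsTop d // Quotient.mk _ E.toCover = f.1} := by
    rw [← Nat.card_sigma]
    exact Nat.card_congr
      { toFun := fun E => ⟨⟨_, E.2⟩, E.1, rfl⟩
        invFun := fun E => ⟨E.2.1, E.2.2.symm ▸ E.1.2⟩
        left_inv := fun _ => rfl
        right_inv := by
          rintro ⟨⟨f, hf⟩, E, hE⟩
          obtain rfl : _ = f := hE
          rfl }
  rw [h1, Nat.cast_sum, Finset.sum_div]
  refine Finset.sum_congr rfl fun f _ => ?_
  have h2 := Ω.card_class_mul f.1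
  have h3 : Nat.card (Gauge Ω.IsTop d) ≠ 0 := Nat.card_pos.ne'
  have h4 : Ω.classAutCard f.1 ≠ 0 := fun h => by
    rw [h, mul_zero] at h2
    exact h3 h2.symm
  have h4' : (Ω.classAutCard f.1 : K) ≠ 0 := Nat.cast_ne_zero.mpr h4
  have h3' : (Nat.card (Gauge Ω.IsTop d) : K) ≠ 0 := Nat.cast_ne_zero.mpr h3
  rw [div_eq_div_iff h4' h3', one_mul, ← h2, Nat.cast_mul]

/-- The number of marked coverings of the cells of positive dimension with given local
invariants. -/
noncomputable def markedCount (β : Ω.Vertex → CoverType D S d) : ℕ :=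
  Nat.card {E : MarkedCover Ω.PosTop d // Ω.markedInvariant E = β}

/-- The normalized number of coverings with given local invariants, multiplied by the
numbers of ways of gluing the sheets at the vertices. -/
noncomputable def weightedCount (K : Type*) [Field K] (u : Prop)
    (β : Ω.Vertex → CoverType D S d) : K :=
  (Ω.markedCount β : K) / Nat.card (Gauge Ω.PosTop d) * ∏ᶠ q, ((β q).weight u : K)

theorem card_gauge_posTop : Nat.card (Gauge Ω.PosTop d) = Nat.card (Gauge Ω.IsTop d) := by
  rw [MarkedCover.card_gauge, MarkedCover.card_gauge]
  congr 1
  refine Nat.card_congr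
    { toFun := fun z => ⟨z.1.1, z.2⟩
      invFun := fun z => ⟨⟨z.1, ?_⟩, z.2⟩
      left_inv := fun _ => rfl
      right_inv := fun _ => rfl }
  have : Ω.dim z.1 = D + 1 := z.2
  omega

/-- Fibering the marked coverings over their restrictions to the cells of positive dimension turns
both kinds of Hurwitz numbers into weighted counts: `p` describes all coverings with local
invariants `β`, respectively the unglued ones among them if `u` holds. -/
theorem finsum_eq_weightedCount (K : Type*) [Field K] [CharZero K] (u : Prop)
    (β : Ω.Vertex → CoverType D S d) (p : CoverClass Ω.toSimpleComplex d → Prop)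
    (hp : ∀ f, p f ↔ (u → ∃ g : Ω.Covering d, g.Unglued ∧ f = Quotient.mk _ g) ∧
      Ω.localInvariants f = β) :
    ∑ᶠ f : {f // p f}, 1 / (Ω.classAutCard f.1 : K) = Ω.weightedCount K u β := by
  classical
  have := Fintype.ofFinite {E : MarkedCover Ω.PosTop d // Ω.markedInvariant E = β}
  have := Fintype.ofFinite Ω.Vertex
  rw [finsum_class, weightedCount, Ω.card_gauge_posTop, div_mul_eq_mul_div]
  congr 1
  have h1 : Nat.card {E : MarkedCover Ω.IsTop d // p (Quotient.mk _ E.toCover)} =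
      Nat.card (Σ E : {E : MarkedCover Ω.PosTop d // Ω.markedInvariant E = β},
        {F : MarkedCover Ω.IsTop d // Ω.posMap.pullback F = E.1 ∧ (u → F.toCover.Unglued)}) := by
    have hloc : ∀ F : MarkedCover Ω.IsTop d,
        Ω.localInvariants (Quotient.mk _ F.toCover : CoverClass _ d) =
          Ω.markedInvariant (Ω.posMap.pullback F) := fun F =>
      funext fun q => Ω.localInvariant_toCover F q
    refine Nat.card_congr
      { toFun := fun F => ⟨⟨Ω.posMap.pullback F.1, ?_⟩, F.1, rfl, ?_⟩
        invFun := fun F => ⟨F.2.1, ?_⟩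
        left_inv := fun _ => rfl
        right_inv := ?_ }
    · rw [← hloc]
      exact ((hp _).mp F.2).2
    · intro hu
      obtain ⟨g, hg, h⟩ := ((hp _).mp F.2).1 hu
      obtain ⟨φ⟩ := Quotient.exact h
      exact hg.of_iso φ
    · refine (hp _).mpr ⟨fun hu => ⟨_, F.2.2.2 hu, rfl⟩, ?_⟩
      rw [hloc, F.2.2.1, F.1.2]
    · rintro ⟨⟨E, hE⟩, F, hF, hu⟩
      obtain rfl : _ = E := hF
      rfl
  rw [h1, Nat.card_sigma]
  have h2 : ∀ E : {E : MarkedCover Ω.PosTop d // Ω.markedInvariant E = β},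
      Nat.card {F : MarkedCover Ω.IsTop d // Ω.posMap.pullback F = E.1 ∧ (u → F.toCover.Unglued)} =
        ∏ᶠ q, (β q).weight u := fun E => by rw [card_extensions, E.2]
  simp_rw [h2]
  rw [Finset.sum_const, Finset.card_univ, smul_eq_mul, markedCount, Nat.card_eq_fintype_card,
    Nat.cast_mul, finprod_eq_prod_of_fintype, finprod_eq_prod_of_fintype, Nat.cast_prod]

theorem hurwitz_eq (K : Type*) [Field K] [CharZero K] (β : Ω.Vertex → CoverType D S d) :
    Ω.hurwitz K β = Ω.weightedCount K False β :=
  Ω.finsum_eq_weightedCount K False β _ fun f => by simp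

theorem ungluedHurwitz_eq (K : Type*) [Field K] [CharZero K] (β : Ω.Vertex → CoverType D S d) :
    Ω.ungluedHurwitz K β = Ω.weightedCount K True β :=
  Ω.finsum_eq_weightedCount K True β _ fun f => by simp

end BraneComplex

/-! ### Counting marked coverings of unions -/

namespace UpperMap

variable {P Q : Type} [PartialOrder P] [PartialOrder Q] {s : P → Prop} {t : Q → Prop} {d : ℕ}

theorem pullback_bijective (j : UpperMap s t) (hj : Function.Surjective j) :
    Function.Bijective (j.pullback (d := d)) := by
  refine ⟨j.pullback_injective hj, fun E => ?_⟩
  let i : UpperMap s s := .ofIso (.refl _) fun _ => Iff.rfl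
  obtain ⟨G, hG, -⟩ := MarkedCover.exists_glue j j (fun x => Or.inl (hj x)) E E i i (fun _ => rfl)
    (fun p q h => ⟨p, rfl, j.injective h⟩) rfl
  exact ⟨G, hG⟩

theorem gauge_bijective (j : UpperMap s t) (hj : Function.Surjective j) :
    Function.Bijective (j.gauge (d := d)) := ⟨j.gauge_injective hj, j.gauge_surjective⟩

end UpperMap

namespace MarkedCover

variable {P Q R C : Type} [PartialOrder P] [PartialOrder Q] [PartialOrder R] [PartialOrder C]
  {s : P → Prop} {t : Q → Prop} {r : R → Prop} {c : C → Prop} {d : ℕ}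

/-- Marked coverings of a disjoint union are pairs of marked coverings. -/
theorem bijective_of_disjoint (j : UpperMap s r) (k : UpperMap t r)
    (h : ∀ x, (∃ p, j p = x) ∨ ∃ q, k q = x) (hd : ∀ p q, j p ≠ k q) :
    Function.Bijective fun G : MarkedCover r d => (j.pullback G, k.pullback G) := by
  refine ⟨fun G G' hG => eq_of_pullback_eq j k h (congrArg Prod.fst hG) (congrArg Prod.snd hG), ?_⟩
  rintro ⟨E, F⟩
  let i : UpperMap (P := {p : P // False}) (fun p => s p.1) s :=
    ⟨OrderEmbedding.subtype _, fun {p} => p.2.elim, fun p => p.2.elim⟩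
  let i' : UpperMap (P := {p : P // False}) (fun p => s p.1) t :=
    ⟨OrderEmbedding.ofMapLEIff (fun p => p.2.elim) fun p => p.2.elim, fun {p} => p.2.elim,
      fun p => p.2.elim⟩
  obtain ⟨G, rfl, rfl⟩ := exists_glue j k h E F i i' (fun p => p.2.elim)
    (fun p q hpq => (hd p q hpq).elim) (MarkedCover.ext (funext fun p => p.2.elim))
  exact ⟨G, rfl⟩

/-- Inclusion and exclusion for the maximal cells of two upper sets. -/
theorem card_top_add [Finite R] (j : UpperMap s r) (k : UpperMap t r)
    (h : ∀ x, (∃ p, j p = x) ∨ ∃ q, k q = x) (u : UpperMap c s) (v : UpperMap c t)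
    (huv : ∀ x, j (u x) = k (v x)) (hc : ∀ p q, j p = k q → ∃ x, u x = p ∧ v x = q) :
    Nat.card {z // r z} + Nat.card {z // c z} = Nat.card {z // s z} + Nat.card {z // t z} := by
  have himg : ∀ {P : Type} [PartialOrder P] {s : P → Prop} (j : UpperMap s r),
      Nat.card {z // s z} = {x | r x ∧ ∃ p, j p = x}.ncard := by
    intro P _ s j
    rw [← Nat.card_coe_set_eq]
    refine Nat.card_congr (Equiv.ofBijective
      (fun z => ⟨j z.1, (j.top_iff _).mpr z.2, z.1, rfl⟩) ⟨fun z z' h => ?_, ?_⟩)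
    · exact Subtype.ext (j.injective (congrArg Subtype.val h))
    · rintro ⟨_, hx, p, rfl⟩
      exact ⟨⟨p, (j.top_iff p).mp hx⟩, rfl⟩
  rw [himg j, himg k, himg (j.comp u), ← Set.ncard_union_add_ncard_inter]
  congr 1
  · rw [← Nat.card_coe_set_eq]
    refine Nat.card_congr (Equiv.subtypeEquivRight fun x => ?_)
    constructor
    · intro hx
      rcases h x with h | h
      · exact Or.inl ⟨hx, h⟩
      · exact Or.inr ⟨hx, h⟩
    · rintro (h | h) <;> exact h.1
  · congr 1
    ext x
    constructor
    · rintro ⟨hx, p, rfl⟩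
      exact ⟨⟨hx, u p, rfl⟩, hx, v p, (huv p).symm⟩
    · rintro ⟨⟨hx, p, rfl⟩, -, q, hq⟩
      obtain ⟨x, rfl, -⟩ := hc p q hq.symm
      exact ⟨hx, x, rfl⟩

theorem card_gauge_mul [Finite P] [Finite Q] [Finite R] [Finite C] (j : UpperMap s r)
    (k : UpperMap t r) (h : ∀ x, (∃ p, j p = x) ∨ ∃ q, k q = x) (u : UpperMap c s)
    (v : UpperMap c t) (huv : ∀ x, j (u x) = k (v x))
    (hc : ∀ p q, j p = k q → ∃ x, u x = p ∧ v x = q) :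
    Nat.card (Gauge r d) * Nat.card (Gauge c d) = Nat.card (Gauge s d) * Nat.card (Gauge t d) := by
  simp_rw [card_gauge]
  rw [← pow_add, ← pow_add, card_top_add j k h u v huv hc]

theorem card_gauge_of_disjoint [Finite P] [Finite Q] [Finite R] (j : UpperMap s r)
    (k : UpperMap t r) (h : ∀ x, (∃ p, j p = x) ∨ ∃ q, k q = x) (hd : ∀ p q, j p ≠ k q) :
    Nat.card (Gauge r d) = Nat.card (Gauge s d) * Nat.card (Gauge t d) := by
  let i : UpperMap (P := {p : P // False}) (fun p => s p.1) s :=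
    ⟨OrderEmbedding.subtype _, fun {p} => p.2.elim, fun p => p.2.elim⟩
  let i' : UpperMap (P := {p : P // False}) (fun p => s p.1) t :=
    ⟨OrderEmbedding.ofMapLEIff (fun p => p.2.elim) fun p => p.2.elim, fun {p} => p.2.elim,
      fun p => p.2.elim⟩
  have h1 := card_gauge_mul (d := d) j k h i i' (fun p => p.2.elim) fun p q hpq => (hd p q hpq).elim
  have h2 : Nat.card (Gauge (P := {p : P // False}) (fun p => s p.1) d) = 1 := by
    rw [card_gauge]
    have : IsEmpty {z : {p : P // False} // s z.1} := ⟨fun z => z.1.2⟩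
    rw [Nat.card_of_isEmpty, pow_zero]
  rwa [h2, mul_one] at h1

end MarkedCover

/-! ### Local invariants under isomorphisms around a vertex -/

namespace BraneComplex

variable {D d : ℕ} {S : Type*}

section Link

variable {Ω Ω' : BraneComplex D S} {q : Ω.Vertex} {q' : Ω'.Vertex}

/-- The isomorphism of posets around two vertices that is given by a map of cells. -/
noncomputable def linkOrderIso
    (f : {x : Ω.Cell // q.1 < x} → Ω'.Cell) (hle : ∀ x y, f x ≤ f y ↔ x ≤ y)
    (hlt : ∀ x, q'.1 < f x) (hsurj : ∀ y, q'.1 < y → ∃ x, f x = y) :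
    {x : Ω.Cell // q.1 < x} ≃o {y : Ω'.Cell // q'.1 < y} :=
  RelIso.ofSurjective (OrderEmbedding.ofMapLEIff
    (fun x => (⟨f x, hlt x⟩ : {y : Ω'.Cell // q'.1 < y})) fun x y => hle x y)
    fun y => by
      obtain ⟨x, hx⟩ := hsurj y.1 y.2
      exact ⟨x, Subtype.ext hx⟩

/-- A bijection between the cells around two vertices that respects all structure is an isomorphism
of the vertex complexes. -/
theorem exists_link_iso
    (f : {x : Ω.Cell // q.1 < x} → Ω'.Cell) (hle : ∀ x y, f x ≤ f y ↔ x ≤ y)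
    (hlt : ∀ x, q'.1 < f x) (hsurj : ∀ y, q'.1 < y → ∃ x, f x = y)
    (hdim : ∀ x, Ω'.dim (f x) = Ω.dim x.1)
    (hinc : ∀ x y, y.1 ⋖ x.1 → Ω'.inc (f x) (f y) = Ω.inc x.1 y.1)
    (hinc0 : ∀ x, Ω.dim x.1 = 1 → Ω'.inc (f x) q'.1 = Ω.inc x.1 q.1)
    (hcolor : ∀ x h h', Ω'.color (f x) h' = Ω.color x.1 h) :
    ∃ φ : ColoredComplex.Iso (Ω.link q).1 (Ω'.link q').1,
      ∀ x, (Ω'.starMap q' (φ.upperMap x)).1 = f x := by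
  have key : ∀ x y : {x : Ω.Cell // q.1 < x}, y ⋖ x →
      (if Ω'.dim (f y) = 1 then -(Ω'.inc (f x) (f y) * Ω'.inc (f y) q'.1)
        else -Ω'.inc (f x) (f y)) =
      if Ω.dim y.1 = 1 then -(Ω.inc x.1 y.1 * Ω.inc y.1 q.1) else -Ω.inc x.1 y.1 := by
    intro x y h
    have h' : y.1 ⋖ x.1 := ⟨h.1, fun z hxz hzy => h.2 (c := ⟨z, y.2.trans hxz⟩) hxz hzy⟩
    rw [hdim, hinc x y h']
    split_ifs with h1
    · rw [hinc0 y h1]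
    · rfl
  exact ⟨⟨linkOrderIso f hle hlt hsurj, fun x => congrArg (· - 1) (hdim x),
    fun {x y} h => key x y h, fun x h h' => hcolor _ _ _⟩, fun _ => rfl⟩

/-- If the orientations of the edges at the two vertices are opposite, then the vertex complexes are
isomorphic up to inversion of all orientations. -/
theorem exists_star_link_iso
    (f : {x : Ω.Cell // q.1 < x} → Ω'.Cell) (hle : ∀ x y, f x ≤ f y ↔ x ≤ y)
    (hlt : ∀ x, q'.1 < f x) (hsurj : ∀ y, q'.1 < y → ∃ x, f x = y)
    (hdim : ∀ x, Ω'.dim (f x) = Ω.dim x.1)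
    (hinc : ∀ x y, y.1 ⋖ x.1 → Ω'.inc (f x) (f y) = Ω.inc x.1 y.1)
    (hinc0 : ∀ x, Ω.dim x.1 = 1 → Ω'.inc (f x) q'.1 = -Ω.inc x.1 q.1)
    (hcolor : ∀ x h h', Ω'.color (f x) h' = Ω.color x.1 h) :
    ∃ φ : ColoredComplex.Iso (Ω.link q).1.star (Ω'.link q').1,
      ∀ x, (Ω'.starMap q' (φ.upperMap x)).1 = f x := by
  have key : ∀ x y : {x : Ω.Cell // q.1 < x}, y ⋖ x →
      (if Ω'.dim (f y) = 1 then -(Ω'.inc (f x) (f y) * Ω'.inc (f y) q'.1)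
        else -Ω'.inc (f x) (f y)) =
      if Ω.dim y.1 - 1 = 0 then
        -(if Ω.dim y.1 = 1 then -(Ω.inc x.1 y.1 * Ω.inc y.1 q.1) else -Ω.inc x.1 y.1)
      else (if Ω.dim y.1 = 1 then -(Ω.inc x.1 y.1 * Ω.inc y.1 q.1) else -Ω.inc x.1 y.1) := by
    intro x y h
    have h' : y.1 ⋖ x.1 := ⟨h.1, fun z hxz hzy => h.2 (c := ⟨z, y.2.trans hxz⟩) hxz hzy⟩
    have h0 := Ω.dim_lt y.2
    rw [hdim, hinc x y h']
    by_cases h1 : Ω.dim y.1 = 1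
    · simp [h1, hinc0 y h1]
    · have h2 : Ω.dim y.1 - 1 ≠ 0 := by omega
      simp [h1, h2]
  exact ⟨⟨linkOrderIso f hle hlt hsurj, fun x => congrArg (· - 1) (hdim x),
    fun {x y} h => key x y h, fun x h h' => hcolor _ _ _⟩, fun _ => rfl⟩

end Link

theorem covBy_of_dim_one {Ω : BraneComplex D S} {q : Ω.Vertex} {x : Ω.Cell} (h : q.1 < x)
    (hx : Ω.dim x = 1) : q.1 ⋖ x :=
  ⟨h, fun z h1 h2 => by
    have := Ω.dim_lt h1
    have := Ω.dim_lt h2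
    omega⟩

theorem markedInvariant_base {Ω : BraneComplex D S} (E : MarkedCover Ω.PosTop d) (q : Ω.Vertex) :
    (Ω.markedInvariant E q).base = Ω.cls q := rfl

theorem base_eq_of_markedCount_ne_zero {Ω : BraneComplex D S} {β : Ω.Vertex → CoverType D S d}
    (h : Ω.markedCount β ≠ 0) (q : Ω.Vertex) : (β q).base = Ω.cls q := by
  obtain ⟨⟨E, rfl⟩⟩ := (Nat.card_ne_zero.mp h).1
  exact Ω.markedInvariant_base E q

theorem base_eq_of_weightedCount_ne_zero {K : Type*} [Field K] {u : Prop} {Ω : BraneComplex D S}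
    {β : Ω.Vertex → CoverType D S d} (h : Ω.weightedCount K u β ≠ 0) (q : Ω.Vertex) :
    (β q).base = Ω.cls q := by
  refine base_eq_of_markedCount_ne_zero (fun h0 => h ?_) q
  rw [weightedCount, h0, Nat.cast_zero, zero_div, zero_mul]

/-! ### Isomorphisms and disjoint unions -/

theorem mapVertex_bijective {Ω Ω' : BraneComplex D S} (φ : Ω.Iso Ω') :
    Function.Bijective (mapVertex φ.toIso) := by
  refine ⟨fun v w h => Subtype.ext (φ.toOrderIso.injective (congrArg Subtype.val h)), fun w => ?_⟩
  refine ⟨⟨φ.toOrderIso.symm w.1, ?_⟩, Subtype.ext (φ.toOrderIso.apply_symm_apply _)⟩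
  rw [← φ.dim_eq, φ.toOrderIso.apply_symm_apply, w.2]

theorem weightedCount_iso (K : Type*) [Field K] (u : Prop) {Ω Ω' : BraneComplex D S} (φ : Ω.Iso Ω')
    (β' : Ω'.Vertex → CoverType D S d) :
    Ω'.weightedCount K u β' = Ω.weightedCount K u fun q => β' (mapVertex φ.toIso q) := by
  let j : UpperMap Ω.PosTop Ω'.PosTop :=
    { toOrderEmbedding := OrderEmbedding.ofMapLEIff
        (fun x => ⟨φ.toOrderIso x.1, by rw [φ.dim_eq]; exact x.2⟩)
        fun x y => φ.toOrderIso.le_iff_le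
      upper := fun {p q} _ => ⟨⟨φ.toOrderIso.symm q.1, by
        have h := φ.dim_eq (φ.toOrderIso.symm q.1)
        rw [φ.toOrderIso.apply_symm_apply] at h
        rw [← h]
        exact q.2⟩, Subtype.ext (φ.toOrderIso.apply_symm_apply _)⟩
      top_iff := fun p => by
        change Ω'.dim _ = _ ↔ Ω.dim _ = _
        rw [← φ.dim_eq]
        rfl }
  have hj : Function.Surjective j := fun q => ⟨⟨φ.toOrderIso.symm q.1, by
    have h := φ.dim_eq (φ.toOrderIso.symm q.1)
    rw [φ.toOrderIso.apply_symm_apply] at h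
    rw [← h]
    exact q.2⟩, Subtype.ext (φ.toOrderIso.apply_symm_apply _)⟩
  have hinv : ∀ (E : MarkedCover Ω'.PosTop d) q,
      Ω.markedInvariant (j.pullback E) q = Ω'.markedInvariant E (mapVertex φ.toIso q) := by
    intro E q
    obtain ⟨ψ, hψ⟩ := exists_link_iso (q := q) (q' := mapVertex φ.toIso q)
      (fun x => φ.toOrderIso x.1) (fun x y => φ.toOrderIso.le_iff_le)
      (fun x => φ.toOrderIso.lt_iff_lt.mpr x.2)
      (fun y hy => ⟨⟨φ.toOrderIso.symm y, φ.toOrderIso.lt_symm_apply.mpr hy⟩,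
        φ.toOrderIso.apply_symm_apply _⟩) (fun x => φ.dim_eq _) (fun x y h => φ.inc_eq h)
      (fun x hx => φ.inc_eq (covBy_of_dim_one x.2 hx)) (fun x h h' => φ.color_eq _ _ _)
    rw [markedInvariant, markedInvariant, ← MarkedCover.type_pullback ψ]
    refine congrArg (MarkedCover.type (Ω.link q)) ?_
    exact UpperMap.pullback_congr (j := j.comp (Ω.starMap q))
      (k := (Ω'.starMap _).comp ψ.upperMap) (fun x => Subtype.ext (hψ x).symm) E
  have hcount : Ω'.markedCount β' = Ω.markedCount fun q => β' (mapVertex φ.toIso q) := by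
    refine Nat.card_congr ((Equiv.ofBijective _ (j.pullback_bijective hj)).subtypeEquiv fun E => ?_)
    constructor
    · rintro rfl
      exact funext fun q => hinv E q
    · intro h
      funext q'
      obtain ⟨q, rfl⟩ := (mapVertex_bijective φ).2 q'
      rw [← hinv]
      exact congrFun h q
  have hprod : ∏ᶠ q, ((β' q).weight u : K) = ∏ᶠ q, ((β' (mapVertex φ.toIso q)).weight u : K) :=
    (finprod_comp_equiv (Equiv.ofBijective _ (mapVertex_bijective φ))).symm
  rw [weightedCount, weightedCount, hcount, hprod,
    Nat.card_congr (Equiv.ofBijective _ (j.gauge_bijective (d := d) hj))]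

namespace DisjointUnion

variable {Ω Ω₁ Ω₂ : BraneComplex D S} (u : DisjointUnion Ω Ω₁ Ω₂)

/-- The inclusion of the cells of positive dimension of the first part. -/
def inlMap : UpperMap Ω₁.PosTop Ω.PosTop where
  toOrderEmbedding := OrderEmbedding.ofMapLEIff
    (fun x => ⟨u.toOrderIso (.inl x.1), by rw [u.dim_inl]; exact x.2⟩)
    fun x y => u.toOrderIso.le_iff_le.trans Sum.inl_le_inl_iff
  upper {p q} h := by
    obtain ⟨q, hq⟩ := q
    obtain ⟨x | x, rfl⟩ := u.toOrderIso.surjective q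
    · exact ⟨⟨x, by rwa [u.dim_inl] at hq⟩, rfl⟩
    · exact absurd (u.toOrderIso.le_iff_le.mp h) Sum.not_inl_le_inr
  top_iff p := by
    change Ω.dim (u.toOrderIso (.inl p.1)) = _ ↔ Ω₁.dim _ = _
    rw [u.dim_inl]

/-- The inclusion of the cells of positive dimension of the second part. -/
def inrMap : UpperMap Ω₂.PosTop Ω.PosTop where
  toOrderEmbedding := OrderEmbedding.ofMapLEIff
    (fun x => ⟨u.toOrderIso (.inr x.1), by rw [u.dim_inr]; exact x.2⟩)
    fun x y => u.toOrderIso.le_iff_le.trans Sum.inr_le_inr_iff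
  upper {p q} h := by
    obtain ⟨q, hq⟩ := q
    obtain ⟨x | x, rfl⟩ := u.toOrderIso.surjective q
    · exact absurd (u.toOrderIso.le_iff_le.mp h) Sum.not_inr_le_inl
    · exact ⟨⟨x, by rwa [u.dim_inr] at hq⟩, rfl⟩
  top_iff p := by
    change Ω.dim (u.toOrderIso (.inr p.1)) = _ ↔ Ω₂.dim _ = _
    rw [u.dim_inr]

/-- The vertices of a disjoint union. -/
noncomputable def vertexEquiv : Ω₁.Vertex ⊕ Ω₂.Vertex ≃ Ω.Vertex :=
  Equiv.ofBijective (Sum.elim u.inl u.inr) <| by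
    constructor
    · rintro (v | v) (w | w) h
      · have := u.toOrderIso.injective (congrArg Subtype.val h)
        exact congrArg Sum.inl (Subtype.ext (Sum.inl_injective this))
      · have := u.toOrderIso.injective (congrArg Subtype.val h)
        exact absurd this Sum.inl_ne_inr
      · have := u.toOrderIso.injective (congrArg Subtype.val h)
        exact absurd this Sum.inr_ne_inl
      · have := u.toOrderIso.injective (congrArg Subtype.val h)
        exact congrArg Sum.inr (Subtype.ext (Sum.inr_injective this))
    · rintro ⟨v, hv⟩
      obtain ⟨x | x, rfl⟩ := u.toOrderIso.surjective v
      · exact ⟨.inl ⟨x, by rwa [u.dim_inl] at hv⟩, rfl⟩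
      · exact ⟨.inr ⟨x, by rwa [u.dim_inr] at hv⟩, rfl⟩

theorem markedInvariant_inl (E : MarkedCover Ω.PosTop d) (q : Ω₁.Vertex) :
    Ω₁.markedInvariant (u.inlMap.pullback E) q = Ω.markedInvariant E (u.inl q) := by
  obtain ⟨ψ, hψ⟩ := exists_link_iso (q := q) (q' := u.inl q)
    (fun x => u.toOrderIso (.inl x.1))
    (fun x y => u.toOrderIso.le_iff_le.trans Sum.inl_le_inl_iff)
    (fun x => u.toOrderIso.lt_iff_lt.mpr (Sum.inl_lt_inl_iff.mpr x.2))
    (fun y hy => by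
      obtain ⟨x | x, rfl⟩ := u.toOrderIso.surjective y
      · exact ⟨⟨x, Sum.inl_lt_inl_iff.mp (u.toOrderIso.lt_iff_lt.mp hy)⟩, rfl⟩
      · exact absurd (u.toOrderIso.lt_iff_lt.mp hy) Sum.not_inl_lt_inr)
    (fun x => u.dim_inl _) (fun x y h => u.inc_inl h)
    (fun x hx => u.inc_inl (covBy_of_dim_one x.2 hx)) (fun x h h' => u.color_inl _ _ _)
  rw [markedInvariant, markedInvariant, ← MarkedCover.type_pullback ψ]
  refine congrArg (MarkedCover.type (Ω₁.link q)) ?_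
  exact UpperMap.pullback_congr (j := u.inlMap.comp (Ω₁.starMap q))
    (k := (Ω.starMap _).comp ψ.upperMap) (fun x => Subtype.ext (hψ x).symm) E

theorem markedInvariant_inr (E : MarkedCover Ω.PosTop d) (q : Ω₂.Vertex) :
    Ω₂.markedInvariant (u.inrMap.pullback E) q = Ω.markedInvariant E (u.inr q) := by
  obtain ⟨ψ, hψ⟩ := exists_link_iso (q := q) (q' := u.inr q)
    (fun x => u.toOrderIso (.inr x.1))
    (fun x y => u.toOrderIso.le_iff_le.trans Sum.inr_le_inr_iff)
    (fun x => u.toOrderIso.lt_iff_lt.mpr (Sum.inr_lt_inr_iff.mpr x.2))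
    (fun y hy => by
      obtain ⟨x | x, rfl⟩ := u.toOrderIso.surjective y
      · exact absurd (u.toOrderIso.lt_iff_lt.mp hy) Sum.not_inr_lt_inl
      · exact ⟨⟨x, Sum.inr_lt_inr_iff.mp (u.toOrderIso.lt_iff_lt.mp hy)⟩, rfl⟩)
    (fun x => u.dim_inr _) (fun x y h => u.inc_inr h)
    (fun x hx => u.inc_inr (covBy_of_dim_one x.2 hx)) (fun x h h' => u.color_inr _ _ _)
  rw [markedInvariant, markedInvariant, ← MarkedCover.type_pullback ψ]
  refine congrArg (MarkedCover.type (Ω₂.link q)) ?_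
  exact UpperMap.pullback_congr (j := u.inrMap.comp (Ω₂.starMap q))
    (k := (Ω.starMap _).comp ψ.upperMap) (fun x => Subtype.ext (hψ x).symm) E

theorem finprod_vertex {M : Type*} [CommMonoid M] (F : Ω.Vertex → M) :
    ∏ᶠ q, F q = (∏ᶠ q, F (u.inl q)) * ∏ᶠ q, F (u.inr q) := by
  have := Fintype.ofFinite Ω.Vertex
  have := Fintype.ofFinite Ω₁.Vertex
  have := Fintype.ofFinite Ω₂.Vertex
  rw [← finprod_comp_equiv u.vertexEquiv, finprod_eq_prod_of_fintype, Fintype.prod_sum_type,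
    finprod_eq_prod_of_fintype, finprod_eq_prod_of_fintype]
  rfl

theorem weightedCount_eq (K : Type*) [Field K] (w : Prop) (β : Ω.Vertex → CoverType D S d) :
    Ω.weightedCount K w β =
      Ω₁.weightedCount K w (fun q => β (u.inl q)) * Ω₂.weightedCount K w fun q => β (u.inr q) := by
  have hjoint : ∀ x, (∃ p, u.inlMap p = x) ∨ ∃ q, u.inrMap q = x := by
    rintro ⟨x, hx⟩
    obtain ⟨x | x, rfl⟩ := u.toOrderIso.surjective x
    · exact Or.inl ⟨⟨x, by rwa [u.dim_inl] at hx⟩, rfl⟩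
    · exact Or.inr ⟨⟨x, by rwa [u.dim_inr] at hx⟩, rfl⟩
  have hdisj : ∀ p q, u.inlMap p ≠ u.inrMap q := fun p q h =>
    Sum.inl_ne_inr (u.toOrderIso.injective (congrArg Subtype.val h))
  have hcount : Ω.markedCount β =
      Ω₁.markedCount (fun q => β (u.inl q)) * Ω₂.markedCount fun q => β (u.inr q) := by
    rw [markedCount, markedCount, markedCount, ← Nat.card_prod]
    refine Nat.card_congr (Equiv.trans ?_ (Equiv.subtypeProdEquivProd
      (p := fun E => Ω₁.markedInvariant E = _) (q := fun E => Ω₂.markedInvariant E = _)))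
    refine (Equiv.ofBijective _ (MarkedCover.bijective_of_disjoint u.inlMap u.inrMap hjoint
      hdisj)).subtypeEquiv fun E => ?_
    constructor
    · rintro rfl
      exact ⟨funext fun q => u.markedInvariant_inl E q, funext fun q => u.markedInvariant_inr E q⟩
    · rintro ⟨h1, h2⟩
      funext q
      obtain ⟨v | v, rfl⟩ := u.vertexEquiv.surjective q
      · exact (u.markedInvariant_inl E v).symm.trans (congrFun h1 v)
      · exact (u.markedInvariant_inr E v).symm.trans (congrFun h2 v)
  rw [weightedCount, weightedCount, weightedCount, hcount, u.finprod_vertex,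
    MarkedCover.card_gauge_of_disjoint u.inlMap u.inrMap hjoint hdisj, Nat.cast_mul, Nat.cast_mul,
    mul_div_mul_comm]
  ring

end DisjointUnion

/-! ### Complexes with two vertices -/

theorem _root_.CoverType.autCard_star {n : ℕ} (β : CoverType n S d) :
    β.star.autCard = β.autCard := by
  induction β using Quotient.inductionOn
  rfl

theorem exists_vertex_le {n : ℕ} (X : SimpleComplex n) (x : X.Cell) : ∃ v : X.Vertex, v.1 ≤ x := by
  induction x using (wellFounded_lt (α := X.Cell)).induction with
  | _ x ih =>
    by_cases h : ∃ y, y < x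
    · obtain ⟨y, hy⟩ := h
      obtain ⟨v, hv⟩ := ih y hy
      exact ⟨v, hv.trans hy.le⟩
    · refine ⟨⟨x, ?_⟩, le_rfl⟩
      -- The boundary of a minimal cell is empty, and so is only the sphere of dimension `-1`.
      by_contra h0
      obtain ⟨φ⟩ := X.sphere x
      obtain ⟨m, hm⟩ := Nat.exists_eq_succ_of_ne_zero h0
      rw [hm] at φ
      let p : EuclideanSpace ℝ (Fin (m + 1)) := EuclideanSpace.single 0 1
      have hp : p ∈ Metric.sphere (0 : EuclideanSpace ℝ (Fin (m + 1))) 1 := by simp [p]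
      have hw := (φ.symm ⟨p, hp⟩).2.2.1
      have : IsEmpty {y : X.Cell // y < x} := ⟨fun y => h ⟨y.1, y.2⟩⟩
      rw [finsum_of_isEmpty] at hw
      exact zero_ne_one hw

open Classical in
/-- With only two vertices, every cell of positive dimension contains both of them, so that marked
coverings are those of the vertex complex of `q₁`, and the invariant at `q₂` is opposite to that
at `q₁`. -/
theorem weightedCount_two (K : Type*) [Field K] [CharZero K] (u : Prop) {Ω : BraneComplex D S}
    {q₁ q₂ : Ω.Vertex} (hne : q₁ ≠ q₂) (h : ∀ v, v = q₁ ∨ v = q₂) (β : Ω.Vertex → CoverType D S d)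
    (hβ : (β q₁).base = Ω.cls q₁) :
    Ω.weightedCount K u β = if β q₂ = (β q₁).star then
      ((β q₁).weight u : K) ^ 2 / (β q₁).autCard else 0 := by
  have key : ∀ x, 0 < Ω.dim x → q₁.1 < x ∧ q₂.1 < x := by
    intro x hx
    have hlt : ∀ v : Ω.Vertex, v.1 ≤ x → v.1 < x := fun v hv => lt_of_le_of_ne hv fun h => by
      have := v.2
      rw [h] at this
      omega
    obtain ⟨v, hv⟩ := exists_vertex_le Ω.toSimpleComplex x
    obtain ⟨w, hw, hwx⟩ := Ω.exists_other_vertex v (hlt v hv)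
    rcases h v with rfl | rfl <;> rcases h w with rfl | rfl
    · exact absurd rfl hw
    · exact ⟨hlt _ hv, hwx⟩
    · exact ⟨hwx, hlt _ hv⟩
    · exact absurd rfl hw
  have hpos : ∀ {q : Ω.Vertex} {x}, q.1 < x → 0 < Ω.dim x := fun {q x} h =>
    (Nat.zero_le _).trans_lt (Ω.dim_lt h)
  have hj : Function.Surjective (Ω.starMap q₁) := fun x => ⟨⟨x.1, (key x.1 x.2).1⟩, rfl⟩
  have hinv : ∀ E : MarkedCover Ω.PosTop d,
      Ω.markedInvariant E q₂ = (Ω.markedInvariant E q₁).star := by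
    intro E
    obtain ⟨ψ, hψ⟩ := exists_star_link_iso (q := q₁) (q' := q₂) (fun x => x.1) (fun x y => Iff.rfl)
      (fun x => (key x.1 (hpos x.2)).2) (fun y hy => ⟨⟨y, (key y (hpos hy)).1⟩, rfl⟩)
      (fun _ => rfl) (fun _ _ _ => rfl)
      (fun x hx => Ω.inc_edge hx (key x.1 (hpos x.2)).2 x.2 fun h => hne (Subtype.ext h.symm))
      (fun _ _ _ => rfl)
    rw [markedInvariant, markedInvariant, MarkedCover.type_star]
    refine (MarkedCover.type_pullback (X := ⟨(Ω.link q₁).1.star, (Ω.link q₁).2⟩) ψ _).symm.trans ?_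
    refine congrArg (MarkedCover.type _) ?_
    exact UpperMap.pullback_congr (j := (Ω.starMap q₂).comp ψ.upperMap) (k := Ω.starMap q₁)
      (fun x => Subtype.ext (hψ x)) E
  have hprod : ∏ᶠ q, ((β q).weight u : K) = (β q₁).weight u * (β q₂).weight u := by
    have := Fintype.ofFinite Ω.Vertex
    rw [finprod_eq_prod_of_fintype, show (Finset.univ : Finset Ω.Vertex) = {q₁, q₂} by
      ext v; simpa using h v, Finset.prod_pair hne]
  have hG : Nat.card (Gauge Ω.PosTop d) = Nat.card (Gauge (Ω.link q₁).1.IsTop d) :=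
    Nat.card_congr (Equiv.ofBijective _ ((Ω.starMap q₁).gauge_bijective hj))
  have haut : ((β q₁).autCard : K) ≠ 0 :=
    Nat.cast_ne_zero.mpr (MarkedCover.autCard_pos _).ne'
  have hGne : (Nat.card (Gauge (Ω.link q₁).1.IsTop d) : K) ≠ 0 :=
    Nat.cast_ne_zero.mpr Nat.card_pos.ne'
  rw [weightedCount, hprod, hG]
  split_ifs with hs
  · have hcount : Ω.markedCount β =
        Nat.card {E : MarkedCover (Ω.link q₁).1.IsTop d // E.type (Ω.link q₁) = β q₁} := by
      refine Nat.card_congr ((Equiv.ofBijective _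
        ((Ω.starMap q₁).pullback_bijective hj)).subtypeEquiv fun E => ?_)
      constructor
      · rintro rfl
        rfl
      · intro h1
        funext v
        rcases h v with rfl | rfl
        · exact h1
        · rw [hs, hinv]
          exact congrArg CoverType.star h1
    have h1 := MarkedCover.card_type_eq_mul (Ω.link q₁) (β q₁) hβ
    rw [← hcount] at h1
    rw [hs, CoverType.weight_star, div_mul_eq_mul_div, div_eq_div_iff hGne haut, ← h1]
    push_cast
    ring
  · have hcount : Ω.markedCount β = 0 := by
      rw [markedCount, Nat.card_eq_zero, isEmpty_subtype]
      refine Or.inl fun E hE => hs ?_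
      rw [← hE, hinv]
    rw [hcount, Nat.cast_zero, zero_div, zero_mul]

end BraneComplex

/-! ### Cuts -/

namespace BraneComplex

variable {D d : ℕ} {S : Type*}

section Sides

variable (Ω : BraneComplex D S) (A : Set Ω.Vertex)

/-- The cells of positive dimension with a vertex in `A`. -/
abbrev Side : Type := {x : Ω.Cell // 0 < Ω.dim x ∧ ∃ a ∈ A, a.1 ≤ x}

/-- The cells of maximal dimension with a vertex in `A`. -/
def SideTop (x : Ω.Side A) : Prop := Ω.IsTop x.1

/-- The cells of the cut. -/
abbrev CrossCell : Type := {x : Ω.Cell // Ω.Crosses A x}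

/-- The cells of maximal dimension of the cut. -/
def CrossTop (x : Ω.CrossCell A) : Prop := Ω.IsTop x.1

/-- The inclusion of one side of a cut. -/
def sideMap : UpperMap (Ω.SideTop A) Ω.PosTop where
  toOrderEmbedding := OrderEmbedding.ofMapLEIff (fun x => ⟨x.1, x.2.1⟩) fun _ _ => Iff.rfl
  upper {p q} h := by
    obtain ⟨a, ha, hap⟩ := p.2.2
    exact ⟨⟨q.1, q.2, a, ha, hap.trans h⟩, rfl⟩
  top_iff _ := Iff.rfl

variable {Ω A}

theorem Crosses_dim_pos {x : Ω.Cell} (h : Ω.Crosses A x) : 0 < Ω.dim x := by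
  obtain ⟨⟨a, ha, hax⟩, b, hb, hbx⟩ := h
  refine Nat.pos_of_ne_zero fun h0 => hb ?_
  have key : ∀ v : Ω.Vertex, v.1 ≤ x → v.1 = x := fun v hv => by
    by_contra hne
    have := Ω.dim_lt (lt_of_le_of_ne hv hne)
    omega
  rwa [show b = a from Subtype.ext ((key b hbx).trans (key a hax).symm)]

variable (Ω A)

/-- The inclusion of the cut into the side of `A`. -/
def crossLeft : UpperMap (Ω.CrossTop A) (Ω.SideTop A) where
  toOrderEmbedding := OrderEmbedding.ofMapLEIff (fun x => ⟨x.1, Crosses_dim_pos x.2, x.2.1⟩)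
    fun _ _ => Iff.rfl
  upper {p q} h := by
    obtain ⟨b, hb, hbp⟩ := p.2.2
    exact ⟨⟨q.1, q.2.2, b, hb, hbp.trans h⟩, rfl⟩
  top_iff _ := Iff.rfl

/-- The inclusion of the cut into the other side. -/
def crossRight : UpperMap (Ω.CrossTop A) (Ω.SideTop Aᶜ) where
  toOrderEmbedding := OrderEmbedding.ofMapLEIff (fun x => ⟨x.1, Crosses_dim_pos x.2, x.2.2⟩)
    fun _ _ => Iff.rfl
  upper {p q} h := by
    obtain ⟨a, ha, hap⟩ := p.2.1
    exact ⟨⟨q.1, ⟨a, ha, hap.trans h⟩, q.2.2⟩, rfl⟩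
  top_iff _ := Iff.rfl

variable {A}

/-- The inclusion of the cells around a vertex in `A`. -/
def starSideMap {v : Ω.Vertex} (hv : v ∈ A) :
    UpperMap (Ω.vertexComplex v).IsTop (Ω.SideTop A) where
  toOrderEmbedding := OrderEmbedding.ofMapLEIff
    (fun x => ⟨x.1, (Nat.zero_le _).trans_lt (Ω.dim_lt x.2), v, hv, x.2.le⟩) fun _ _ => Iff.rfl
  upper {p q'} h := ⟨⟨q'.1, p.2.trans_le h⟩, rfl⟩
  top_iff p := (Ω.starMap v).top_iff p

theorem mem_side_or (x : Ω.PosCell) :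
    (∃ p, Ω.sideMap A p = x) ∨ ∃ q, Ω.sideMap Aᶜ q = x := by
  obtain ⟨v, hv⟩ := exists_vertex_le Ω.toSimpleComplex x.1
  by_cases h : v ∈ A
  · exact Or.inl ⟨⟨x.1, x.2, v, h, hv⟩, rfl⟩
  · exact Or.inr ⟨⟨x.1, x.2, v, h, hv⟩, rfl⟩

theorem exists_cross (p : Ω.Side A) (q : Ω.Side Aᶜ) (h : Ω.sideMap A p = Ω.sideMap Aᶜ q) :
    ∃ x, Ω.crossLeft A x = p ∧ Ω.crossRight A x = q := by
  have h' : p.1 = q.1 := congrArg Subtype.val h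
  exact ⟨⟨p.1, p.2.2, h' ▸ q.2.2⟩, rfl, Subtype.ext h'⟩

variable (A)

/-- Marked coverings are pairs of marked coverings of the two sides which agree on the cut. -/
noncomputable def splitEquiv : MarkedCover Ω.PosTop d ≃
    {p : MarkedCover (Ω.SideTop A) d × MarkedCover (Ω.SideTop Aᶜ) d //
      (Ω.crossLeft A).pullback p.1 = (Ω.crossRight A).pullback p.2} :=
  Equiv.ofBijective (fun E => ⟨((Ω.sideMap A).pullback E, (Ω.sideMap Aᶜ).pullback E), rfl⟩) <| by
    constructor
    · intro E F h
      have h' := congrArg Subtype.val h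
      exact MarkedCover.eq_of_pullback_eq _ _ Ω.mem_side_or (congrArg Prod.fst h')
        (congrArg Prod.snd h')
    · rintro ⟨⟨E, F⟩, h⟩
      obtain ⟨G, rfl, rfl⟩ := MarkedCover.exists_glue _ _ Ω.mem_side_or E F _ _ (fun _ => rfl)
        Ω.exists_cross h
      exact ⟨G, rfl⟩

/-- The class of the covering around a vertex, in terms of the coverings of the two sides. -/
noncomputable def sideInvariant
    (p : MarkedCover (Ω.SideTop A) d × MarkedCover (Ω.SideTop Aᶜ) d) (v : Ω.Vertex) :
    CoverType D S d :=
  open Classical in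
  if hv : v ∈ A then ((Ω.starSideMap hv).pullback p.1).type (Ω.link v)
  else ((Ω.starSideMap (A := Aᶜ) hv).pullback p.2).type (Ω.link v)

theorem sideInvariant_split (E : MarkedCover Ω.PosTop d) :
    Ω.sideInvariant A (Ω.splitEquiv A E).1 = Ω.markedInvariant E := by
  funext v
  rw [sideInvariant]
  split_ifs <;> rfl

theorem sideInvariant_smul
    (E : MarkedCover (Ω.SideTop A) d) (F : MarkedCover (Ω.SideTop Aᶜ) d)
    (g : Gauge (Ω.SideTop Aᶜ) d) : Ω.sideInvariant A (E, g • F) = Ω.sideInvariant A (E, F) := by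
  funext v
  rw [sideInvariant, sideInvariant]
  split_ifs with hv
  · rfl
  · exact MarkedCover.type_smul (Ω.link v) ((Ω.starSideMap (A := Aᶜ) hv).pullback F)
      ((Ω.starSideMap (A := Aᶜ) hv).gauge g)

end Sides

namespace CutMorphism

variable {Ω Ω' : BraneComplex D S} {A : Set Ω.Vertex} (c : CutMorphism Ω Ω' A)

/-- The side of `A`, as a part of the complex after the cut. -/
def leftMap : UpperMap (Ω.SideTop A) Ω'.PosTop where
  toOrderEmbedding := OrderEmbedding.ofMapLEIff
    (fun x => ⟨c.toEquiv (.left x.1 x.2.2), by rw [c.dim_eq]; exact x.2.1⟩) fun _ _ => c.le_iff _ _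
  upper {p q} h := by
    obtain ⟨q, hq⟩ := q
    obtain ⟨y, rfl⟩ := c.toEquiv.surjective q
    have h' := (c.le_iff _ _).mp h
    rw [c.dim_eq] at hq
    rcases y with ⟨x, hx⟩ | ⟨x, hx⟩ | _ | _
    · exact ⟨⟨x, hq, hx⟩, rfl⟩
    all_goals exact absurd h' id
  top_iff p := by
    change Ω'.dim (c.toEquiv _) = _ ↔ Ω.dim _ = _
    rw [c.dim_eq]
    rfl

/-- The other side, as a part of the complex after the cut. -/
def rightMap : UpperMap (Ω.SideTop Aᶜ) Ω'.PosTop where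
  toOrderEmbedding := OrderEmbedding.ofMapLEIff
    (fun x => ⟨c.toEquiv (.right x.1 x.2.2), by rw [c.dim_eq]; exact x.2.1⟩) fun _ _ => c.le_iff _ _
  upper {p q} h := by
    obtain ⟨q, hq⟩ := q
    obtain ⟨y, rfl⟩ := c.toEquiv.surjective q
    have h' := (c.le_iff _ _).mp h
    rw [c.dim_eq] at hq
    rcases y with ⟨x, hx⟩ | ⟨x, hx⟩ | _ | _
    · exact absurd h' id
    · exact ⟨⟨x, hq, hx⟩, rfl⟩
    all_goals exact absurd h' id
  top_iff p := by
    change Ω'.dim (c.toEquiv _) = _ ↔ Ω.dim _ = _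
    rw [c.dim_eq]
    rfl

theorem mem_left_or (x : Ω'.PosCell) : (∃ p, c.leftMap p = x) ∨ ∃ q, c.rightMap q = x := by
  obtain ⟨x, hx⟩ := x
  obtain ⟨y, rfl⟩ := c.toEquiv.surjective x
  have hx' := hx
  rw [c.dim_eq] at hx'
  rcases y with ⟨x, h⟩ | ⟨x, h⟩ | _ | _
  · exact Or.inl ⟨⟨x, hx', h⟩, rfl⟩
  · exact Or.inr ⟨⟨x, hx', h⟩, rfl⟩
  · exact absurd hx' (lt_irrefl 0)
  · exact absurd hx' (lt_irrefl 0)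

theorem left_ne_right (p : Ω.Side A) (q : Ω.Side Aᶜ) : c.leftMap p ≠ c.rightMap q := fun h => by
  have := c.toEquiv.injective (congrArg Subtype.val h)
  cases this

/-- After the cut, marked coverings are pairs of marked coverings of the two sides. -/
noncomputable def splitEquiv : MarkedCover Ω'.PosTop d ≃
    MarkedCover (Ω.SideTop A) d × MarkedCover (Ω.SideTop Aᶜ) d :=
  Equiv.ofBijective _
    (MarkedCover.bijective_of_disjoint c.leftMap c.rightMap c.mem_left_or c.left_ne_right)

theorem old_of_mem {v : Ω.Vertex} (hv : v ∈ A) :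
    (c.old v).1 = c.toEquiv (.left v.1 ⟨v, hv, le_rfl⟩) := by
  simp [old, CutCell.old, hv]

theorem old_of_notMem {v : Ω.Vertex} (hv : v ∉ A) :
    (c.old v).1 = c.toEquiv (.right v.1 ⟨v, hv, le_rfl⟩) := by
  simp [old, CutCell.old, hv]

theorem sideInvariant_split (E : MarkedCover Ω'.PosTop d) (v : Ω.Vertex) :
    Ω.sideInvariant A (c.splitEquiv E) v = Ω'.markedInvariant E (c.old v) := by
  rw [sideInvariant]
  split_ifs with hv
  · have hold := c.old_of_mem hv
    obtain ⟨ψ, hψ⟩ := exists_link_iso (q := v) (q' := c.old v)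
      (fun x => c.toEquiv (.left x.1 ⟨v, hv, x.2.le⟩)) (fun x y => c.le_iff _ _)
      (fun x => by
        rw [hold, c.lt_iff]
        exact ⟨x.2.le, fun h => x.2.ne (CutCell.left.inj h)⟩)
      (fun y hy => by
        obtain ⟨x, rfl⟩ := c.toEquiv.surjective y
        have hy' := hy
        rw [hold, c.lt_iff] at hy'
        rcases x with ⟨x, hx⟩ | ⟨x, hx⟩ | _ | _
        · refine ⟨⟨x, lt_of_le_of_ne hy'.1 fun h => hy'.2 ?_⟩, rfl⟩
          subst h
          rfl
        all_goals exact absurd hy'.1 id)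
      (fun x => c.dim_eq _) (fun x y h => c.inc_left _ _ h)
      (fun x hx => (congrArg (Ω'.inc _) hold).trans (c.inc_left _ _ (covBy_of_dim_one x.2 hx)))
      (fun x h h' => c.color_left _ _ _ _)
    rw [markedInvariant, ← MarkedCover.type_pullback ψ]
    refine congrArg (MarkedCover.type (Ω.link v)) ?_
    exact UpperMap.pullback_congr (j := c.leftMap.comp (Ω.starSideMap hv))
      (k := (Ω'.starMap _).comp ψ.upperMap) (fun x => Subtype.ext (hψ x).symm) E
  · have hold := c.old_of_notMem hv
    obtain ⟨ψ, hψ⟩ := exists_link_iso (q := v) (q' := c.old v)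
      (fun x => c.toEquiv (.right x.1 ⟨v, hv, x.2.le⟩)) (fun x y => c.le_iff _ _)
      (fun x => by
        rw [hold, c.lt_iff]
        exact ⟨x.2.le, fun h => x.2.ne (CutCell.right.inj h)⟩)
      (fun y hy => by
        obtain ⟨x, rfl⟩ := c.toEquiv.surjective y
        have hy' := hy
        rw [hold, c.lt_iff] at hy'
        rcases x with ⟨x, hx⟩ | ⟨x, hx⟩ | _ | _
        · exact absurd hy'.1 id
        · refine ⟨⟨x, lt_of_le_of_ne hy'.1 fun h => hy'.2 ?_⟩, rfl⟩
          subst h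
          rfl
        all_goals exact absurd hy'.1 id)
      (fun x => c.dim_eq _) (fun x y h => c.inc_right _ _ h)
      (fun x hx => (congrArg (Ω'.inc _) hold).trans (c.inc_right _ _ (covBy_of_dim_one x.2 hx)))
      (fun x h h' => c.color_right _ _ _ _)
    rw [markedInvariant, ← MarkedCover.type_pullback ψ]
    refine congrArg (MarkedCover.type (Ω.link v)) ?_
    exact UpperMap.pullback_congr (j := c.rightMap.comp (Ω.starSideMap (A := Aᶜ) hv))
      (k := (Ω'.starMap _).comp ψ.upperMap) (fun x => Subtype.ext (hψ x).symm) E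

/-- The vertices after a cut: the old ones and the two new ones. -/
noncomputable def vertexEquiv : Option (Option Ω.Vertex) ≃ Ω'.Vertex :=
  Equiv.ofBijective (fun o => o.elim c.leftPt fun o => o.elim c.rightPt c.old) <| by
    have hL : ∀ v, c.old v ≠ c.leftPt := fun v h => by
      have := c.toEquiv.injective (congrArg Subtype.val h)
      unfold CutCell.old at this
      split_ifs at this
    have hR : ∀ v, c.old v ≠ c.rightPt := fun v h => by
      have := c.toEquiv.injective (congrArg Subtype.val h)
      unfold CutCell.old at this
      split_ifs at this
    constructor
    · rintro (_ | _ | v) (_ | _ | w) h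
      · rfl
      · exact absurd h c.leftPt_ne_rightPt
      · exact absurd h.symm (hL w)
      · exact absurd h.symm c.leftPt_ne_rightPt
      · rfl
      · exact absurd h.symm (hR w)
      · exact absurd h (hL v)
      · exact absurd h (hR v)
      · have := c.toEquiv.injective (congrArg Subtype.val h)
        unfold CutCell.old at this
        refine congrArg (fun v => some (some v)) (Subtype.ext ?_)
        split_ifs at this
        · exact CutCell.left.inj this
        · exact CutCell.right.inj this
    · rintro ⟨v, hv⟩
      obtain ⟨y, rfl⟩ := c.toEquiv.surjective v
      have hv' := hv
      rw [c.dim_eq] at hv'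
      have key : ∀ {w x : Ω.Cell}, Ω.dim x = 0 → w ≤ x → w = x := fun {w x} hx h => by
        by_contra hne
        have := Ω.dim_lt (lt_of_le_of_ne h hne)
        omega
      rcases y with ⟨x, a, ha, hax⟩ | ⟨x, b, hb, hbx⟩ | _ | _
      · obtain rfl := key hv' hax
        exact ⟨some (some a), Subtype.ext (c.old_of_mem ha)⟩
      · obtain rfl := key hv' hbx
        exact ⟨some (some b), Subtype.ext (c.old_of_notMem hb)⟩
      · exact ⟨none, rfl⟩
      · exact ⟨some none, rfl⟩

theorem forall_vertex {p : Ω'.Vertex → Prop} :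
    (∀ q, p q) ↔ p c.leftPt ∧ p c.rightPt ∧ ∀ v, p (c.old v) := by
  rw [← c.vertexEquiv.forall_congr_right, Option.forall, Option.forall]
  rfl

theorem finprod_vertex {M : Type*} [CommMonoid M] (F : Ω'.Vertex → M) :
    ∏ᶠ q, F q = F c.leftPt * (F c.rightPt * ∏ᶠ v, F (c.old v)) := by
  have := Fintype.ofFinite Ω.Vertex
  have := Fintype.ofFinite Ω'.Vertex
  rw [← finprod_comp_equiv c.vertexEquiv, finprod_eq_prod_of_fintype, Fintype.prod_option,
    Fintype.prod_option, finprod_eq_prod_of_fintype]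
  rfl

open Classical in
/-- The number of ways of gluing the two coverings at the new vertices. -/
theorem card_gluings (E : MarkedCover Ω'.PosTop d) :
    Nat.card {γ : Gauge (Ω.CrossTop A) d //
        γ • (Ω.crossLeft A).pullback (c.splitEquiv E).1 =
          (Ω.crossRight A).pullback (c.splitEquiv E).2} =
      if Ω'.markedInvariant E c.rightPt = (Ω'.markedInvariant E c.leftPt).star then
        (Ω'.markedInvariant E c.leftPt).autCard else 0 := by
  let L : {x : Ω.Cell // Ω.Crosses A x} ≃o {y : Ω'.Cell // c.leftPt.1 < y} :=
    RelIso.ofSurjective c.leftIso c.leftIso_surjective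
  have hL : ∀ y : {y : Ω'.Cell // c.leftPt.1 < y},
      y.1 = c.toEquiv (.left (L.symm y).1 (L.symm y).2.1) := fun y =>
    congrArg Subtype.val (L.apply_symm_apply y).symm
  have hdim : ∀ y : {y : Ω'.Cell // c.leftPt.1 < y}, Ω.dim (L.symm y).1 = Ω'.dim y.1 := fun y => by
    rw [hL y, c.dim_eq]
    rfl
  have hcov : ∀ x y : {y : Ω'.Cell // c.leftPt.1 < y}, y.1 ⋖ x.1 →
      (L.symm y).1 ⋖ (L.symm x).1 := fun x y h => by
    refine ⟨L.symm.lt_iff_lt.mpr (show y < x from h.1), fun z h1 h2 => ?_⟩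
    obtain ⟨⟨a, ha, hay⟩, b, hb, hby⟩ := (L.symm y).2
    have hz : Ω.Crosses A z := ⟨⟨a, ha, hay.trans h1.le⟩, b, hb, hby.trans h1.le⟩
    have h3 : y < L ⟨z, hz⟩ := L.symm_apply_lt.mp h1
    have h4 : L ⟨z, hz⟩ < x := L.lt_symm_apply.mp h2
    exact h.2 h3 h4
  obtain ⟨ψ, hψ⟩ := exists_star_link_iso (q := c.leftPt) (q' := c.rightPt)
    (fun y => c.toEquiv (.right (L.symm y).1 (L.symm y).2.2))
    (fun x y => (c.le_iff _ _).trans L.symm.le_iff_le)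
    (fun y => c.lt_iff.mpr ⟨(L.symm y).2.1, fun h => by cases h⟩)
    (fun y hy => by
      obtain ⟨x, hx⟩ := c.rightIso_surjective ⟨y, hy⟩
      refine ⟨L x, ?_⟩
      have h1 := congrArg Subtype.val hx
      refine Eq.trans ?_ h1
      exact congrArg (fun x : {x : Ω.Cell // Ω.Crosses A x} => (c.rightIso x).1)
        (L.symm_apply_apply x))
    (fun y => by
      rw [c.dim_eq]
      exact hdim y)
    (fun x y h => by
      conv_rhs => rw [hL x, hL y]
      exact (c.inc_right _ _ (hcov x y h)).trans (c.inc_left _ _ (hcov x y h)).symm)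
    (fun y hy => by
      conv_rhs => rw [hL y]
      have hd : Ω.dim (L.symm y).1 = 1 := (hdim y).trans hy
      obtain ⟨⟨a, ha, hax⟩, b, hb, hbx⟩ := id (L.symm y).2
      have hax' : a.1 < (L.symm y).1 := lt_of_le_of_ne hax fun h => by
        have := a.2; rw [h] at this; omega
      have hbx' : b.1 < (L.symm y).1 := lt_of_le_of_ne hbx fun h => by
        have := b.2; rw [h] at this; omega
      have hne : a.1 ≠ b.1 := fun h => hb (Subtype.ext h ▸ ha)
      exact (c.inc_rightPt _ a hd ha hax').trans ((Ω.inc_edge hd hax' hbx' hne).trans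
        (congrArg Neg.neg (c.inc_leftPt _ b hd hb hbx').symm)))
    (fun y h h' => by
      have hd : 0 < Ω.dim (L.symm y).1 := lt_of_lt_of_eq h (hdim y).symm
      refine (c.color_right _ _ hd _).trans ?_
      have h3 := c.color_left (L.symm y).1 (L.symm y).2.1 hd (by rw [← hL y]; exact h)
      rw [← h3]
      congr 1
      exact (hL y).symm)
  have htop : ∀ x : {x : Ω.Cell // Ω.Crosses A x},
      (Ω'.vertexComplex c.leftPt).IsTop (L x) ↔ Ω.CrossTop A x := fun x => by
    have h1 : Ω'.dim (L x).1 = Ω.dim x.1 := c.dim_eq _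
    have h2 := Crosses_dim_pos x.2
    change Ω'.dim (L x).1 - 1 = D ↔ Ω.dim x.1 = D + 1
    omega
  let k : UpperMap (Ω.CrossTop A) (Ω'.vertexComplex c.leftPt).IsTop := .ofIso L htop
  let l : UpperMap (Ω.CrossTop A) (Ω'.vertexComplex c.rightPt).IsTop := ψ.upperMap.comp k
  have hk : ((Ω.crossLeft A).pullback (c.splitEquiv E).1) =
      k.pullback ((Ω'.starMap c.leftPt).pullback E) :=
    UpperMap.pullback_congr (j := c.leftMap.comp (Ω.crossLeft A))
      (k := (Ω'.starMap c.leftPt).comp k) (fun _ => rfl) E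
  have hl : ((Ω.crossRight A).pullback (c.splitEquiv E).2) =
      l.pullback ((Ω'.starMap c.rightPt).pullback E) := by
    refine UpperMap.pullback_congr (j := c.rightMap.comp (Ω.crossRight A))
      (k := (Ω'.starMap c.rightPt).comp l) (fun x => Subtype.ext ?_) E
    refine Eq.trans ?_ (hψ (L x)).symm
    exact congrArg (fun x : {x : Ω.Cell // Ω.Crosses A x} => (c.rightIso x).1)
      (L.symm_apply_apply x).symm
  rw [hk, hl]
  refine (MarkedCover.card_smul_pullback_eq
    (X := ⟨(Ω'.link c.leftPt).1.star, (Ω'.link c.leftPt).2⟩) (Y := Ω'.link c.rightPt) ψ k l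
    L.surjective (fun _ => rfl) _ _).trans ?_
  refine if_congr eq_comm ?_ rfl
  exact CoverType.autCard_star (Ω'.markedInvariant E c.leftPt)

open Classical in
/-- Cutting and gluing: after a renumbering of the sheets on one side of the cut, the gluings of two
marked coverings correspond to marked coverings of the original complex. -/
theorem card_markedInvariant_mul (β : Ω.Vertex → CoverType D S d) :
    Ω.markedCount β * Nat.card (Gauge (Ω.CrossTop A) d) =
      Nat.card (Σ E : {E : MarkedCover Ω'.PosTop d // ∀ v, Ω'.markedInvariant E (c.old v) = β v},
        {γ : Gauge (Ω.CrossTop A) d // γ • (Ω.crossLeft A).pullback (c.splitEquiv E.1).1 =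
          (Ω.crossRight A).pullback (c.splitEquiv E.1).2}) := by
  let V := MarkedCover (Ω.SideTop A) d × MarkedCover (Ω.SideTop Aᶜ) d
  choose σ hσ using (Ω.crossRight A).gauge_surjective (d := d)
  -- Twisting the second component by a lift of `γ` replaces the condition that two coverings agree
  -- along the cut by the condition that they agree after renumbering by `γ`.
  let e : V × Gauge (Ω.CrossTop A) d ≃ V × Gauge (Ω.CrossTop A) d :=
    { toFun := fun p => ((p.1.1, σ p.2 • p.1.2), p.2)
      invFun := fun p => ((p.1.1, (σ p.2)⁻¹ • p.1.2), p.2)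
      left_inv := fun p => by simp
      right_inv := fun p => by simp }
  rw [markedCount, ← Nat.card_prod]
  have h1 : Nat.card ({E : MarkedCover Ω.PosTop d // Ω.markedInvariant E = β} ×
      Gauge (Ω.CrossTop A) d) = Nat.card {p : V × Gauge (Ω.CrossTop A) d //
        (Ω.crossLeft A).pullback p.1.1 = (Ω.crossRight A).pullback p.1.2 ∧
          Ω.sideInvariant A p.1 = β} := by
    refine Nat.card_congr
      { toFun := fun p => ⟨((Ω.splitEquiv A p.1.1).1, p.2), (Ω.splitEquiv A p.1.1).2, ?_⟩
        invFun := fun p => ⟨⟨(Ω.splitEquiv A).symm ⟨p.1.1, p.2.1⟩, ?_⟩, p.1.2⟩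
        left_inv := fun p => Prod.ext (Subtype.ext ((Ω.splitEquiv A).symm_apply_apply _)) rfl
        right_inv := fun p => Subtype.ext (Prod.ext
          (congrArg Subtype.val ((Ω.splitEquiv A).apply_symm_apply _)) rfl) }
    · exact (Ω.sideInvariant_split A p.1.1).trans p.1.2
    · rw [← BraneComplex.sideInvariant_split, Equiv.apply_symm_apply, p.2.2]
  have h2 : Nat.card {p : V × Gauge (Ω.CrossTop A) d //
        (Ω.crossLeft A).pullback p.1.1 = (Ω.crossRight A).pullback p.1.2 ∧
          Ω.sideInvariant A p.1 = β} =
      Nat.card {p : V × Gauge (Ω.CrossTop A) d //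
        p.2 • (Ω.crossLeft A).pullback p.1.1 = (Ω.crossRight A).pullback p.1.2 ∧
          Ω.sideInvariant A p.1 = β} := by
    refine Nat.card_congr (e.subtypeEquiv fun p => ?_)
    have h3 : (Ω.crossRight A).pullback (e p).1.2 = p.2 • (Ω.crossRight A).pullback p.1.2 := by
      change (Ω.crossRight A).pullback (σ p.2 • p.1.2) = _
      rw [UpperMap.pullback_smul, hσ]
    have h4 : Ω.sideInvariant A (e p).1 = Ω.sideInvariant A p.1 :=
      Ω.sideInvariant_smul A _ _ _
    rw [h3, h4]
    exact and_congr_left' (smul_left_cancel_iff p.2).symm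
  rw [h1, h2]
  refine (Nat.card_congr (Equiv.ofBijective (fun p => ⟨(c.splitEquiv p.1.1, p.2.1), p.2.2,
    funext fun v => (c.sideInvariant_split p.1.1 v).trans (p.1.2 v)⟩) ⟨?_, ?_⟩)).symm
  · rintro ⟨⟨E, hE⟩, γ, hγ⟩ ⟨⟨E', hE'⟩, γ', hγ'⟩ h
    have h3 := congrArg Subtype.val h
    obtain rfl := c.splitEquiv.injective (congrArg Prod.fst h3)
    obtain rfl : γ = γ' := congrArg Prod.snd h3
    rfl
  · rintro ⟨⟨p, γ⟩, hγ, hp⟩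
    simp only at hγ hp
    obtain ⟨E, rfl⟩ := c.splitEquiv.surjective p
    exact ⟨⟨⟨E, fun v => by rw [← sideInvariant_split, hp]⟩, γ, hγ⟩, rfl⟩

open Classical in
/-- The cut formula for numbers of marked coverings. -/
theorem markedCount_mul (K : Type*) [Field K] (β : Ω.Vertex → CoverType D S d)
    (β' : CoverType D S d → Ω'.Vertex → CoverType D S d) (hold : ∀ b v, β' b (c.old v) = β v)
    (hleft : ∀ b, β' b c.leftPt = b) (hright : ∀ b, β' b c.rightPt = b.star) :
    (Ω.markedCount β : K) * Nat.card (Gauge (Ω.CrossTop A) d) =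
      ∑ᶠ b : CoverType D S d, (b.autCard : K) * Ω'.markedCount (β' b) := by
  have := Fintype.ofFinite (MarkedCover Ω'.PosTop d)
  have hiff : ∀ b (E : MarkedCover Ω'.PosTop d), Ω'.markedInvariant E = β' b ↔
      b = Ω'.markedInvariant E c.leftPt ∧
      Ω'.markedInvariant E c.rightPt = (Ω'.markedInvariant E c.leftPt).star ∧
      ∀ v, Ω'.markedInvariant E (c.old v) = β v := by
    intro b E
    rw [funext_iff, c.forall_vertex, hleft, hright]
    simp_rw [hold]
    constructor
    · rintro ⟨rfl, h, h'⟩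
      exact ⟨rfl, h, h'⟩
    · rintro ⟨rfl, h, h'⟩
      exact ⟨rfl, h, h'⟩
  have hsupp : (Function.support fun b => (b.autCard : K) * Ω'.markedCount (β' b)) ⊆
      ((Finset.univ.image fun E => Ω'.markedInvariant E c.leftPt : Finset (CoverType D S d)) :
        Set (CoverType D S d)) := by
    intro b hb
    have hb' : Ω'.markedCount (β' b) ≠ 0 := fun h => hb (by simp [h])
    obtain ⟨⟨E, hE⟩⟩ := (Nat.card_ne_zero.mp hb').1
    exact Finset.mem_coe.mpr (Finset.mem_image.mpr
      ⟨E, Finset.mem_univ _, ((hiff b E).mp hE).1.symm⟩)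
  rw [finsum_eq_sum_of_support_subset _ hsupp, ← Nat.cast_mul, c.card_markedInvariant_mul,
    Nat.card_sigma]
  simp_rw [c.card_gluings]
  have h1 : ∀ b, Ω'.markedCount (β' b) =
      ∑ E : MarkedCover Ω'.PosTop d, if Ω'.markedInvariant E = β' b then 1 else 0 := fun b => by
    rw [markedCount, Nat.card_eq_fintype_card, Fintype.card_subtype, Finset.card_filter]
  simp_rw [h1]
  push_cast
  simp_rw [Finset.mul_sum]
  rw [Finset.sum_comm, ← Finset.sum_subtype (Finset.univ.filter fun E : MarkedCover Ω'.PosTop d =>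
    ∀ v, Ω'.markedInvariant E (c.old v) = β v) (fun E => by simp) (fun E => if
      Ω'.markedInvariant E c.rightPt = (Ω'.markedInvariant E c.leftPt).star then
        ((Ω'.markedInvariant E c.leftPt).autCard : K) else 0), Finset.sum_filter]
  refine Finset.sum_congr rfl fun E _ => ?_
  rw [Finset.sum_eq_single_of_mem (Ω'.markedInvariant E c.leftPt)
    (Finset.mem_image.mpr ⟨E, Finset.mem_univ _, rfl⟩) fun b _ hb => by
      rw [if_neg fun h => hb ((hiff b E).mp h).1, mul_zero]]
  simp only [hiff, true_and]
  split_ifs <;> simp_all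

open Classical in
/-- The cut formula: the count for `Ω` is the sum over the classes of coverings of the cut. -/
theorem weightedCount_eq (K : Type*) [Field K] [CharZero K] (u : Prop)
    (β : Ω.Vertex → CoverType D S d)
    (β' : CoverType D S d → Ω'.Vertex → CoverType D S d) (hold : ∀ b v, β' b (c.old v) = β v)
    (hleft : ∀ b, β' b c.leftPt = b) (hright : ∀ b, β' b c.rightPt = b.star) :
    Ω.weightedCount K u β = ∑ᶠ b : CoverType D S d,
      (b.autCard : K) / (b.weight u : K) ^ 2 * Ω'.weightedCount K u (β' b) := by
  have h1 := c.markedCount_mul K β β' hold hleft hright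
  have hG : Nat.card (Gauge Ω'.PosTop d) =
      Nat.card (Gauge Ω.PosTop d) * Nat.card (Gauge (Ω.CrossTop A) d) := by
    rw [MarkedCover.card_gauge_of_disjoint c.leftMap c.rightMap c.mem_left_or c.left_ne_right]
    exact (MarkedCover.card_gauge_mul _ _ Ω.mem_side_or _ _ (fun _ => rfl) Ω.exists_cross).symm
  have hw : ∀ b : CoverType D S d, (b.weight u : K) ≠ 0 := fun b =>
    Nat.cast_ne_zero.mpr (b.weight_pos u).ne'
  have hg : (Nat.card (Gauge Ω.PosTop d) : K) ≠ 0 := Nat.cast_ne_zero.mpr Nat.card_pos.ne'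
  have hg' : (Nat.card (Gauge (Ω.CrossTop A) d) : K) ≠ 0 := Nat.cast_ne_zero.mpr Nat.card_pos.ne'
  have h2 : ∀ b, (b.autCard : K) / (b.weight u : K) ^ 2 * Ω'.weightedCount K u (β' b) =
      (b.autCard : K) * Ω'.markedCount (β' b) * ((∏ᶠ v, ((β v).weight u : K)) /
        (Nat.card (Gauge Ω.PosTop d) * Nat.card (Gauge (Ω.CrossTop A) d))) := fun b => by
    rw [weightedCount, c.finprod_vertex, hleft, hright, CoverType.weight_star, hG, Nat.cast_mul]
    simp_rw [hold]
    have := hw b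
    field_simp
  simp_rw [h2]
  rw [← finsum_mul', ← h1, weightedCount]
  · field_simp
  · refine Set.Finite.subset (Set.finite_coe_iff.mp (MarkedCover.finite_base (Ω'.cls c.leftPt)))
      fun b hb => ?_
    have hb' : Ω'.markedCount (β' b) ≠ 0 := fun h => hb (by simp [h])
    have := base_eq_of_markedCount_ne_zero hb' c.leftPt
    rwa [hleft] at this

end CutMorphism

end BraneComplex

/-! ### Coefficients of vectors and of the linear forms -/

theorem ColoredClass.star_star {n : ℕ} {S : Type*} (σ : ColoredClass n S) : σ.star.star = σ := by
  induction σ using Quotient.inductionOn with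
  | _ X =>
    refine Quotient.sound ⟨⟨OrderIso.refl _, fun _ => rfl, fun {x y} _ => ?_, fun _ _ _ => rfl⟩⟩
    change X.1.inc x y = if X.1.dim y = 0 then -(if X.1.dim y = 0 then -X.1.inc x y else _) else
      if X.1.dim y = 0 then _ else X.1.inc x y
    split_ifs <;> simp

theorem CoverType.star_star {n : ℕ} {S : Type*} {d : ℕ} (β : CoverType n S d) :
    β.star.star = β := by
  induction β using Quotient.inductionOn with
  | _ f =>
    let X := f.base
    refine Quotient.sound ⟨⟨⟨OrderIso.refl _, fun _ => rfl, fun {x y} _ => ?_, fun _ _ _ => rfl⟩,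
      OrderIso.refl _, fun _ => rfl⟩⟩
    change X.1.inc x y = if X.1.dim y = 0 then -(if X.1.dim y = 0 then -X.1.inc x y else _) else
      if X.1.dim y = 0 then _ else X.1.inc x y
    split_ifs <;> simp

theorem CoverType.star_injective {n : ℕ} {S : Type*} {d : ℕ} :
    Function.Injective (CoverType.star : CoverType n S d → CoverType n S d) :=
  Function.LeftInverse.injective CoverType.star_star

/-- The involution as a map from the coverings of `σ` to the coverings of `σ*`. -/
def CoverType.starOver {n : ℕ} {S : Type*} {d : ℕ} {σ : ColoredClass n S}
    (β : {β : CoverType n S d // β.base = σ}) : {β : CoverType n S d // β.base = σ.star} :=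
  ⟨β.1.star, β.1.base_star.trans (congrArg _ β.2)⟩

section Coefficients

variable {K : Type*} [Field K] {D : ℕ} {S : Type*} {d : ℕ}

/-- The coefficient of a vector of `C_σ` at any covering, which is zero unless the covering lies
over a complex of class `σ`.  In contrast to the vectors, these coefficients can be compared
for spaces `C_σ` and `C_τ` with `σ` and `τ` only provably equal. -/
noncomputable def coverCoeff {σ : ColoredClass D S} (v : CoverSpace K D S d σ)
    (b : CoverType D S d) : K :=
  Finsupp.mapDomain Subtype.val v b

theorem coverCoeff_apply {σ : ColoredClass D S} (v : CoverSpace K D S d σ)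
    (b : {β : CoverType D S d // β.base = σ}) : coverCoeff v b.1 = v b :=
  Finsupp.mapDomain_apply Subtype.val_injective _ _

theorem coverCoeff_of_base_ne {σ : ColoredClass D S} (v : CoverSpace K D S d σ)
    {b : CoverType D S d} (h : b.base ≠ σ) : coverCoeff v b = 0 :=
  Finsupp.mapDomain_of_notMem_range _ _ fun ⟨a, ha⟩ => h (ha ▸ a.2)

open Classical in
theorem coverCoeff_single {σ : ColoredClass D S} (β : {β : CoverType D S d // β.base = σ})
    (b : CoverType D S d) :
    coverCoeff (Finsupp.single β (1 : K)) b = if b = β.1 then 1 else 0 := by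
  rw [coverCoeff, Finsupp.mapDomain_single, Finsupp.single_apply]
  simp only [eq_comm]

theorem coverCoeff_transport {σ τ : ColoredClass D S} (h : σ = τ) (v : CoverSpace K D S d σ) :
    coverCoeff (transport K (CoverSpace K D S d) h v) = coverCoeff v := by
  subst h
  rfl

/-- The value of the linear form with the values `h` on basis tensors; `T` is any finite set
of coverings which contains the coverings of the vertex complexes. -/
theorem formOf_tprod (h : ∀ Ω : BraneComplex D S, (Ω.Vertex → CoverType D S d) → K)
    (Ω : BraneComplex D S) [Fintype Ω.Vertex] [DecidableEq Ω.Vertex] (T : Finset (CoverType D S d))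
    (hT : ∀ q b, b.base = Ω.cls q → b ∈ T) (x : ∀ q, CoverSpace K D S d (Ω.cls q)) :
    formOf h Ω (PiTensorProduct.tprod K x) =
      ∑ β : Ω.Vertex → T, (∏ q, coverCoeff (x q) (β q).1) * h Ω fun q => (β q).1 := by
  have := fun q => MarkedCover.finite_base (d := d) (Ω.cls q)
  have := Fintype.ofFinite (∀ q, {β : CoverType D S d // β.base = Ω.cls q})
  rw [formOf, Module.Basis.constr_apply_fintype]
  let f : (∀ q, {β : CoverType D S d // β.base = Ω.cls q}) → Ω.Vertex → T :=
    fun p q => ⟨(p q).1, hT q _ (p q).2⟩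
  refine Fintype.sum_of_injective f (fun p p' hp => ?_) _ _ (fun β hβ => ?_) fun p => ?_
  · funext q
    exact Subtype.ext (congrArg (fun a : T => a.1) (congrFun hp q))
  · have : ∃ q, (β q).1.base ≠ Ω.cls q := by
      by_contra hcon
      push Not at hcon
      exact hβ ⟨fun q => ⟨(β q).1, hcon q⟩, rfl⟩
    obtain ⟨q, hq⟩ := this
    rw [Finset.prod_eq_zero (Finset.mem_univ q) (coverCoeff_of_base_ne _ hq), zero_mul]
  · simp only [Module.Basis.equivFun_apply, Basis.piTensorProduct_repr_tprod_apply, smul_eq_mul]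
    congr 1
    refine Finset.prod_congr rfl fun q _ => ?_
    exact (coverCoeff_apply (x q) (p q)).symm

/-- Finitely many classes of complexes have finitely many coverings. -/
theorem exists_finset_covers {ι : Type*} [Finite ι] (σ : ι → ColoredClass D S) (d : ℕ) :
    ∃ T : Finset (CoverType D S d), ∀ i b, b.base = σ i → b ∈ T := by
  have h : (⋃ i, {b : CoverType D S d | b.base = σ i}).Finite :=
    Set.finite_iUnion fun i => Set.finite_coe_iff.mp (MarkedCover.finite_base (σ i))
  exact ⟨h.toFinset, fun i b hb => h.mem_toFinset.mpr (Set.mem_iUnion.mpr ⟨i, hb⟩)⟩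

/-! ### Pairings and tensors -/

variable (K) in
/-- The form `C_σ × C_σ* → K` with the value `w(β)² / |Aut β|` at `(β, β*)`. -/
noncomputable def coverPairing (u : Prop) (d : ℕ) (σ : ColoredClass D S) :
    CoverSpace K D S d σ →ₗ[K] CoverSpace K D S d σ.star →ₗ[K] K :=
  Finsupp.linearCombination K fun β =>
    ((β.1.weight u : K) ^ 2 / β.1.autCard) • Finsupp.lapply (CoverType.starOver β)

variable (K) in
/-- The tensor in `C_σ ⊗ C_σ*` which is inverse to `coverPairing`. -/
noncomputable def coverTensor (u : Prop) (d : ℕ) (σ : ColoredClass D S) :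
    CoverSpace K D S d σ ⊗[K] CoverSpace K D S d σ.star :=
  ∑ᶠ β : {β : CoverType D S d // β.base = σ}, ((β.1.autCard : K) / (β.1.weight u : K) ^ 2) •
    (Finsupp.single β 1 ⊗ₜ[K] Finsupp.single (CoverType.starOver β) 1)

theorem coverPairing_single_left (u : Prop) {σ : ColoredClass D S}
    (β : {β : CoverType D S d // β.base = σ}) (w : CoverSpace K D S d σ.star) :
    coverPairing K u d σ (Finsupp.single β 1) w =
      (β.1.weight u : K) ^ 2 / β.1.autCard * w (CoverType.starOver β) := by
  simp [coverPairing]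

theorem coverPairing_apply (u : Prop) {σ : ColoredClass D S} (T : Finset (CoverType D S d))
    (hT : ∀ b, b.base = σ → b ∈ T) (v : CoverSpace K D S d σ) (w : CoverSpace K D S d σ.star) :
    coverPairing K u d σ v w = ∑ b : T,
      coverCoeff v b.1 * coverCoeff w b.1.star * ((b.1.weight u : K) ^ 2 / b.1.autCard) := by
  have := MarkedCover.finite_base (d := d) σ
  have := Fintype.ofFinite {β : CoverType D S d // β.base = σ}
  rw [coverPairing, Finsupp.linearCombination_apply,
    Finsupp.sum_fintype _ _ fun _ => by rw [zero_smul],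
    LinearMap.sum_apply]
  refine Fintype.sum_of_injective (fun β => ⟨β.1, hT _ β.2⟩) (fun β β' h => ?_) _ _ (fun b hb => ?_)
    fun β => ?_
  · exact Subtype.ext (congrArg (fun a : T => a.1) h)
  · rw [coverCoeff_of_base_ne v fun h => hb ⟨⟨b.1, h⟩, rfl⟩, zero_mul, zero_mul]
  · have h2 : coverCoeff w β.1.star = w (CoverType.starOver β) :=
      coverCoeff_apply w (CoverType.starOver β)
    simp only [coverCoeff_apply, h2, LinearMap.smul_apply, Finsupp.lapply_apply, smul_eq_mul]
    ring

theorem coverPairing_factor_ne_zero [CharZero K] (u : Prop) (β : CoverType D S d) :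
    (β.weight u : K) ^ 2 / β.autCard ≠ 0 :=
  div_ne_zero (pow_ne_zero _ (Nat.cast_ne_zero.mpr (β.weight_pos u).ne'))
    (Nat.cast_ne_zero.mpr (MarkedCover.autCard_pos β).ne')

theorem coverPairing_nondegenerate [CharZero K] (u : Prop) (d : ℕ) (σ : ColoredClass D S) :
    (coverPairing K u d σ).Nondegenerate := by
  classical
  refine ⟨fun v hv => Finsupp.ext fun β => ?_, fun w hw => Finsupp.ext fun γ => ?_⟩
  · have h := hv (Finsupp.single (CoverType.starOver β) 1)
    obtain ⟨T, hT⟩ := exists_finset_covers (fun _ : Unit => σ) d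
    rw [coverPairing_apply u T (hT ()), Finset.sum_eq_single ⟨β.1, hT () _ β.2⟩] at h
    · rw [coverCoeff_single, coverCoeff_apply] at h
      simpa [CoverType.starOver, coverPairing_factor_ne_zero u β.1] using h
    · intro b _ hb
      rw [coverCoeff_single, if_neg, mul_zero, zero_mul]
      exact fun h => hb (Subtype.ext (CoverType.star_injective h))
    · exact fun h => absurd (Finset.mem_univ _) h
  · have hγ : γ.1.star.base = σ := by rw [γ.1.base_star, γ.2, σ.star_star]
    have h := hw (Finsupp.single ⟨γ.1.star, hγ⟩ 1)
    rw [coverPairing_single_left] at h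
    have h2 := (mul_eq_zero.mp h).resolve_left (coverPairing_factor_ne_zero u _)
    rwa [show CoverType.starOver ⟨γ.1.star, hγ⟩ = γ from Subtype.ext γ.1.star_star] at h2

/-- The tensor is inverse to the pairing. -/
theorem lift_coverTensor [CharZero K] (u : Prop) (d : ℕ) (σ : ColoredClass D S)
    (v : CoverSpace K D S d σ) :
    TensorProduct.rid K _ (TensorProduct.map LinearMap.id (coverPairing K u d σ v)
      (coverTensor K u d σ)) = v := by
  classical
  have := MarkedCover.finite_base (d := d) σ
  have := Fintype.ofFinite {β : CoverType D S d // β.base = σ}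
  induction v using Finsupp.induction_linear with
  | zero => simp
  | add v w hv hw => simp only [map_add, TensorProduct.map_add_right, LinearMap.add_apply, hv, hw]
  | single β a =>
    rw [← mul_one a, ← smul_eq_mul, ← Finsupp.smul_single, map_smul, TensorProduct.map_smul_right,
      LinearMap.smul_apply, map_smul]
    congr 1
    rw [coverTensor, finsum_eq_sum_of_fintype, map_sum, map_sum, Finset.sum_eq_single β]
    · simp only [map_smul, TensorProduct.map_tmul, TensorProduct.rid_tmul, LinearMap.id_apply,
        coverPairing_single_left, Finsupp.single_eq_same, mul_one, smul_smul]
      rw [← inv_div, inv_mul_cancel₀ (coverPairing_factor_ne_zero u β.1), one_smul]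
    · intro γ _ hγ
      have hne : CoverType.starOver β ≠ CoverType.starOver γ := fun h =>
        hγ (Subtype.ext (CoverType.star_injective (congrArg Subtype.val h)).symm)
      simp [coverPairing_single_left, Finsupp.single_eq_of_ne hne]
    · exact fun h => absurd (Finset.mem_univ _) h

end Coefficients

theorem finsum_eq_sum_covers {M : Type*} [AddCommMonoid M] {D : ℕ} {S : Type*} {d : ℕ}
    (σ : ColoredClass D S) [Fintype {β : CoverType D S d // β.base = σ}] (f : CoverType D S d → M)
    (hf : ∀ b, f b ≠ 0 → b.base = σ) :
    ∑ᶠ b, f b = ∑ β : {β : CoverType D S d // β.base = σ}, f β.1 := by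
  rw [← finsum_eq_sum_of_fintype, ← finsum_mem_range Subtype.val_injective, ← finsum_mem_support f,
    ← finsum_mem_inter_support f (Set.range _), Set.inter_eq_self_of_subset_right]
  exact fun b hb => ⟨⟨b, hf b hb⟩, rfl⟩

/-! ### Inverse tensors and associativity -/

/-- A tensor which is inverse to a pairing has the entries of the inverse matrix of the pairing as
coefficients. -/
theorem eq_sum_inv_tmul {K V W : Type*} [Field K] [AddCommGroup V] [Module K V] [AddCommGroup W]
    [Module K W] {m : ℕ} (η : V →ₗ[K] W →ₗ[K] K) (κ : V ⊗[K] W)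
    (hκ : ∀ v, TensorProduct.rid K _ (TensorProduct.map LinearMap.id (η v) κ) = v)
    (b : Module.Basis (Fin m) K V) (b' : Module.Basis (Fin m) K W) :
    κ = ∑ i, ∑ j, (Matrix.of fun i j => η (b i) (b' j))⁻¹ j i • (b i ⊗ₜ[K] b' j) := by
  let M : Matrix (Fin m) (Fin m) K := Matrix.of fun i j => (b.tensorProduct b').repr κ (i, j)
  have h1 : κ = ∑ i, ∑ j, M i j • (b i ⊗ₜ[K] b' j) := by
    conv_lhs => rw [← (b.tensorProduct b').sum_repr κ]
    rw [Fintype.sum_prod_type]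
    simp only [Module.Basis.tensorProduct_apply]
    rfl
  have h2 : (Matrix.of fun i j => η (b i) (b' j)) * M.transpose = 1 := by
    ext l i
    have h := congrArg (fun v => b.repr v i) (hκ (b l))
    rw [h1] at h
    simp only [map_sum, map_smul, TensorProduct.map_tmul, TensorProduct.rid_tmul,
      LinearMap.id_apply, Finsupp.coe_finsetSum, Finset.sum_apply, Finsupp.smul_apply,
      Module.Basis.repr_self, smul_eq_mul] at h
    rw [Finset.sum_eq_single i (fun k _ hk => by simp [Finsupp.single_eq_of_ne' hk])
      (fun h => absurd (Finset.mem_univ _) h)] at h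
    simp only [Finsupp.single_eq_same, mul_one] at h
    rw [Matrix.mul_apply, Matrix.one_apply, ← Finsupp.single_apply, ← h]
    exact Finset.sum_congr rfl fun j _ => mul_comm _ _
  rw [Matrix.inv_eq_right_inv h2]
  exact h1

/-- A description of `pairAt` that does not involve decidable equality. -/
theorem exists_pairAt_eq {K : Type*} [Field K] {ι : Type*} {M : ι → Type*}
    [∀ i, AddCommGroup (M i)] [∀ i, Module K (M i)] (Φ : (⨂[K] i, M i) →ₗ[K] K) (x : ∀ i, M i)
    {i j : ι} (h : i ≠ j) (a : M i) (b : M j) :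
    ∃ z : ∀ i, M i, z i = a ∧ z j = b ∧ (∀ k, k ≠ i → k ≠ j → z k = x k) ∧
      pairAt Φ x h a b = Φ (PiTensorProduct.tprod K z) := by
  classical
  refine ⟨Function.update (Function.update x i a) j b, ?_, ?_, fun k hi hj => ?_, ?_⟩
  · rw [Function.update_of_ne h, Function.update_self]
  · rw [Function.update_self]
  · rw [Function.update_of_ne hj, Function.update_of_ne hi]
  · rw [pairAt, LinearMap.mk₂_apply]

section BraneTFT

variable {K : Type*} [Field K] {D : ℕ} {S : Type*} {B : ColoredClass D S → Type*}
  [∀ σ, AddCommGroup (B σ)] [∀ σ, Module K (B σ)]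

/-- If the tensors are inverse to the pairings, then gluing the two parts of a cut complex computes
the value for the original complex. -/
theorem IsBraneTFT.glueSum_eq {κ : ∀ σ, B σ ⊗[K] B σ.star}
    {η : ∀ σ, B σ →ₗ[K] B σ.star →ₗ[K] K} {Φ : ∀ Ω : BraneComplex D S, StateSpace K B Ω →ₗ[K] K}
    (H : IsBraneTFT κ η Φ)
    (hκ : ∀ σ v, TensorProduct.rid K _ (TensorProduct.map LinearMap.id (η σ v) (κ σ)) = v)
    {Ω Ω' : BraneComplex D S} {A : Set Ω.Vertex} {c : Ω.CutMorphism Ω' A} {Ω₁ Ω₂ : BraneComplex D S}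
    (u : c.Splitting Ω₁ Ω₂) (x : ∀ q, B (Ω.cls q)) (y : ∀ q, B (Ω'.cls q))
    (hy : ∀ v, y (c.old v) = transport K B (c.cls_old v) (x v)) {m : ℕ}
    (b : Module.Basis (Fin m) K (B (Ω'.cls c.leftPt)))
    (b' : Module.Basis (Fin m) K (B (Ω'.cls c.rightPt))) :
    glueSum η Φ u y b b' = Φ Ω (PiTensorProduct.tprod K x) := by
  rw [← H.cut c x y hy, eq_sum_inv_tmul (η _) (κ _) (hκ _) b
    (b'.map (transport K B c.star_cls_leftPt.symm)), glueSum]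
  have htr : ∀ w, transport K B c.star_cls_leftPt (transport K B c.star_cls_leftPt.symm w) = w := by
    have : ∀ {σ τ : ColoredClass D S} (h : σ = τ) (w : B τ),
        transport K B h (transport K B h.symm w) = w := by
      rintro σ _ rfl w
      rfl
    exact this _
  simp only [map_sum, map_smul, TensorProduct.lift.tmul, LinearMap.compl₂_apply,
    Module.Basis.map_apply, LinearEquiv.coe_coe, htr, smul_eq_mul]
  refine Finset.sum_congr rfl fun i _ => Finset.sum_congr rfl fun j _ => ?_
  rw [mul_right_comm, ← H.multiplicativity u.toDisjointUnion, mul_comm, pairAt,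
    LinearMap.mk₂_apply]
  congr!

/-- Associativity compares two ways of computing the value for one complex with four vertices. -/
theorem IsBraneTFT.isColoredFrobenius {κ : ∀ σ, B σ ⊗[K] B σ.star}
    {η : ∀ σ, B σ →ₗ[K] B σ.star →ₗ[K] K} {Φ : ∀ Ω : BraneComplex D S, StateSpace K B Ω →ₗ[K] K}
    (H : IsBraneTFT κ η Φ)
    (hκ : ∀ σ v, TensorProduct.rid K _ (TensorProduct.map LinearMap.id (η σ v) (κ σ)) = v) :
    IsColoredFrobenius η Φ where
  finiteDimensional := H.finiteDimensional
  nondegenerate := H.nondegenerate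
  invariance φ x x' _ _ h := H.invariance φ x x' h
  associativity _ _ _ _ _ _ _ _ _ _ _ u u' x y y' hy hy' _ _ _ _ _ _ := by
    rw [H.glueSum_eq hκ u x y hy, H.glueSum_eq hκ u' x y' hy']

end BraneTFT

/-! ### The field theories of weighted counts -/

section Hurwitz

variable {K : Type*} [Field K] {D : ℕ} {S : Type*} {d : ℕ}

theorem formOf_weightedCount_iso (u : Prop) {Ω Ω' : BraneComplex D S} (φ : Ω.Iso Ω')
    (x : ∀ q, CoverSpace K D S d (Ω.cls q)) (x' : ∀ q, CoverSpace K D S d (Ω'.cls q))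
    (h : ∀ q, x' (BraneComplex.mapVertex φ.toIso q) =
      transport K (CoverSpace K D S d) (φ.cls_eq q) (x q)) :
    formOf (fun Ω => Ω.weightedCount K u) Ω' (PiTensorProduct.tprod K x') =
      formOf (fun Ω => Ω.weightedCount K u) Ω (PiTensorProduct.tprod K x) := by
  classical
  have := Fintype.ofFinite Ω.Vertex
  have := Fintype.ofFinite Ω'.Vertex
  let e := Equiv.ofBijective _ (BraneComplex.mapVertex_bijective φ)
  obtain ⟨T, hT⟩ := exists_finset_covers Ω'.cls d
  have hT' : ∀ q b, b.base = Ω.cls q → b ∈ T := fun q b hb =>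
    hT (e q) b (hb.trans (φ.cls_eq q))
  rw [formOf_tprod _ _ T hT, formOf_tprod _ _ T hT', ← (e.symm.arrowCongr (Equiv.refl T)).sum_comp]
  refine Finset.sum_congr rfl fun β _ => ?_
  rw [Ω.weightedCount_iso K u φ]
  congr 1
  rw [← e.prod_comp]
  refine Finset.prod_congr rfl fun q _ => ?_
  change coverCoeff (x' (BraneComplex.mapVertex φ.toIso q)) _ = _
  rw [h, coverCoeff_transport]
  rfl

theorem formOf_weightedCount_disjointUnion (w : Prop) {Ω Ω₁ Ω₂ : BraneComplex D S}
    (u : Ω.DisjointUnion Ω₁ Ω₂) (x : ∀ q, CoverSpace K D S d (Ω.cls q)) :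
    formOf (fun Ω => Ω.weightedCount K w) Ω (PiTensorProduct.tprod K x) =
      formOf (fun Ω => Ω.weightedCount K w) Ω₁ (PiTensorProduct.tprod K fun q =>
        transport K (CoverSpace K D S d) (u.cls_inl q).symm (x (u.inl q))) *
      formOf (fun Ω => Ω.weightedCount K w) Ω₂ (PiTensorProduct.tprod K fun q =>
        transport K (CoverSpace K D S d) (u.cls_inr q).symm (x (u.inr q))) := by
  classical
  have := Fintype.ofFinite Ω.Vertex
  have := Fintype.ofFinite Ω₁.Vertex
  have := Fintype.ofFinite Ω₂.Vertex
  obtain ⟨T, hT⟩ := exists_finset_covers Ω.cls d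
  rw [formOf_tprod _ _ T hT, formOf_tprod _ _ T fun q b hb => hT _ b (hb.trans (u.cls_inl q)),
    formOf_tprod _ _ T fun q b hb => hT _ b (hb.trans (u.cls_inr q)), Fintype.sum_mul_sum,
    ← Fintype.sum_prod_type',
    ← ((u.vertexEquiv.arrowCongr (Equiv.refl T)).symm.trans
      (Equiv.sumArrowEquivProdArrow Ω₁.Vertex Ω₂.Vertex T)).sum_comp]
  refine Finset.sum_congr rfl fun β _ => ?_
  rw [u.weightedCount_eq, ← u.vertexEquiv.prod_comp, Fintype.prod_sum_type, mul_mul_mul_comm]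
  simp only [coverCoeff_transport]
  rfl

/-- Values at the vertices of the complex after a cut, given by values at the new and at the old
vertices. -/
noncomputable def BraneComplex.CutMorphism.extend {Ω Ω' : BraneComplex D S} {A : Set Ω.Vertex}
    (c : Ω.CutMorphism Ω' A) {C : Type*} (l r : C) (γ : Ω.Vertex → C) (v : Ω'.Vertex) : C :=
  (c.vertexEquiv.symm v).elim l fun o => o.elim r γ

theorem BraneComplex.CutMorphism.extend_leftPt {Ω Ω' : BraneComplex D S} {A : Set Ω.Vertex}
    (c : Ω.CutMorphism Ω' A) {C : Type*} (l r : C) (γ : Ω.Vertex → C) :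
    c.extend l r γ c.leftPt = l := by
  rw [extend, show c.leftPt = c.vertexEquiv none from rfl, Equiv.symm_apply_apply]
  rfl

theorem BraneComplex.CutMorphism.extend_rightPt {Ω Ω' : BraneComplex D S} {A : Set Ω.Vertex}
    (c : Ω.CutMorphism Ω' A) {C : Type*} (l r : C) (γ : Ω.Vertex → C) :
    c.extend l r γ c.rightPt = r := by
  rw [extend, show c.rightPt = c.vertexEquiv (some none) from rfl, Equiv.symm_apply_apply]
  rfl

theorem BraneComplex.CutMorphism.extend_old {Ω Ω' : BraneComplex D S} {A : Set Ω.Vertex}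
    (c : Ω.CutMorphism Ω' A) {C : Type*} (l r : C) (γ : Ω.Vertex → C) (v : Ω.Vertex) :
    c.extend l r γ (c.old v) = γ v := by
  rw [extend, show c.old v = c.vertexEquiv (some (some v)) from rfl, Equiv.symm_apply_apply]
  rfl

open Classical in
/-- Inserting a covering and its opposite at the new vertices keeps the coefficients at the old
ones. -/
theorem pairAt_formOf_single (u : Prop) {Ω Ω' : BraneComplex D S} {A : Set Ω.Vertex}
    (c : Ω.CutMorphism Ω' A) [Fintype Ω.Vertex] (T : Finset (CoverType D S d))
    (hT : ∀ q b, b.base = Ω'.cls q → b ∈ T) (x : ∀ q, CoverSpace K D S d (Ω.cls q))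
    (x' : ∀ q, CoverSpace K D S d (Ω'.cls q))
    (h : ∀ q, x' (c.old q) = transport K (CoverSpace K D S d) (c.cls_old q) (x q))
    (β : {β : CoverType D S d // β.base = Ω'.cls c.leftPt}) :
    pairAt (formOf (fun Ω => Ω.weightedCount K u) Ω') x' c.leftPt_ne_rightPt (Finsupp.single β 1)
        (transport K (CoverSpace K D S d) c.star_cls_leftPt
          (Finsupp.single (CoverType.starOver β) 1)) =
      ∑ γ : Ω.Vertex → T, (∏ q, coverCoeff (x q) (γ q).1) *
        Ω'.weightedCount K u (c.extend β.1 β.1.star fun q => (γ q).1) := by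
  have := Fintype.ofFinite Ω'.Vertex
  let e : T × T × (Ω.Vertex → T) ≃ (Ω'.Vertex → T) :=
    { toFun := fun p => c.extend p.1 p.2.1 p.2.2
      invFun := fun β => (β c.leftPt, β c.rightPt, fun v => β (c.old v))
      left_inv := fun p => by
        simp only [c.extend_leftPt, c.extend_rightPt, c.extend_old]
      right_inv := fun β => funext <| c.forall_vertex.mpr
        ⟨c.extend_leftPt _ _ _, c.extend_rightPt _ _ _, c.extend_old _ _ _⟩ }
  have hstar : β.1.star.base = Ω'.cls c.rightPt := by
    rw [β.1.base_star, β.2, c.star_cls_leftPt]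
  have hl : ∀ v, c.old v ≠ c.leftPt := fun v h => by
    have := c.vertexEquiv.injective (a₁ := some (some v)) (a₂ := none) h
    cases this
  have hr : ∀ v, c.old v ≠ c.rightPt := fun v h => by
    have := c.vertexEquiv.injective (a₁ := some (some v)) (a₂ := some none) h
    cases this
  have hval : ∀ z : ∀ q, CoverSpace K D S d (Ω'.cls q), z c.leftPt = Finsupp.single β 1 →
      z c.rightPt = transport K (CoverSpace K D S d) c.star_cls_leftPt
        (Finsupp.single (CoverType.starOver β) 1) → (∀ v, z (c.old v) = x' (c.old v)) →
      formOf (fun Ω => Ω.weightedCount K u) Ω' (PiTensorProduct.tprod K z) =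
      ∑ γ : Ω.Vertex → T, (∏ q, coverCoeff (x q) (γ q).1) *
        Ω'.weightedCount K u (c.extend β.1 β.1.star fun q => (γ q).1) := by
    intro z hzl hzr hzo
    rw [formOf_tprod _ _ T hT, ← e.sum_comp, Fintype.sum_prod_type]
    have hprod : ∀ p : T × T × (Ω.Vertex → T), ∏ q, coverCoeff (z q) (e p q).1 =
        (if p.1.1 = β.1 then 1 else 0) * ((if p.2.1.1 = β.1.star then 1 else 0) *
          ∏ q, coverCoeff (x q) (p.2.2 q).1) := by
      intro p
      rw [← finprod_eq_prod_of_fintype, c.finprod_vertex, finprod_eq_prod_of_fintype, hzl, hzr,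
        coverCoeff_transport, coverCoeff_single, coverCoeff_single]
      change (if (c.extend _ _ _ _ : T).1 = _ then _ else _) *
        ((if (c.extend _ _ _ _ : T).1 = _ then _ else _) *
          ∏ q, coverCoeff _ (c.extend _ _ _ _ : T).1) = _
      simp only [c.extend_leftPt, c.extend_rightPt, c.extend_old, hzo, h, coverCoeff_transport]
      rfl
    simp only [hprod]
    rw [Finset.sum_eq_single ⟨β.1, hT _ _ β.2⟩, Fintype.sum_prod_type,
      Finset.sum_eq_single ⟨β.1.star, hT _ _ hstar⟩]
    · refine Finset.sum_congr rfl fun γ _ => ?_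
      simp only [if_true, one_mul]
      congr 2
      refine funext <| c.forall_vertex.mpr ⟨?_, ?_, fun v => ?_⟩
      · rw [c.extend_leftPt]
        exact congrArg Subtype.val (c.extend_leftPt _ _ _)
      · rw [c.extend_rightPt]
        exact congrArg Subtype.val (c.extend_rightPt _ _ _)
      · rw [c.extend_old]
        exact congrArg Subtype.val (c.extend_old _ _ _ v)
    · intro r _ hr
      refine Finset.sum_eq_zero fun γ _ => ?_
      rw [if_neg (c := r.1 = _) fun h => hr (Subtype.ext h), zero_mul, mul_zero, zero_mul]
    · exact fun h => absurd (Finset.mem_univ _) h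
    · intro l _ hl
      refine Finset.sum_eq_zero fun γ _ => ?_
      rw [if_neg (c := l.1 = _) fun h => hl (Subtype.ext h), zero_mul, zero_mul]
    · exact fun h => absurd (Finset.mem_univ _) h
  obtain ⟨z, hzl, hzr, hzo, hz⟩ := exists_pairAt_eq (formOf (fun Ω => Ω.weightedCount K u) Ω') x'
    c.leftPt_ne_rightPt (Finsupp.single β 1) (transport K (CoverSpace K D S d) c.star_cls_leftPt
      (Finsupp.single (CoverType.starOver β) 1))
  rw [hz]
  exact hval z hzl hzr fun v => hzo _ (hl v) (hr v)

variable [CharZero K]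

theorem formOf_weightedCount_two (u : Prop) {Ω : BraneComplex D S} {q₁ q₂ : Ω.Vertex}
    (hne : q₁ ≠ q₂) (h : ∀ v, v = q₁ ∨ v = q₂) (x : ∀ q, CoverSpace K D S d (Ω.cls q)) :
    coverPairing K u d (Ω.cls q₁) (x q₁) (transport K (CoverSpace K D S d)
        (BraneComplex.star_cls_eq_of_two hne h).symm (x q₂)) =
      formOf (fun Ω => Ω.weightedCount K u) Ω (PiTensorProduct.tprod K x) := by
  classical
  have := Fintype.ofFinite Ω.Vertex
  obtain ⟨T, hT⟩ := exists_finset_covers Ω.cls d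
  let e : T × T ≃ (Ω.Vertex → T) :=
    { toFun := fun p v => if v = q₁ then p.1 else p.2
      invFun := fun β => (β q₁, β q₂)
      left_inv := fun p => by simp [hne.symm]
      right_inv := fun β => by
        funext v
        rcases h v with rfl | rfl
        · simp
        · simp [hne.symm] }
  have huniv : (Finset.univ : Finset Ω.Vertex) = {q₁, q₂} := by
    ext v
    simpa using h v
  rw [coverPairing_apply u T (hT q₁), formOf_tprod _ _ T hT, coverCoeff_transport, ← e.sum_comp,
    Fintype.sum_prod_type, huniv]
  refine Finset.sum_congr rfl fun a _ => ?_
  simp only [Finset.prod_pair hne]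
  have h1 : ∀ t, e (a, t) q₁ = a := fun t => if_pos rfl
  have h2 : ∀ t, e (a, t) q₂ = t := fun t => if_neg hne.symm
  by_cases ha : a.1.base = Ω.cls q₁
  · have hstar : a.1.star.base = Ω.cls q₂ := by
      rw [a.1.base_star, ha, BraneComplex.star_cls_eq_of_two hne h]
    rw [Finset.sum_eq_single ⟨a.1.star, hT q₂ _ hstar⟩]
    · rw [Ω.weightedCount_two K u hne h _ (by rwa [h1]), h1, h2, if_pos rfl]
    · intro t _ ht
      rw [Ω.weightedCount_two K u hne h _ (by rwa [h1]), h1, h2,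
        if_neg fun h => ht (Subtype.ext h), mul_zero]
    · exact fun h => absurd (Finset.mem_univ _) h
  · rw [coverCoeff_of_base_ne _ ha, zero_mul, zero_mul, Finset.sum_eq_zero]
    intro t _
    rw [h1, coverCoeff_of_base_ne _ ha, zero_mul, zero_mul]

theorem formOf_weightedCount_cut (u : Prop) {Ω Ω' : BraneComplex D S} {A : Set Ω.Vertex}
    (c : Ω.CutMorphism Ω' A) (x : ∀ q, CoverSpace K D S d (Ω.cls q))
    (x' : ∀ q, CoverSpace K D S d (Ω'.cls q))
    (h : ∀ q, x' (c.old q) = transport K (CoverSpace K D S d) (c.cls_old q) (x q)) :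
    TensorProduct.lift ((pairAt (formOf (fun Ω => Ω.weightedCount K u) Ω') x'
        c.leftPt_ne_rightPt).compl₂
        (transport K (CoverSpace K D S d) c.star_cls_leftPt).toLinearMap)
        (coverTensor K u d (Ω'.cls c.leftPt)) =
      formOf (fun Ω => Ω.weightedCount K u) Ω (PiTensorProduct.tprod K x) := by
  classical
  have := Fintype.ofFinite Ω.Vertex
  have := Fintype.ofFinite Ω'.Vertex
  have := MarkedCover.finite_base (d := d) (Ω'.cls c.leftPt)
  have := Fintype.ofFinite {β : CoverType D S d // β.base = Ω'.cls c.leftPt}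
  obtain ⟨T, hT⟩ := exists_finset_covers Ω'.cls d
  rw [formOf_tprod _ _ T fun q b hb => hT _ b (hb.trans (c.cls_old q)), coverTensor,
    finsum_eq_sum_of_fintype, map_sum]
  simp only [map_smul, TensorProduct.lift.tmul, LinearMap.compl₂_apply, LinearEquiv.coe_coe,
    pairAt_formOf_single u c T hT x x' h, smul_eq_mul, Finset.mul_sum]
  rw [Finset.sum_comm]
  refine Finset.sum_congr rfl fun γ _ => ?_
  rw [c.weightedCount_eq K u _ (fun b => c.extend b b.star fun q => (γ q).1)
    (fun b v => c.extend_old _ _ _ v) (fun b => c.extend_leftPt _ _ _)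
    (fun b => c.extend_rightPt _ _ _),
    finsum_eq_sum_covers (Ω'.cls c.leftPt), Finset.mul_sum]
  · exact Finset.sum_congr rfl fun b _ => mul_left_comm _ _ _
  · intro b hb
    have h := BraneComplex.base_eq_of_weightedCount_ne_zero (right_ne_zero_of_mul hb) c.leftPt
    rwa [c.extend_leftPt] at h

/-- The weighted counts form a field theory; the two values of `u` give the theories of all and of
the unglued coverings. -/
theorem isBraneTFT_weightedCount (u : Prop) :
    IsBraneTFT (coverTensor K u d) (coverPairing K u d)
      (formOf fun Ω : BraneComplex D S => Ω.weightedCount (d := d) K u) where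
  finiteDimensional σ := by
    have := MarkedCover.finite_base (d := d) σ
    infer_instance
  invariance φ x x' h := formOf_weightedCount_iso u φ x x' h
  pairing hne h x := formOf_weightedCount_two u hne h x
  nondegenerate := coverPairing_nondegenerate u d
  cut c x x' h := formOf_weightedCount_cut u c x x' h
  multiplicativity v x := formOf_weightedCount_disjointUnion u v x

theorem isColoredFrobenius_weightedCount (u : Prop) :
    IsColoredFrobenius (coverPairing K u d)
      (formOf fun Ω : BraneComplex D S => Ω.weightedCount (d := d) K u) :=
  (isBraneTFT_weightedCount u).isColoredFrobenius fun σ v => lift_coverTensor u d σ v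

theorem gluingFormula_weightedCount {u : Prop} (hu : u) :
    GluingFormula fun Ω : BraneComplex D S => Ω.weightedCount (d := d) K u := by
  intro Ω Ω' A c Ω₁ Ω₂ v β β' hold hleft hright
  change Ω.weightedCount K u β = _
  rw [c.weightedCount_eq K u β β' hold hleft hright]
  refine finsum_congr fun b => ?_
  rw [v.toDisjointUnion.weightedCount_eq, b.weight_of_true hu, Nat.cast_one, one_pow, div_one,
    mul_assoc]

end Hurwitz

theorem theorem4p1 (K : Type*) [Field K] [CharZero K] (S : Type*) (D d : ℕ) :
    (∀ Ω : BraneComplex D S, Finite (CoverClass Ω.toSimpleComplex d)) ∧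
    (∃ (κ : ∀ σ, CoverSpace K D S d σ ⊗[K] CoverSpace K D S d σ.star)
      (η : ∀ σ, CoverSpace K D S d σ →ₗ[K] CoverSpace K D S d σ.star →ₗ[K] K),
      IsBraneTFT κ η (formOf fun Ω => Ω.hurwitz (d := d) K) ∧
      IsColoredFrobenius η (formOf fun Ω => Ω.hurwitz (d := d) K)) ∧
    (∃ (κ : ∀ σ, CoverSpace K D S d σ ⊗[K] CoverSpace K D S d σ.star)
      (η : ∀ σ, CoverSpace K D S d σ →ₗ[K] CoverSpace K D S d σ.star →ₗ[K] K),
      (∀ σ, κ σ = ∑ᶠ β : {β : CoverType D S d // β.base = σ}, (β.1.autCard : K) •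
        (Finsupp.single β 1 ⊗ₜ[K]
          Finsupp.single ⟨β.1.star, β.1.base_star.trans (congrArg _ β.2)⟩ 1)) ∧
      (∀ σ β γ, γ.1 = β.1.star →
        η σ (Finsupp.single β 1) (Finsupp.single γ 1) = 1 / (β.1.autCard : K)) ∧
      (∀ σ β γ, γ.1 ≠ β.1.star → η σ (Finsupp.single β 1) (Finsupp.single γ 1) = 0) ∧
      IsBraneTFT κ η (formOf fun Ω => Ω.ungluedHurwitz (d := d) K) ∧
      IsColoredFrobenius η (formOf fun Ω => Ω.ungluedHurwitz (d := d) K)) ∧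
    GluingFormula fun Ω : BraneComplex D S => Ω.ungluedHurwitz (d := d) K := by
  have hH : (fun Ω : BraneComplex D S => Ω.hurwitz (d := d) K) =
      fun Ω => Ω.weightedCount K False := by
    funext Ω β
    exact Ω.hurwitz_eq K β
  have hU : (fun Ω : BraneComplex D S => Ω.ungluedHurwitz (d := d) K) =
      fun Ω => Ω.weightedCount K True := by
    funext Ω β
    exact Ω.ungluedHurwitz_eq K β
  have hw : ∀ β : CoverType D S d, (β.weight True : K) = 1 := fun β => by
    rw [β.weight_of_true trivial, Nat.cast_one]
  refine ⟨fun Ω => CoverClass.finite _, ⟨coverTensor K False d, coverPairing K False d, ?_, ?_⟩,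
    ⟨coverTensor K True d, coverPairing K True d, fun σ => ?_, fun σ β γ h => ?_,
      fun σ β γ h => ?_, ?_, ?_⟩, ?_⟩
  · rw [hH]
    exact isBraneTFT_weightedCount False
  · rw [hH]
    exact isColoredFrobenius_weightedCount False
  · simp only [coverTensor, hw, one_pow, div_one]
    rfl
  · rw [coverPairing_single_left, show γ = CoverType.starOver β from Subtype.ext h,
      Finsupp.single_eq_same, mul_one, hw, one_pow]
  · rw [coverPairing_single_left,
      Finsupp.single_eq_of_ne fun h' => h (congrArg Subtype.val h'.symm),
      mul_zero]
  · rw [hU]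
    exact isBraneTFT_weightedCount True
  · rw [hU]
    exact isColoredFrobenius_weightedCount True
  · rw [hU]
    exact gluingFormula_weightedCount trivial
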